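/- Let $G$ be a real (analytic) Lie group with Lie algebra $\mathfrak g$, and let $K\subset G$ be a closed subgroup with Lie algebra $\mathfrak k$. Let $P\colon G\to G/K$ be the projection, where $G/K$ has its analytic manifold structure for which $P$ is a submersion. Complexifications are denoted by $\mathfrak g^{\mathbb C}$, $\mathfrak k^{\mathbb C}$, $T^{\mathbb C}(G/K)$, $N^{\mathbb C}$, and bars denote conjugation with respect to the real forms. Let $s\ge 1$, $p\ge 0$, $2p\le s$, and let $\lambda_1,\dots,\lambda_s\in\mathbb C$ be distinct with $\lambda_i=\overline{\lambda_{i+p}}$ for $i=1,\dots,p$ and $\lambda_j\in\mathbb R$ for $j=2p+1,\dots,s$. Consider (i) the analytic $(1,1)$-tensors $N\colon T(G/K)\to T(G/K)$ that are $G$-invariant, semisimple at every point, with spectrum of $N^{\mathbb C}$ equal to $\{\lambda_1,\dots,\lambda_s\}$, and Nijenhuis, i.e. $[NX,NY]-N([NX,Y]+[X,NY]-N[X,Y])=0$ for all analytic (local) vector fields $X,Y$; (ii) the decompositions $\mathfrak g^{\mathbb C}=\mathfrak g_1+\dots+\mathfrak g_s$ into sums of complex subspaces $\mathfrak g_i\neq\mathfrak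 k^{\mathbb C}$ such that 1. $\mathfrak g_i\cap\mathfrak g_j=\mathfrak k^{\mathbb C}$ for all $i\ne j$; 2. $\mathfrak g^{\mathbb C}/\mathfrak k^{\mathbb C}=(\mathfrak g_1/\mathfrak k^{\mathbb C})\oplus\dots\oplus(\mathfrak g_s/\mathfrak k^{\mathbb C})$; 3. $\mathfrak g_i+\mathfrak g_j$ is a Lie subalgebra of $\mathfrak g^{\mathbb C}$ for all $i,j$ (including $i=j$); 4. $\mathfrak g_i=\overline{\mathfrak g_{i+p}}$ for $i=1,\dots,p$, and $\mathfrak g_j=\overline{\mathfrak g_j}$ for $j=2p+1,\dots,s$; 5. every $\mathfrak g_i$ is $\operatorname{Ad}(K)$-invariant. Then $N\mapsto(\mathfrak g_1,\dots,\mathfrak g_s)$, where $\mathfrak g_i=\{v\in\mathfrak g^{\mathbb C} : N^{\mathbb C}P_*v=\lambda_iP_*v\}$ (here $P_*$ is the complexified differential of $P$ at the identity), is a bijection from (i) onto (ii). If $K$ is connected, then it is also a bijection from (i) onto the set of decompositions that satisfy 1–4 only (condition 5 can be dropped). Moreover, every decomposition in (ii) induces a decomposition $T^{\mathbb C}(G/K)=D_1\oplus\dots\oplus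 D_s$ into involutive analytic subbundles, given by $(D_i)_{aK}=P_*(L_a)_*\mathfrak g_i$ for all $a\in G$ (with $L_a$ the left translation by $a$), and the corresponding tensor is given by $N^{\mathbb C}|_{D_i}=\lambda_i\operatorname{Id}_{D_i}$. Vice versa, for $N$ in (i) the eigendistributions $D_i=\ker(N^{\mathbb C}-\lambda_i)$ form such a decomposition of $T^{\mathbb C}(G/K)$, and they are the distributions induced by the $\mathfrak g_i$ constructed from $N$. -/

import Mathlib

open scoped Manifold ContDiff Topology TensorProduct

noncomputable section

namespace HomNij

/-! ### Complexification -/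

section Complexification

variable (V : Type*) [AddCommGroup V] [Module ℝ V]

/-- Complex conjugation `z ⊗ v ↦ conj z ⊗ v` on `V^ℂ = ℂ ⊗ V`, with respect to the real form `V`. -/
def conjugation : (ℂ ⊗[ℝ] V) →ₗ[ℝ] (ℂ ⊗[ℝ] V) :=
  LinearMap.rTensor V Complex.conjAe.toLinearMap

variable {V}

/-- The complex vector `v + i w` of `V^ℂ`. -/
def complexVector (v w : V) : ℂ ⊗[ℝ] V := (1 : ℂ) ⊗ₜ[ℝ] v + Complex.I ⊗ₜ[ℝ] w

end Complexification

/-! ### Analytic manifolds: (1,1)-tensors and complex distributions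

Everything is real analytic. `M` is a manifold of dimension `m`. -/

section Manifolds

variable (m : ℕ) (M : Type*) [TopologicalSpace M] [ChartedSpace (EuclideanSpace ℝ (Fin m)) M]

/-- A (not necessarily continuous) vector field on `M`. -/
abbrev VField : Type _ := (x : M) → TangentSpace (𝓡 m) x

/-- A field of endomorphisms of the tangent spaces of `M`. -/
abbrev EndField : Type _ := (x : M) → (TangentSpace (𝓡 m) x →L[ℝ] TangentSpace (𝓡 m) x)

/-- A field of complex subspaces of the complexified tangent spaces of `M`. -/
abbrev ComplexDistribution : Type _ :=
  (x : M) → Submodule ℂ (ℂ ⊗[ℝ] TangentSpace (𝓡 m) x)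

variable {m M} [IsManifold (𝓡 m) ω M]

/-- The vector field `X` is analytic near the point `x`. -/
def AnalyticVFieldAt (X : VField m M) (x : M) : Prop :=
  ContMDiffAt (𝓡 m) (𝓡 m).tangent ω (fun y => (⟨y, X y⟩ : TangentBundle (𝓡 m) M)) x

/-- `N`, as a bundle map `TM → TM`, is analytic. -/
def AnalyticEndField (N : EndField m M) : Prop :=
  ContMDiff (𝓡 m).tangent (𝓡 m).tangent ω
    (fun v : TangentBundle (𝓡 m) M => (⟨v.1, N v.1 v.2⟩ : TangentBundle (𝓡 m) M))

/-- The vector field `N X`. -/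
def EndField.app (N : EndField m M) (X : VField m M) : VField m M := fun x => N x (X x)

/-- The value at `x` of the Nijenhuis torsion
`T_N(X,Y) = [NX,NY] - N ([NX,Y] + [X,NY] - N[X,Y])`. -/
def nijenhuisTorsion (N : EndField m M) (X Y : VField m M) (x : M) : TangentSpace (𝓡 m) x :=
  VectorField.mlieBracket (𝓡 m) (N.app X) (N.app Y) x
    - N x (VectorField.mlieBracket (𝓡 m) (N.app X) Y x
        + VectorField.mlieBracket (𝓡 m) X (N.app Y) x
        - N x (VectorField.mlieBracket (𝓡 m) X Y x))

/-- The Nijenhuis torsion of `N` vanishes, on all (locally defined) analytic vector fields. -/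
def IsNijenhuis (N : EndField m M) : Prop :=
  ∀ (x : M) (X Y : VField m M), AnalyticVFieldAt X x → AnalyticVFieldAt Y x →
    nijenhuisTorsion N X Y x = 0

/-- The complexification `N^ℂ` of `N` at `x`. -/
def EndField.complexify (N : EndField m M) (x : M) :
    Module.End ℂ (ℂ ⊗[ℝ] TangentSpace (𝓡 m) x) :=
  LinearMap.baseChange ℂ (N x : TangentSpace (𝓡 m) x →ₗ[ℝ] TangentSpace (𝓡 m) x)

/-- The distribution of eigenspaces of `N^ℂ` for `μ`. -/
def eigenDistribution (N : EndField m M) (μ : ℂ) : ComplexDistribution m M :=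
  fun x => Module.End.eigenspace (N.complexify x) μ

/-- `D` is an analytic subbundle of `T^ℂ M`: near every point it is spanned by a frame of
pointwise linearly independent complex vector fields `X k + i Y k` with `X k`, `Y k` analytic. -/
def IsAnalyticSubbundle (D : ComplexDistribution m M) : Prop :=
  ∀ x : M, ∃ (r : ℕ) (X Y : Fin r → VField m M),
    (∀ k, AnalyticVFieldAt (X k) x ∧ AnalyticVFieldAt (Y k) x) ∧
    ∀ᶠ y in 𝓝 x, LinearIndependent ℂ (fun k => complexVector (X k y) (Y k y)) ∧
      D y = Submodule.span ℂ (Set.range fun k => complexVector (X k y) (Y k y))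

/-- The bracket at `x` of the complex vector fields `X + i Y` and `U + i V` (the complex bilinear
extension of the Lie bracket of vector fields). -/
def complexBracket (X Y U V : VField m M) (x : M) : ℂ ⊗[ℝ] TangentSpace (𝓡 m) x :=
  complexVector
    (VectorField.mlieBracket (𝓡 m) X U x - VectorField.mlieBracket (𝓡 m) Y V x)
    (VectorField.mlieBracket (𝓡 m) X V x + VectorField.mlieBracket (𝓡 m) Y U x)

/-- `D` is involutive: the bracket of two local analytic sections of `D` lies in `D`. -/
def IsInvolutive (D : ComplexDistribution m M) : Prop :=
  ∀ (x : M) (X Y U V : VField m M),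
    AnalyticVFieldAt X x → AnalyticVFieldAt Y x → AnalyticVFieldAt U x → AnalyticVFieldAt V x →
    (∀ᶠ y in 𝓝 x, complexVector (X y) (Y y) ∈ D y) →
    (∀ᶠ y in 𝓝 x, complexVector (U y) (V y) ∈ D y) →
    complexBracket X Y U V x ∈ D x

end Manifolds

/-! ### Lie groups and closed subgroups -/

section LieGroups

variable {d : ℕ} {G : Type*} [TopologicalSpace G] [ChartedSpace (EuclideanSpace ℝ (Fin d)) G]
  [Group G]

variable (d G) in
/-- The complexification `𝔤^ℂ` of the Lie algebra `𝔤 = T_1 G`. -/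
abbrev ComplexLieAlg : Type _ := ℂ ⊗[ℝ] GroupLieAlgebra (𝓡 d) G

/-- `v ∈ T_1 G` is the velocity at `t = 0` of a germ of a `C^1` curve lying in `K` and passing
through `1` at `t = 0`. -/
def IsTangentToSubgroup (K : Subgroup G) (v : GroupLieAlgebra (𝓡 d) G) : Prop :=
  ∃ γ : ℝ → G, γ 0 = 1 ∧ (∀ᶠ t in 𝓝 (0 : ℝ), γ t ∈ K) ∧
    ContMDiffAt 𝓘(ℝ, ℝ) (𝓡 d) 1 γ 0 ∧
    HasMFDerivAt 𝓘(ℝ, ℝ) (𝓡 d) γ 0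
      (ContinuousLinearMap.toSpanSingleton ℝ (v : EuclideanSpace ℝ (Fin d)))

theorem IsTangentToSubgroup.zero (K : Subgroup G) :
    IsTangentToSubgroup K (0 : GroupLieAlgebra (𝓡 d) G) := by
  refine ⟨fun _ => 1, rfl, Filter.Eventually.of_forall fun _ => K.one_mem, contMDiffAt_const, ?_⟩
  have h := hasMFDerivAt_const (I := 𝓘(ℝ, ℝ)) (I' := 𝓡 d) (1 : G) (0 : ℝ)
  have e : (ContinuousLinearMap.toSpanSingleton ℝ (0 : EuclideanSpace ℝ (Fin d))) = 0 :=
    ContinuousLinearMap.toSpanSingleton_zero ℝ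
  exact h.congr_mfderiv e.symm

theorem IsTangentToSubgroup.smul {K : Subgroup G} {v : GroupLieAlgebra (𝓡 d) G} (c : ℝ)
    (hv : IsTangentToSubgroup K v) : IsTangentToSubgroup K (c • v) := by
  obtain ⟨γ, h0, hK, hs, hd⟩ := hv
  have hl : HasMFDerivAt 𝓘(ℝ, ℝ) 𝓘(ℝ, ℝ) (fun t : ℝ => c * t) 0
      (c • ContinuousLinearMap.id ℝ ℝ) :=
    ((hasFDerivAt_id (𝕜 := ℝ) (0 : ℝ)).const_mul c).hasMFDerivAt
  have hc : ContMDiffAt 𝓘(ℝ, ℝ) 𝓘(ℝ, ℝ) 1 (fun t : ℝ => c * t) 0 :=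
    (contDiff_const.mul contDiff_id).contMDiff.contMDiffAt
  have e0 : c * (0 : ℝ) = 0 := mul_zero c
  refine ⟨fun t => γ (c * t), by simp [h0], ?_, ?_, ?_⟩
  · have : Filter.Tendsto (fun t : ℝ => c * t) (𝓝 0) (𝓝 0) := by
      have := hc.continuousAt.tendsto
      rwa [e0] at this
    exact this.eventually hK
  · exact ContMDiffAt.comp (0 : ℝ) (by rwa [e0]) hc
  · have hd' : HasMFDerivAt 𝓘(ℝ, ℝ) (𝓡 d) γ (c * (0 : ℝ))
        (ContinuousLinearMap.toSpanSingleton ℝ (v : EuclideanSpace ℝ (Fin d))) := by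
      rwa [e0]
    refine (HasMFDerivAt.comp (0 : ℝ) hd' hl).congr_mfderiv ?_
    ext1
    change (c * (1 : ℝ)) • (v : EuclideanSpace ℝ (Fin d)) =
      (1 : ℝ) • (c • (v : EuclideanSpace ℝ (Fin d)))
    rw [mul_one, one_smul]

variable [LieGroup (𝓡 d) ω G]

/-- The differential of the multiplication at `(1, 1)` is the addition. -/
theorem mfderiv_mul_one_one {a b : G} (ha : a = 1) (hb : b = 1) (v w : EuclideanSpace ℝ (Fin d)) :
    mfderiv ((𝓡 d).prod (𝓡 d)) (𝓡 d) (fun q : G × G => q.1 * q.2) (a, b) (v, w) = v + w := by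
  subst ha hb
  have hm : MDifferentiableAt ((𝓡 d).prod (𝓡 d)) (𝓡 d) (fun q : G × G => q.1 * q.2)
      ((1 : G), (1 : G)) := (contMDiff_mul (𝓡 d) ω).mdifferentiableAt (by simp)
  refine (mfderiv_prod_eq_add_apply (v := (v, w)) hm).trans ?_
  have e1 : mfderiv (𝓡 d) (𝓡 d) (fun z : G => z * 1) 1 v = v := by
    have : (fun z : G => z * 1) = id := by ext z; simp
    rw [this, mfderiv_id]
    rfl
  have e2 : mfderiv (𝓡 d) (𝓡 d) (fun z : G => 1 * z) 1 w = w := by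
    have : (fun z : G => 1 * z) = id := by ext z; simp
    rw [this, mfderiv_id]
    rfl
  exact congrArg₂ (fun x y : EuclideanSpace ℝ (Fin d) => x + y) e1 e2

theorem IsTangentToSubgroup.add {K : Subgroup G} {v w : GroupLieAlgebra (𝓡 d) G}
    (hv : IsTangentToSubgroup K v) (hw : IsTangentToSubgroup K w) :
    IsTangentToSubgroup K (v + w) := by
  obtain ⟨γ, h0, hK, hs, hd⟩ := hv
  obtain ⟨η, k0, kK, ks, kd⟩ := hw
  refine ⟨fun t => γ t * η t, by simp [h0, k0], ?_, hs.mul ks, ?_⟩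
  · filter_upwards [hK, kK] with t ht kt using K.mul_mem ht kt
  · have hm : MDifferentiableAt ((𝓡 d).prod (𝓡 d)) (𝓡 d) (fun q : G × G => q.1 * q.2)
        (γ 0, η 0) := (contMDiff_mul (𝓡 d) ω).mdifferentiableAt (by simp)
    have key := HasMFDerivAt.comp (0 : ℝ) hm.hasMFDerivAt (hd.prodMk kd)
    refine key.congr_mfderiv (ContinuousLinearMap.ext_ring ?_)
    have h := mfderiv_mul_one_one (d := d) h0 k0 v w
    change mfderiv ((𝓡 d).prod (𝓡 d)) (𝓡 d) (fun q : G × G => q.1 * q.2) (γ 0, η 0)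
      ((1 : ℝ) • (v : EuclideanSpace ℝ (Fin d)), (1 : ℝ) • (w : EuclideanSpace ℝ (Fin d)))
      = (1 : ℝ) • ((v : EuclideanSpace ℝ (Fin d)) + (w : EuclideanSpace ℝ (Fin d)))
    rw [one_smul, one_smul, one_smul]
    exact h

/-- The Lie algebra `𝔨` of a closed subgroup `K` of `G`, as a subspace of `𝔤 = T_1 G`: the
velocities at `1` of the curves lying in `K`. -/
def lieAlgOf (K : Subgroup G) : Submodule ℝ (GroupLieAlgebra (𝓡 d) G) where
  carrier := {v | IsTangentToSubgroup K v}
  zero_mem' := IsTangentToSubgroup.zero K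
  add_mem' := IsTangentToSubgroup.add
  smul_mem' c _ hv := IsTangentToSubgroup.smul c hv

variable (d) in
/-- The complexification `𝔨^ℂ ⊆ 𝔤^ℂ`. -/
def complexLieAlgOf (K : Subgroup G) : Submodule ℂ (ComplexLieAlg d G) :=
  (lieAlgOf (d := d) K).baseChange ℂ

variable (d) in
/-- The adjoint action `Ad a : 𝔤 → 𝔤`, the differential at `1` of `b ↦ a b a⁻¹`. -/
def adjoint (a : G) : GroupLieAlgebra (𝓡 d) G →L[ℝ] GroupLieAlgebra (𝓡 d) G :=
  mfderiv (𝓡 d) (𝓡 d) (fun b : G => a * b * a⁻¹) 1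

/-- The decompositions `𝔤^ℂ = 𝔤_1 + ⋯ + 𝔤_s` attached to `K` and to the conjugation pattern
`i ↔ i + p` (`i < p`), `j ↔ j` (`j ≥ 2 p`), where indices are counted from `0`. -/
structure IsNijenhuisDecomposition (K : Subgroup G) (p : ℕ) {s : ℕ}
    (g : Fin s → Submodule ℂ (ComplexLieAlg d G)) : Prop where
  sum_eq : ⨆ i, g i = ⊤
  inter_eq : ∀ i j, i ≠ j → g i ⊓ g j = complexLieAlgOf d K
  /-- no summand of the induced decomposition of `𝔤^ℂ / 𝔨^ℂ` vanishes -/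
  ne : ∀ i, g i ≠ complexLieAlgOf d K
  direct : DirectSum.IsInternal fun i => (g i).map (complexLieAlgOf d K).mkQ
  lie_mem : ∀ i j, ∀ v ∈ g i ⊔ g j, ∀ w ∈ g i ⊔ g j, ⁅v, w⁆ ∈ g i ⊔ g j
  conj_pair : ∀ i j : Fin s, (i : ℕ) < p → (j : ℕ) = i + p →
    (g i : Set (ComplexLieAlg d G)) = conjugation _ '' (g j)
  conj_real : ∀ j : Fin s, 2 * p ≤ (j : ℕ) →
    (g j : Set (ComplexLieAlg d G)) = conjugation _ '' (g j)

/-- All the subspaces `g i` are `Ad(K)`-invariant. -/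
def IsAdInvariant (K : Subgroup G) {s : ℕ} (g : Fin s → Submodule ℂ (ComplexLieAlg d G)) : Prop :=
  ∀ a ∈ K, ∀ i, (g i).map (LinearMap.baseChange ℂ
    (adjoint d a : GroupLieAlgebra (𝓡 d) G →ₗ[ℝ] GroupLieAlgebra (𝓡 d) G)) = g i

end LieGroups

/-! ### Homogeneous spaces -/

section Homogeneous

variable {d m : ℕ} {G : Type*} [TopologicalSpace G] [ChartedSpace (EuclideanSpace ℝ (Fin d)) G]
  [Group G] (K : Subgroup G) [ChartedSpace (EuclideanSpace ℝ (Fin m)) (G ⧸ K)]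
  [IsManifold (𝓡 m) ω (G ⧸ K)]

variable {K} in
/-- `N` commutes with the differentials of the diffeomorphisms `x ↦ a • x` of `G/K`. -/
def IsInvariantEndField (N : EndField m (G ⧸ K)) : Prop :=
  ∀ (a : G) (x : G ⧸ K) (v : TangentSpace (𝓡 m) x),
    N (a • x) (mfderiv (𝓡 m) (𝓡 m) (fun y : G ⧸ K => a • y) x v)
      = mfderiv (𝓡 m) (𝓡 m) (fun y : G ⧸ K => a • y) x (N x v)

variable {K} in
/-- `N` is a `G`-invariant semisimple Nijenhuis (1,1)-tensor on `G/K` with the spectrum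
`{lam 0, …, lam (s-1)}`. -/
structure IsInvariantSemisimpleNijenhuis {s : ℕ} (lam : Fin s → ℂ)
    (N : EndField m (G ⧸ K)) : Prop where
  analytic : AnalyticEndField N
  invariant : IsInvariantEndField N
  semisimple : ∀ x, Module.End.IsSemisimple
    (N x : TangentSpace (𝓡 m) x →ₗ[ℝ] TangentSpace (𝓡 m) x)
  spectrum_eq : ∀ x, spectrum ℂ (N.complexify x) = Set.range lam
  nijenhuis : IsNijenhuis N

variable (d m) in
/-- The complexified differential `𝔤^ℂ → T^ℂ_{aK}(G/K)` at `1` of `P ∘ L_a`, where `L_a` is the left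
translation by `a` and `P : G → G/K` is the projection: `v ↦ P_* (L_a)_* v`. -/
def translateProj (a : G) :
    ComplexLieAlg d G →ₗ[ℂ] ℂ ⊗[ℝ] TangentSpace (𝓡 m) (a : G ⧸ K) :=
  LinearMap.baseChange ℂ
    (((mfderiv (𝓡 d) (𝓡 m) (fun b : G => (b : G ⧸ K)) a).comp
      (show GroupLieAlgebra (𝓡 d) G →L[ℝ] TangentSpace (𝓡 d) a from
        mfderiv (𝓡 d) (𝓡 d) (fun b : G => a * b) 1) :
      GroupLieAlgebra (𝓡 d) G →L[ℝ] TangentSpace (𝓡 m) (a : G ⧸ K)) :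
      GroupLieAlgebra (𝓡 d) G →ₗ[ℝ] TangentSpace (𝓡 m) (a : G ⧸ K))

variable {K} in
/-- `D` is the distribution on `G/K` induced by the subspace `W ⊆ 𝔤^ℂ`: it is the projection of the
left invariant distribution on `G` with value `W` at `1`, `D_{aK} = P_* (L_a)_* W` for all `a`. -/
def IsInducedBy (D : ComplexDistribution m (G ⧸ K)) (W : Submodule ℂ (ComplexLieAlg d G)) : Prop :=
  ∀ a : G, D (a : G ⧸ K) = W.map (translateProj d m K a)

variable {K} in
/-- The decomposition constructed from `N`: `𝔤_i` is the preimage in `𝔤^ℂ` of the eigenspace of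
`N^ℂ` for `lam i` at the base point `K` of `G/K`, under the complexified differential of `P`. -/
def eigenDecomposition {s : ℕ} (lam : Fin s → ℂ) (N : EndField m (G ⧸ K)) :
    Fin s → Submodule ℂ (ComplexLieAlg d G) :=
  fun i => (eigenDistribution N (lam i) ((1 : G) : G ⧸ K)).comap (translateProj d m K 1)

variable {K} in
/-- `T^ℂ(G/K) = D_1 ⊕ ⋯ ⊕ D_s` is a decomposition into involutive subbundles induced by the `g i`. -/
structure IsInducedDecomposition {s : ℕ} (g : Fin s → Submodule ℂ (ComplexLieAlg d G))
    (D : Fin s → ComplexDistribution m (G ⧸ K)) : Prop where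
  induced : ∀ i, IsInducedBy (D i) (g i)
  direct : ∀ x, DirectSum.IsInternal fun i => D i x
  subbundle : ∀ i, IsAnalyticSubbundle (D i)
  involutive : ∀ i, IsInvolutive (D i)

end Homogeneous

end HomNij

end

/-! A `G`-invariant tensor `N` on `G/K` is determined by its value `N₀` on `T_o(G/K) = 𝔤/𝔨`. An
endomorphism `N₀` extends to an invariant tensor exactly when it commutes with the isotropy action
of `K`, and the extension is then automatically analytic. Semisimplicity and spectrum can be read
off at the base point, so the main point is to express the Nijenhuis condition on `𝔤`.

Translating a vector field on `G/K` back to the base point gives a function `G → T_o(G/K)`. In this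
picture `N` becomes the constant `N₀`, and the bracket becomes `[f, h] + (D_f h - D_h f)` in the
left trivialization of `TG` (`vbr_leftField`, `vbr_of_lift`). The derivative terms cancel in the
torsion (`nijenhuisTorsion_eq`), and what remains is the algebraic identity `IsAlgNijenhuis`. That
identity is required for arbitrary lifts `v'`, `w'` to `𝔤` of `N₀ π v`, `N₀ π w`. The choice `v =
0`, `v' ∈ 𝔨` therefore says that `N₀` commutes with the action of `𝔨`.

After complexification, take `v ∈ 𝔤_i` and `w ∈ 𝔤_j`. The identity with `v' = λ_i v`, `w' = λ_j w`
says `(N₀ - λ_i)(N₀ - λ_j) π[v, w] = 0`. For semisimple `N₀` this means `[v, w] ∈ 𝔤_i + 𝔤_j`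
(`mem_eigenspace_sup`, `IsAlgNijenhuis.lie_mem`). Conversely, the identity is additive in the pairs
`(v, v')` and `(w, w')`, so it only has to be checked on eigenvectors and on `𝔨`
(`isAlgNijenhuis_of_lie_mem`). A decomposition defines an operator with value `λ_i` on `𝔤_i/𝔨^ℂ`;
the conjugation conditions make it real (`exists_end_of_decomposition`).

When `K` is connected, commutation with `𝔨` integrates to commutation with `K`. Along a curve in `K`
the defect satisfies a linear differential equation with zero initial value, so it vanishes near
`1`, and an open subgroup of a connected group is the whole group
(`IsAlgNijenhuis.commute_isotropy`). The eigendistributions are involutive by the argument above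
with `i = j`, applied to vector fields. -/

noncomputable section

namespace HomNij

open VectorField

set_option linter.unusedSectionVars false

/-! ### Brackets of vector fields related by a smooth map. -/

section ManifoldLemmas

variable {n n' : ℕ} {M M' : Type*}
  [TopologicalSpace M] [ChartedSpace (EuclideanSpace ℝ (Fin n)) M] [IsManifold (𝓡 n) ω M]
  [TopologicalSpace M'] [ChartedSpace (EuclideanSpace ℝ (Fin n')) M'] [IsManifold (𝓡 n') ω M']

/-- The vector field `X`, read in the preferred chart at `x`. -/
def chartVField (x : M) (X : VField n M) (u : EuclideanSpace ℝ (Fin n)) :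
    EuclideanSpace ℝ (Fin n) :=
  mfderiv (𝓡 n) 𝓘(ℝ, EuclideanSpace ℝ (Fin n)) (extChartAt (𝓡 n) x)
    ((extChartAt (𝓡 n) x).symm u) (X ((extChartAt (𝓡 n) x).symm u))

lemma chartVField_eventuallyEq (x : M) (X : VField n M) :
    mpullbackWithin 𝓘(ℝ, EuclideanSpace ℝ (Fin n)) (𝓡 n) (extChartAt (𝓡 n) x).symm X
      (Set.range (𝓡 n)) =ᶠ[𝓝 (extChartAt (𝓡 n) x x)] chartVField x X := by
  filter_upwards [extChartAt_target_mem_nhds (I := 𝓡 n) x] with u hu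
  rw [mpullbackWithin_apply]
  have hs : (extChartAt (𝓡 n) x).symm u ∈ (extChartAt (𝓡 n) x).source :=
    (extChartAt (𝓡 n) x).map_target hu
  have h1 := mfderivWithin_extChartAt_symm_comp_mfderiv_extChartAt' (I := 𝓡 n) hs
  have h2 := mfderiv_extChartAt_comp_mfderivWithin_extChartAt_symm (I := 𝓡 n) hu
  rw [(extChartAt (𝓡 n) x).right_inv hu] at h1
  have := ContinuousLinearMap.inverse_eq h1 h2
  rw [this]
  rfl

lemma differentiableAt_chartVField {x : M} {X : VField n M}
    (hX : MDifferentiableAt (𝓡 n) (𝓡 n).tangent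
      (fun y => (⟨y, X y⟩ : TangentBundle (𝓡 n) M)) x) :
    DifferentiableAt ℝ (chartVField x X) (extChartAt (𝓡 n) x x) := by
  rw [← mdifferentiableWithinAt_univ] at hX
  have h := hX.differentiableWithinAt_mpullbackWithin_vectorField
  have e : (extChartAt (𝓡 n) x).symm ⁻¹' Set.univ ∩ Set.range (𝓡 n) = Set.univ := by simp
  rw [e] at h
  exact (differentiableWithinAt_univ.1 h).congr_of_eventuallyEq (chartVField_eventuallyEq x X).symm

/-- The bracket on a manifold is defined by pulling back the bracket computed in the chart, and the
differential of the chart is invertible, so it undoes the pullback. -/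
lemma mfderiv_extChartAt_mlieBracket (x : M) (X Y : VField n M) :
    mfderiv (𝓡 n) 𝓘(ℝ, EuclideanSpace ℝ (Fin n)) (extChartAt (𝓡 n) x) x
      (mlieBracket (𝓡 n) X Y x) =
      lieBracket ℝ (chartVField x X) (chartVField x Y) (extChartAt (𝓡 n) x x) := by
  rw [← mlieBracketWithin_univ, mlieBracketWithin_apply]
  have hinv : (mfderiv (𝓡 n) 𝓘(ℝ, EuclideanSpace ℝ (Fin n)) (extChartAt (𝓡 n) x) x).IsInvertible :=
    isInvertible_mfderiv_extChartAt (mem_extChartAt_source x)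
  refine (hinv.self_apply_inverse _).trans ?_
  have e : (extChartAt (𝓡 n) x).symm ⁻¹' Set.univ ∩ Set.range (𝓡 n) = Set.univ := by simp
  rw [e]
  refine (congrFun (lieBracketWithin_univ (𝕜 := ℝ) (E := EuclideanSpace ℝ (Fin n))) _).trans ?_
  exact (chartVField_eventuallyEq x X).lieBracket_vectorField_eq (chartVField_eventuallyEq x Y)

/-- The bracket of vector fields which are `F`-related to `X'`, `Y'` is `F`-related to
`[X', Y']`. -/
theorem mlieBracket_of_related {F : M → M'} {x : M} (hF : ContMDiffAt (𝓡 n) (𝓡 n') ω F x)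
    {X Y : VField n M} {X' Y' : VField n' M'}
    (hX : MDifferentiableAt (𝓡 n) (𝓡 n).tangent
      (fun y => (⟨y, X y⟩ : TangentBundle (𝓡 n) M)) x)
    (hY : MDifferentiableAt (𝓡 n) (𝓡 n).tangent
      (fun y => (⟨y, Y y⟩ : TangentBundle (𝓡 n) M)) x)
    (hX' : MDifferentiableAt (𝓡 n') (𝓡 n').tangent
      (fun y => (⟨y, X' y⟩ : TangentBundle (𝓡 n') M')) (F x))
    (hY' : MDifferentiableAt (𝓡 n') (𝓡 n').tangent
      (fun y => (⟨y, Y' y⟩ : TangentBundle (𝓡 n') M')) (F x))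
    (rX : ∀ᶠ y in 𝓝 x, mfderiv (𝓡 n) (𝓡 n') F y (X y) = X' (F y))
    (rY : ∀ᶠ y in 𝓝 x, mfderiv (𝓡 n) (𝓡 n') F y (Y y) = Y' (F y)) :
    mfderiv (𝓡 n) (𝓡 n') F x (mlieBracket (𝓡 n) X Y x) = mlieBracket (𝓡 n') X' Y' (F x) := by
  set φ := extChartAt (𝓡 n) x with hφ
  set ψ := extChartAt (𝓡 n') (F x) with hψ
  set Fh : EuclideanSpace ℝ (Fin n) → EuclideanSpace ℝ (Fin n') := ψ ∘ F ∘ φ.symm with hFh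
  have hFhs : ContDiffAt ℝ ω Fh (φ x) := by
    have := (contMDiffAt_iff.1 hF).2
    simpa [hFh, hφ, hψ, contDiffWithinAt_univ] using this
  have evs : ∀ᶠ y in 𝓝 x, y ∈ φ.source := extChartAt_source_mem_nhds x
  have evs' : ∀ᶠ y in 𝓝 x, F y ∈ ψ.source :=
    hF.continuousAt.eventually (extChartAt_source_mem_nhds (I := 𝓡 n') (F x))
  have evF : ∀ᶠ y in 𝓝 x, MDifferentiableAt (𝓡 n) (𝓡 n') F y := by
    filter_upwards [(contMDiffAt_iff_contMDiffAt_nhds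
      (by simp)).1 hF] with y hy using hy.mdifferentiableAt (by simp)
  have evFh : ∀ᶠ y in 𝓝 x, DifferentiableAt ℝ Fh (φ y) := by
    have h1 : ∀ᶠ u in 𝓝 (φ x), DifferentiableAt ℝ Fh u := by
      filter_upwards [hFhs.eventually (by simp)] with y hy using hy.differentiableAt (by simp)
    exact (continuousAt_extChartAt (I := 𝓡 n) x).eventually h1
  -- The chain rule for `ψ ∘ F = Fh ∘ φ`, which turns relatedness on the manifolds into relatedness
  -- of the chart representatives.
  have key : ∀ᶠ y in 𝓝 x, ∀ v : TangentSpace (𝓡 n) y,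
      fderiv ℝ Fh (φ y) (mfderiv (𝓡 n) 𝓘(ℝ, EuclideanSpace ℝ (Fin n)) φ y v) =
      mfderiv (𝓡 n') 𝓘(ℝ, EuclideanSpace ℝ (Fin n')) ψ (F y) (mfderiv (𝓡 n) (𝓡 n') F y v) := by
    filter_upwards [evs.eventually_nhds, evs', evF, evFh] with y hy hy' hFy hFhy v
    have hφy : MDifferentiableAt (𝓡 n) 𝓘(ℝ, EuclideanSpace ℝ (Fin n)) φ y :=
      mdifferentiableAt_extChartAt (by simpa [hφ] using hy.self_of_nhds)
    have hψy : MDifferentiableAt (𝓡 n') 𝓘(ℝ, EuclideanSpace ℝ (Fin n')) ψ (F y) :=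
      mdifferentiableAt_extChartAt (by simpa [hψ] using hy')
    have e : (ψ ∘ F) =ᶠ[𝓝 y] (Fh ∘ φ) := by
      filter_upwards [hy] with z hz
      simp [hFh, φ.left_inv hz]
    have h1 := e.mfderiv_eq (I := 𝓡 n) (I' := 𝓘(ℝ, EuclideanSpace ℝ (Fin n')))
    rw [mfderiv_comp y hψy hFy, mfderiv_comp y hFhy.mdifferentiableAt hφy, mfderiv_eq_fderiv] at h1
    exact (congrArg (fun L : EuclideanSpace ℝ (Fin n) →L[ℝ] EuclideanSpace ℝ
      (Fin n') => L v) h1).symm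
  have tends : Filter.Tendsto φ.symm (𝓝 (φ x)) (𝓝 x) := by
    have := (continuousAt_extChartAt_symm (I := 𝓡 n) x).tendsto
    rwa [extChartAt_to_inv] at this
  have evt : ∀ᶠ u in 𝓝 (φ x), u ∈ φ.target := extChartAt_target_mem_nhds x
  have rel : ∀ {Z : VField n M} {Z' : VField n' M'},
      (∀ᶠ y in 𝓝 x, mfderiv (𝓡 n) (𝓡 n') F y (Z y) = Z' (F y)) →
      (fun u => fderiv ℝ Fh u (chartVField x Z u)) =ᶠ[𝓝 (φ x)]
        fun u => chartVField (F x) Z' (Fh u) := by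
    intro Z Z' hZ
    filter_upwards [tends.eventually key, tends.eventually hZ, tends.eventually evs', evt]
      with u hu hZu hs hut
    have h1 := hu (Z (φ.symm u))
    rw [hZu, φ.right_inv hut] at h1
    refine h1.trans ?_
    unfold chartVField
    have : ψ.symm (Fh u) = F (φ.symm u) := ψ.left_inv hs
    rw [this]
  have hφx : Fh (φ x) = ψ (F x) := by simp [hFh, hφ]
  -- The second derivative of `Fh` is symmetric, so it drops out of the image of the bracket. No
  -- invertibility of `F` is used, so the result applies to the projection `G → G/K`.
  have hb := fderiv_apply_lieBracket (W := chartVField x Y) (V := chartVField x X) hFhs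
    (by simp) (differentiableAt_chartVField hY) (differentiableAt_chartVField hX)
  rw [(rel rX).fderiv_eq, (rel rY).fderiv_eq] at hb
  have dc : ∀ {Z' : VField n' M'}, MDifferentiableAt (𝓡 n') (𝓡 n').tangent
      (fun y => (⟨y, Z' y⟩ : TangentBundle (𝓡 n') M')) (F x) → ∀ w,
      fderiv ℝ (fun u => chartVField (F x) Z' (Fh u)) (φ x) w =
        fderiv ℝ (chartVField (F x) Z') (ψ (F x)) (fderiv ℝ Fh (φ x) w) := by
    intro Z' hZ' w
    have h1 := differentiableAt_chartVField hZ'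
    rw [← hψ, ← hφx] at h1
    have h2 := fderiv_comp (φ x) h1 (hFhs.differentiableAt (by simp))
    rw [hφx] at h2
    exact congrArg (fun L => L w) h2
  have rX0 : fderiv ℝ Fh (φ x) (chartVField x X (φ x)) = chartVField (F x) X' (Fh (φ x)) :=
    (rel rX).self_of_nhds
  have rY0 : fderiv ℝ Fh (φ x) (chartVField x Y (φ x)) = chartVField (F x) Y' (Fh (φ x)) :=
    (rel rY).self_of_nhds
  rw [dc hX', dc hY', rX0, rY0, hφx] at hb
  have hinv : (mfderiv (𝓡 n') 𝓘(ℝ, EuclideanSpace ℝ (Fin n')) ψ (F x)).IsInvertible :=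
    isInvertible_mfderiv_extChartAt (mem_extChartAt_source _)
  apply hinv.injective
  rw [mfderiv_extChartAt_mlieBracket, ← key.self_of_nhds, mfderiv_extChartAt_mlieBracket]
  exact hb

end ManifoldLemmas

/-! ### Smoothness of maps into a single tangent space. -/

section FiberLemmas

variable {n : ℕ} {M : Type*}
  [TopologicalSpace M] [ChartedSpace (EuclideanSpace ℝ (Fin n)) M] [IsManifold (𝓡 n) ω M]
  {EA HA : Type*} [NormedAddCommGroup EA] [NormedSpace ℝ EA] [TopologicalSpace HA]
  {IA : ModelWithCorners ℝ EA HA} {A : Type*} [TopologicalSpace A] [ChartedSpace HA A]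

/-- A map into a fixed tangent space is `C^k` if and only if it is so as a map into the tangent
bundle. -/
lemma contMDiffAt_tangent_fiber_iff {k : ℕ∞ω} (z : M) (f : A → EuclideanSpace ℝ (Fin n)) (a : A) :
    ContMDiffAt IA (𝓡 n).tangent k
      (fun b => (⟨z, f b⟩ : TangentBundle (𝓡 n) M)) a ↔
    ContMDiffAt IA 𝓘(ℝ, EuclideanSpace ℝ (Fin n)) k f a := by
  rw [Bundle.contMDiffAt_totalSpace]
  have e : (fun b => (trivializationAt (EuclideanSpace ℝ (Fin n)) (TangentSpace (𝓡 n)) z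
      (⟨z, f b⟩ : TangentBundle (𝓡 n) M)).2) = f := by
    funext b
    exact (tangentBundleCore (𝓡 n) M).coordChange_self (achart _ z) z (mem_chart_source _ z) (f b)
  constructor
  · rintro ⟨-, h⟩
    exact e ▸ h
  · intro h
    exact ⟨contMDiffAt_const, by rw [e]; exact h⟩

lemma contMDiffAt_tangent_snd {k : ℕ∞ω} {z : M} {g : A → TangentBundle (𝓡 n) M} {a : A}
    (hg : ContMDiffAt IA (𝓡 n).tangent k g a) (hz : ∀ᶠ b in 𝓝 a, (g b).1 = z) :
    ContMDiffAt IA 𝓘(ℝ, EuclideanSpace ℝ (Fin n)) k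
      (fun b => ((g b).2 : EuclideanSpace ℝ (Fin n))) a := by
  refine (contMDiffAt_tangent_fiber_iff z
    (fun b => ((g b).2 : EuclideanSpace ℝ (Fin n))) a).1 ?_
  refine hg.congr_of_eventuallyEq ?_
  filter_upwards [hz] with b hb
  rcases h : g b with ⟨y, v⟩
  rw [h] at hb
  change y = z at hb
  subst hb
  rfl

end FiberLemmas

/-! ### The tangent lift of an analytic group action. -/

section Action

variable {d n : ℕ} {G Z : Type*} [TopologicalSpace G] [ChartedSpace (EuclideanSpace ℝ (Fin d)) G]
  [Group G] [LieGroup (𝓡 d) ω G]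
  [TopologicalSpace Z] [ChartedSpace (EuclideanSpace ℝ (Fin n)) Z] [IsManifold (𝓡 n) ω Z]
  [MulAction G Z]

/-- The differential at `x` of `x ↦ a • x`, as an endomorphism of the model space. -/
def smulDeriv (n : ℕ) {G Z : Type*} [TopologicalSpace Z]
    [ChartedSpace (EuclideanSpace ℝ (Fin n)) Z] [SMul G Z] (a : G) (x : Z) :
    EuclideanSpace ℝ (Fin n) →L[ℝ] EuclideanSpace ℝ (Fin n) :=
  mfderiv (𝓡 n) (𝓡 n) (fun y : Z => a • y) x

/-- The action of `G` on `TZ` induced by an analytic action on `Z` is analytic. -/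
lemma contMDiff_tangent_smul
    (h : ContMDiff ((𝓡 d).prod (𝓡 n)) (𝓡 n) ω (fun q : G × Z => q.1 • q.2)) :
    ContMDiff ((𝓡 d).prod (𝓡 n).tangent) (𝓡 n).tangent ω
      (fun q : G × TangentBundle (𝓡 n) Z =>
        (⟨q.1 • q.2.1, smulDeriv n q.1 q.2.1 q.2.2⟩ : TangentBundle (𝓡 n) Z)) := by
  -- The tangent action is the tangent map of `G × Z → Z` restricted to the zero section of `TG`
  -- times `TZ`.
  have s0 : ContMDiff (𝓡 d) (𝓡 d).tangent ω
      (fun g : G => (⟨g, 0⟩ : TangentBundle (𝓡 d) G)) := Bundle.contMDiff_zeroSection _ _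
  have s1 : ContMDiff ((𝓡 d).prod (𝓡 n).tangent) ((𝓡 d).tangent.prod (𝓡 n).tangent) ω
      (fun q : G × TangentBundle (𝓡 n) Z => ((⟨q.1, 0⟩ : TangentBundle (𝓡 d) G), q.2)) :=
    (s0.comp contMDiff_fst).prodMk contMDiff_snd
  have s2 : ContMDiff _ _ ω (equivTangentBundleProd (𝓡 d) G (𝓡 n) Z).symm :=
    contMDiff_equivTangentBundleProd_symm
  have s3 := h.contMDiff_tangentMap (m := ω) (by simp)
  refine ((s3.comp s2).comp s1).congr ?_
  rintro ⟨g, ⟨x, (v : EuclideanSpace ℝ (Fin n))⟩⟩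
  have hm : MDifferentiableAt ((𝓡 d).prod (𝓡 n)) (𝓡 n) (fun q : G × Z => q.1 • q.2) (g, x) :=
    h.mdifferentiableAt (by simp)
  have e := mfderiv_prod_eq_add_apply (v := ((0 : EuclideanSpace ℝ (Fin d)), v)) hm
  have e0 : (mfderiv (𝓡 d) (𝓡 n) (fun z : G => z • x) g :
      EuclideanSpace ℝ (Fin d) →L[ℝ] EuclideanSpace ℝ (Fin n)) 0 = 0 := map_zero _
  have e' : mfderiv ((𝓡 d).prod (𝓡 n)) (𝓡 n) (fun q : G × Z => q.1 • q.2) (g, x)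
      ((0 : EuclideanSpace ℝ (Fin d)), v) = mfderiv (𝓡 n) (𝓡 n) (fun y : Z => g • y) x v :=
    (e.trans (congrArg (fun t : EuclideanSpace ℝ (Fin n) => t + smulDeriv n g x v) e0)).trans
        (zero_add (M := EuclideanSpace ℝ (Fin n)) _)
  change (⟨g • x, _⟩ : TangentBundle (𝓡 n) Z) = ⟨g • x, _⟩
  congr 1
  exact e'.symm

lemma mdifferentiableAt_smul
    (h : ContMDiff ((𝓡 d).prod (𝓡 n)) (𝓡 n) ω (fun q : G × Z => q.1 • q.2)) (a : G) (x : Z) :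
    MDifferentiableAt (𝓡 n) (𝓡 n) (fun y : Z => a • y) x := by
  have : ContMDiff (𝓡 n) (𝓡 n) ω (fun y : Z => a • y) :=
    h.comp (contMDiff_const.prodMk contMDiff_id)
  exact this.mdifferentiableAt (by simp)

lemma smulDeriv_mul
    (h : ContMDiff ((𝓡 d).prod (𝓡 n)) (𝓡 n) ω (fun q : G × Z => q.1 • q.2)) (a b : G) (x : Z)
    (v : EuclideanSpace ℝ (Fin n)) :
    smulDeriv n (a * b) x v = smulDeriv n a (b • x) (smulDeriv n b x v) := by
  have e : (fun y : Z => (a * b) • y) = (fun y : Z => a • y) ∘ (fun y : Z => b • y) := by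
    funext y; exact mul_smul a b y
  unfold smulDeriv
  rw [e, mfderiv_comp x (mdifferentiableAt_smul h a (b • x)) (mdifferentiableAt_smul h b x)]
  rfl

lemma smulDeriv_one (x : Z) (v : EuclideanSpace ℝ (Fin n)) :
    smulDeriv n (1 : G) x v = v := by
  have e : (fun y : Z => (1 : G) • y) = id := by funext y; exact one_smul G y
  unfold smulDeriv
  rw [e, mfderiv_id]
  rfl

lemma smulDeriv_inv_smulDeriv
    (h : ContMDiff ((𝓡 d).prod (𝓡 n)) (𝓡 n) ω (fun q : G × Z => q.1 • q.2)) (a : G) (x : Z)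
    (v : EuclideanSpace ℝ (Fin n)) :
    smulDeriv n a⁻¹ (a • x) (smulDeriv n a x v) = v := by
  rw [← smulDeriv_mul h, inv_mul_cancel, smulDeriv_one]

lemma smulDeriv_smulDeriv_inv
    (h : ContMDiff ((𝓡 d).prod (𝓡 n)) (𝓡 n) ω (fun q : G × Z => q.1 • q.2)) (a : G) (x : Z)
    (v : EuclideanSpace ℝ (Fin n)) :
    smulDeriv n a x (smulDeriv n a⁻¹ (a • x) v) = v := by
  have := smulDeriv_inv_smulDeriv h a⁻¹ (a • x) v
  rwa [inv_inv, inv_smul_smul] at this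

end Action

/-! ### Vector fields on `G` in the left trivialization. -/

section LeftInvariant

variable {d : ℕ} {G : Type*} [TopologicalSpace G] [ChartedSpace (EuclideanSpace ℝ (Fin d)) G]
  [Group G] [LieGroup (𝓡 d) ω G]

/-- The vector field on `G` which corresponds to a function `f : G → 𝔤` in the left
trivialization of `TG`. -/
def leftField (f : G → EuclideanSpace ℝ (Fin d)) : VField d G :=
  fun a => smulDeriv d a (1 : G) (f a)

/-- The Lie bracket of vector fields, with values in the model space. -/
def vbr {n : ℕ} {M : Type*} [TopologicalSpace M] [ChartedSpace (EuclideanSpace ℝ (Fin n)) M]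
    (X Y : VField n M) (x : M) : EuclideanSpace ℝ (Fin n) :=
  mlieBracket (𝓡 n) X Y x

/-- Writing a field as a combination of left invariant fields with function coefficients gives
access to the Leibniz rule of the bracket. -/
lemma leftField_eq_sum (f : G → EuclideanSpace ℝ (Fin d)) :
    leftField f = ∑ i, (fun a => f a i) •
      (mulInvariantVectorField (I := 𝓡 d) (EuclideanSpace.basisFun (Fin d) ℝ i) : VField d G) := by
  funext a
  have h : f a = ∑ i, f a i • EuclideanSpace.basisFun (Fin d) ℝ i := by
    have := (EuclideanSpace.basisFun (Fin d) ℝ).sum_repr (f a)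
    simpa using this.symm
  unfold leftField
  conv_lhs => rw [h]
  rw [Finset.sum_apply, map_sum]
  refine Finset.sum_congr rfl fun i _ => ?_
  rw [map_smul]
  rfl

lemma mdifferentiableAt_mulInvariant (v : GroupLieAlgebra (𝓡 d) G) (a : G) :
    MDifferentiableAt (𝓡 d) (𝓡 d).tangent
      (fun b => (⟨b, mulInvariantVectorField (I := 𝓡 d) v b⟩ : TangentBundle (𝓡 d) G)) a :=
  mdifferentiableAt_mulInvariantVectorField v

lemma mdifferentiableAt_coord {f : G → EuclideanSpace ℝ (Fin d)} {a : G}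
    (hf : MDifferentiableAt (𝓡 d) 𝓘(ℝ, EuclideanSpace ℝ (Fin d)) f a) (i : Fin d) :
    MDifferentiableAt (𝓡 d) 𝓘(ℝ, ℝ) (fun b => f b i) a :=
  ((EuclideanSpace.proj (𝕜 := ℝ) i).differentiable).comp_mdifferentiableAt hf

lemma mvfderiv_coord {f : G → EuclideanSpace ℝ (Fin d)} {a : G}
    (hf : MDifferentiableAt (𝓡 d) 𝓘(ℝ, EuclideanSpace ℝ (Fin d)) f a) (i : Fin d)
    (v : TangentSpace (𝓡 d) a) :
    mvfderiv (𝓡 d) (fun b => f b i) a v = mvfderiv (𝓡 d) f a v i := by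
  have h := mfderiv_comp (I' := 𝓘(ℝ, EuclideanSpace ℝ (Fin d))) (I'' := 𝓘(ℝ, ℝ)) a
    (g := EuclideanSpace.proj (𝕜 := ℝ) i)
    ((EuclideanSpace.proj (𝕜 := ℝ) i).differentiableAt.mdifferentiableAt) hf
  rw [ContinuousLinearMap.mfderiv_eq] at h
  exact congrArg (fun L => L v) h

lemma mdifferentiableAt_leftField {f : G → EuclideanSpace ℝ (Fin d)} {a : G}
    (hf : MDifferentiableAt (𝓡 d) 𝓘(ℝ, EuclideanSpace ℝ (Fin d)) f a) :
    MDifferentiableAt (𝓡 d) (𝓡 d).tangent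
      (fun b => (⟨b, leftField f b⟩ : TangentBundle (𝓡 d) G)) a := by
  rw [leftField_eq_sum]
  have := MDifferentiableAt.sum_section (I := 𝓡 d) (F := EuclideanSpace ℝ (Fin d))
    (E := (TangentSpace (𝓡 d) : G → Type)) (s := (Finset.univ : Finset (Fin d)))
    (t := fun i => (fun a => f a i) •
      (mulInvariantVectorField (I :=
        𝓡 d) (EuclideanSpace.basisFun (Fin d) ℝ i) : VField d G)) (x₀ := a)
    (fun i _ => (mdifferentiableAt_coord hf i).smul_section
        (mdifferentiableAt_mulInvariant _ a))
  simpa [Finset.sum_apply] using this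

lemma mlieBracket_sum_right {M : Type*} [TopologicalSpace M]
    [ChartedSpace (EuclideanSpace ℝ (Fin d)) M] [IsManifold (𝓡 d) ω M] {ι : Type*} (s : Finset ι)
    (V : VField d M) (W : ι → VField d M) (x : M)
    (hW : ∀ i, MDifferentiableAt (𝓡 d) (𝓡 d).tangent
      (fun b => (⟨b, W i b⟩ : TangentBundle (𝓡 d) M)) x) :
    mlieBracket (𝓡 d) V (∑ i ∈ s, W i) x = ∑ i ∈ s, mlieBracket (𝓡 d) V (W i) x := by
  classical
  induction s using Finset.induction_on with
  | empty => simp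
  | insert i s hi ih =>
    rw [Finset.sum_insert hi, Finset.sum_insert hi, mlieBracket_add_right (hW i), ih]
    have := MDifferentiableAt.sum_section (I := 𝓡 d) (F := EuclideanSpace ℝ (Fin d))
      (E := (TangentSpace (𝓡 d) : M → Type)) (s := s) (t := W) (x₀ := x) (fun i _ => hW i)
    simpa [Finset.sum_apply] using this

lemma mlieBracket_leftField_right (V : VField d G) {f : G → EuclideanSpace ℝ (Fin d)} {a : G}
    (hf : MDifferentiableAt (𝓡 d) 𝓘(ℝ, EuclideanSpace ℝ (Fin d)) f a) :
    vbr V (leftField f) a = smulDeriv d a (1 : G) (mvfderiv (𝓡 d) f a (V a)) +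
        ∑ i, f a i • vbr V
          (mulInvariantVectorField (I := 𝓡 d) (EuclideanSpace.basisFun (Fin d) ℝ i)) a := by
  have e := congrFun (leftField_eq_sum (fun _ : G => mvfderiv (𝓡 d) f a (V a))) a
  unfold leftField at e
  rw [Finset.sum_apply] at e
  refine Eq.trans ?_ (congrArg (fun t : EuclideanSpace ℝ (Fin d) => t + _) e.symm)
  refine Eq.trans ?_ (Finset.sum_add_distrib (M := EuclideanSpace ℝ (Fin d)))
  unfold vbr
  rw [leftField_eq_sum f, mlieBracket_sum_right]
  · refine Finset.sum_congr rfl fun i _ => ?_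
    refine (mlieBracket_smul_right (mdifferentiableAt_coord hf i)
      (mdifferentiableAt_mulInvariant _ a)).trans ?_
    rw [mvfderiv_coord hf]
    rfl
  · exact fun i => (mdifferentiableAt_coord hf i).smul_section (mdifferentiableAt_mulInvariant _ a)

variable (d G) in
/-- The Lie bracket of `𝔤`, on the model space. -/
def lieBr (v w : EuclideanSpace ℝ (Fin d)) : EuclideanSpace ℝ (Fin d) :=
  Bracket.bracket (L := GroupLieAlgebra (𝓡 d) G) (M := GroupLieAlgebra (𝓡 d) G) v w

lemma lieBr_skew (v w : EuclideanSpace ℝ (Fin d)) : lieBr d G w v = - lieBr d G v w :=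
  (lie_skew (L := GroupLieAlgebra (𝓡 d) G) w v).symm

lemma vbr_mulInvariant (v w : EuclideanSpace ℝ (Fin d)) (a : G) :
    vbr (leftField fun _ : G => v) (leftField fun _ : G => w) a =
      smulDeriv d a (1 : G) (lieBr d G v w) :=
  (congrFun (mulInvariantVector_mlieBracket (I := 𝓡 d) (G := G) v w) a).symm

lemma vbr_swap {n : ℕ} {M : Type*} [TopologicalSpace M] [ChartedSpace (EuclideanSpace ℝ (Fin n)) M]
    (X Y : VField n M) (x : M) : vbr X Y x = - vbr Y X x :=
  mlieBracket_swap_apply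

/-- The Leibniz expansions for `f` and for the constant function `f a` have the same
undifferentiated terms, so they differ only by the derivative of `f`. Freezing both entries in this
way reduces a general bracket to the bracket of `𝔤`. -/
lemma vbr_leftField_right (V : VField d G) {f : G → EuclideanSpace ℝ (Fin d)} {a : G}
    (hf : MDifferentiableAt (𝓡 d) 𝓘(ℝ, EuclideanSpace ℝ (Fin d)) f a) :
    vbr V (leftField f) a = smulDeriv d a (1 : G) (mvfderiv (𝓡 d) f a (V a)) +
        vbr V (leftField fun _ : G => f a) a := by
  rw [mlieBracket_leftField_right V hf, mlieBracket_leftField_right V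
    (f := fun _ : G => f a) (a := a) mdifferentiableAt_const, mvfderiv_const]
  congr 1
  refine (zero_add _).symm.trans ?_
  exact congrArg (fun t : EuclideanSpace ℝ (Fin d) => t + _) (map_zero _).symm

/-- The bracket of vector fields in the left trivialization. -/
theorem vbr_leftField {f h : G → EuclideanSpace ℝ (Fin d)} {a : G}
    (hf : MDifferentiableAt (𝓡 d) 𝓘(ℝ, EuclideanSpace ℝ (Fin d)) f a)
    (hh : MDifferentiableAt (𝓡 d) 𝓘(ℝ, EuclideanSpace ℝ (Fin d)) h a) :
    vbr (leftField f) (leftField h) a =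
      smulDeriv d a (1 : G) (lieBr d G (f a) (h a) + (mvfderiv (𝓡 d) h a (leftField f a)
          - mvfderiv (𝓡 d) f a (leftField h a))) := by
  have e : leftField h a = leftField (fun _ => h a) a := rfl
  rw [vbr_leftField_right _ hh, vbr_swap _ (leftField fun _ => h a), vbr_leftField_right _ hf,
    vbr_mulInvariant, lieBr_skew, map_add, map_sub, map_neg, e]
  abel

end LeftInvariant

/-! ### Submersions: local sections and curves in fibers. -/

section Submersions

variable {d m : ℕ} {M M' : Type*}
  [TopologicalSpace M] [ChartedSpace (EuclideanSpace ℝ (Fin d)) M] [IsManifold (𝓡 d) ω M]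
  [TopologicalSpace M'] [ChartedSpace (EuclideanSpace ℝ (Fin m)) M'] [IsManifold (𝓡 m) ω M']

/-- Charts around `x` and `P x` in which the map `P` is a linear projection. -/
structure SubmersionChart (P : M → M') (x : M) where
  /-- the complement -/
  F : Type
  [normedGroup : NormedAddCommGroup F]
  [normedSpace : NormedSpace ℝ F]
  /-- the chart of the domain -/
  φ : OpenPartialHomeomorph M (EuclideanSpace ℝ (Fin d))
  /-- the chart of the codomain -/
  ψ : OpenPartialHomeomorph M' (EuclideanSpace ℝ (Fin m))
  /-- the splitting of the model space -/
  e : EuclideanSpace ℝ (Fin d) ≃L[ℝ] EuclideanSpace ℝ (Fin m) × F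
  mem_φ : x ∈ φ.source
  mem_ψ : P x ∈ ψ.source
  contMDiffOn_φ : ContMDiffOn (𝓡 d) (𝓡 d) ω φ φ.source
  contMDiffOn_φ_symm : ContMDiffOn (𝓡 d) (𝓡 d) ω φ.symm φ.target
  contMDiffOn_ψ : ContMDiffOn (𝓡 m) (𝓡 m) ω ψ ψ.source
  mapsTo : ∀ y ∈ φ.source, P y ∈ ψ.source
  apply_eq : ∀ u ∈ φ.target, ψ (P (φ.symm u)) = (e u).1

attribute [instance] SubmersionChart.normedGroup SubmersionChart.normedSpace

theorem exists_submersionChart {P : M → M'} (hP : Manifold.IsSubmersion (𝓡 d) (𝓡 m) ω P)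
    (x : M) : Nonempty (SubmersionChart (d := d) (m := m) P x) := by
  obtain ⟨F, _, _, hF⟩ := hP
  have h := hF x
  refine ⟨⟨F, h.domChart, h.codChart, h.equiv, h.mem_domChart_source, h.mem_codChart_source,
    contMDiffOn_of_mem_maximalAtlas h.domChart_mem_maximalAtlas,
    contMDiffOn_symm_of_mem_maximalAtlas h.domChart_mem_maximalAtlas,
    contMDiffOn_of_mem_maximalAtlas h.codChart_mem_maximalAtlas, h.source_subset_preimage_source,
    fun u hu => ?_⟩⟩
  have hu' : u ∈ (h.domChart.extend (𝓡 d)).target := by simpa using hu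
  have := h.writtenInCharts hu'
  simpa using this

/-- A submersion has analytic local sections through every point. -/
theorem exists_local_section {P : M → M'} (hP : Manifold.IsSubmersion (𝓡 d) (𝓡 m) ω P) (x : M) :
    ∃ σ : M' → M, ContMDiffAt (𝓡 m) (𝓡 d) ω σ (P x) ∧ σ (P x) = x ∧
      ∀ᶠ y in 𝓝 (P x), P (σ y) = y := by
  obtain ⟨c⟩ := exists_submersionChart hP x
  have hx : c.φ x ∈ c.φ.target := c.φ.map_source c.mem_φ
  have h0 : c.ψ (P x) = (c.e (c.φ x)).1 := by
    rw [← c.apply_eq _ hx, c.φ.left_inv c.mem_φ]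
  -- In the adapted charts `P` is the first projection; freezing the complementary coordinate at its
  -- value at `x` gives a section through `x`.
  set τ : M' → EuclideanSpace ℝ (Fin d) := fun y => c.e.symm (c.ψ y, (c.e (c.φ x)).2) with hτ
  have hτx : τ (P x) = c.φ x := by
    rw [hτ]
    simp only [h0, Prod.mk.eta, ContinuousLinearEquiv.symm_apply_apply]
  have sψ : ContMDiffAt (𝓡 m) (𝓡 m) ω c.ψ (P x) :=
    c.contMDiffOn_ψ.contMDiffAt (c.ψ.open_source.mem_nhds c.mem_ψ)
  have sl : ContDiff ℝ ω (fun u : EuclideanSpace ℝ (Fin m) => c.e.symm (u, (c.e (c.φ x)).2)) := by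
    fun_prop
  have sτ : ContMDiffAt (𝓡 m) (𝓡 d) ω τ (P x) :=
    ContMDiffAt.comp (g := fun u : EuclideanSpace ℝ (Fin m) => c.e.symm (u, (c.e (c.φ x)).2))
      (P x) sl.contMDiff.contMDiffAt sψ
  have evt : ∀ᶠ y in 𝓝 (P x), τ y ∈ c.φ.target :=
    sτ.continuousAt.eventually (by rw [hτx]; exact c.φ.open_target.mem_nhds hx)
  refine ⟨fun y => c.φ.symm (τ y), ?_, by simp [hτx, c.φ.left_inv c.mem_φ], ?_⟩
  · refine ContMDiffAt.comp (P x) ?_ sτ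
    rw [hτx]
    exact c.contMDiffOn_φ_symm.contMDiffAt (c.φ.open_target.mem_nhds hx)
  · filter_upwards [evt, c.ψ.open_source.mem_nhds c.mem_ψ] with y hy hys
    apply c.ψ.injOn (c.mapsTo _ (c.φ.map_target hy)) hys
    rw [c.apply_eq _ hy, hτ]
    simp

/-- The differential of a local section is a right inverse. -/
theorem mfderiv_surjective {P : M → M'} (hP : Manifold.IsSubmersion (𝓡 d) (𝓡 m) ω P) (x : M) :
    Function.Surjective (mfderiv (𝓡 d) (𝓡 m) P x) := by
  obtain ⟨σ, sσ, hσx, hσ⟩ := exists_local_section hP x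
  have hPd : MDifferentiableAt (𝓡 d) (𝓡 m) P (σ (P x)) :=
    hP.contMDiff.mdifferentiableAt (by simp)
  have h := mfderiv_comp (P x) hPd (sσ.mdifferentiableAt (by simp))
  have e : P ∘ σ =ᶠ[𝓝 (P x)] id := hσ
  rw [e.mfderiv_eq, mfderiv_id, hσx] at h
  intro v
  exact ⟨mfderiv (𝓡 m) (𝓡 d) σ (P x) v, (congrArg (fun L => L v) h).symm⟩

namespace SubmersionChart

variable {P : M → M'} {x : M} (c : SubmersionChart (d := d) (m := m) P x)

/-- The curve in the fiber of `x` which is a line in the chart. -/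
def line (w : EuclideanSpace ℝ (Fin d)) (t : ℝ) : M := c.φ.symm (c.φ x + t • w)

lemma line_zero (w : EuclideanSpace ℝ (Fin d)) : c.line w 0 = x := by
  simp [line, c.φ.left_inv c.mem_φ]

lemma apply_line {w : EuclideanSpace ℝ (Fin d)} (hw : (c.e w).1 = 0) {t : ℝ}
    (ht : c.φ x + t • w ∈ c.φ.target) : P (c.line w t) = P x := by
  have hx : c.φ x ∈ c.φ.target := c.φ.map_source c.mem_φ
  apply c.ψ.injOn (c.mapsTo _ (c.φ.map_target ht)) c.mem_ψ
  have h0 := c.apply_eq _ hx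
  rw [c.φ.left_inv c.mem_φ] at h0
  change c.ψ (P (c.φ.symm (c.φ x + t • w))) = c.ψ (P x)
  rw [c.apply_eq _ ht, h0, map_add, map_smul, Prod.fst_add, Prod.smul_fst, hw, smul_zero,
    add_zero]

lemma contMDiffAt_line (w : EuclideanSpace ℝ (Fin d)) {t : ℝ}
    (ht : c.φ x + t • w ∈ c.φ.target) : ContMDiffAt 𝓘(ℝ, ℝ) (𝓡 d) ω (c.line w) t := by
  have s : ContDiff ℝ ω (fun t : ℝ => c.φ x + t • w) := by fun_prop
  exact ContMDiffAt.comp t (c.contMDiffOn_φ_symm.contMDiffAt (c.φ.open_target.mem_nhds ht))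
    s.contMDiff.contMDiffAt

end SubmersionChart

/-- A vector in the kernel of the differential of a submersion is the velocity of a curve in the
fiber. -/
theorem exists_curve_of_mem_ker {P : M → M'} (hP : Manifold.IsSubmersion (𝓡 d) (𝓡 m) ω P) (x : M)
    (v : EuclideanSpace ℝ (Fin d)) (hv : mfderiv (𝓡 d) (𝓡 m) P x v = (0 : EuclideanSpace ℝ
      (Fin m))) :
    ∃ γ : ℝ → M, γ 0 = x ∧ (∀ᶠ t in 𝓝 (0 : ℝ), P (γ t) = P x) ∧
      ContMDiffAt 𝓘(ℝ, ℝ) (𝓡 d) ω γ 0 ∧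
      HasMFDerivAt 𝓘(ℝ, ℝ) (𝓡 d) γ 0 (ContinuousLinearMap.toSpanSingleton ℝ v) := by
  obtain ⟨c⟩ := exists_submersionChart hP x
  have hx : c.φ x ∈ c.φ.target := c.φ.map_source c.mem_φ
  have dφ : MDifferentiableAt (𝓡 d) (𝓡 d) c.φ x :=
    (c.contMDiffOn_φ.contMDiffAt (c.φ.open_source.mem_nhds c.mem_φ)).mdifferentiableAt (by simp)
  have dψ : MDifferentiableAt (𝓡 m) (𝓡 m) c.ψ (P x) :=
    (c.contMDiffOn_ψ.contMDiffAt (c.ψ.open_source.mem_nhds c.mem_ψ)).mdifferentiableAt (by simp)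
  have dφs : MDifferentiableAt (𝓡 d) (𝓡 d) c.φ.symm (c.φ x) :=
    (c.contMDiffOn_φ_symm.contMDiffAt (c.φ.open_target.mem_nhds hx)).mdifferentiableAt (by simp)
  have dP : MDifferentiableAt (𝓡 d) (𝓡 m) P x := hP.contMDiff.mdifferentiableAt (by simp)
  set w : EuclideanSpace ℝ (Fin d) := mfderiv (𝓡 d) (𝓡 d) c.φ x v with hw
  -- Reading `dP v = 0` in the charts shows that the chart image `w` of `v` points along the
  -- complement `F`. The straight line in direction `w` therefore stays in the fiber.
  have hew : (c.e w).1 = 0 := by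
    have e1 : c.ψ ∘ P =ᶠ[𝓝 x] (fun u => (c.e u).1) ∘ c.φ := by
      filter_upwards [c.φ.open_source.mem_nhds c.mem_φ] with y hy
      have := c.apply_eq _ (c.φ.map_source hy)
      rw [c.φ.left_inv hy] at this
      exact this
    have dl : MDifferentiableAt (𝓡 d) (𝓡 m) (fun u => (c.e u).1) (c.φ x) := by
      have : DifferentiableAt ℝ (fun u => (c.e u).1) (c.φ x) := by fun_prop
      exact this.mdifferentiableAt
    have h := e1.mfderiv_eq (I := 𝓡 d) (I' := 𝓡 m)
    rw [mfderiv_comp x dψ dP, mfderiv_comp x dl dφ] at h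
    have h2 := congrArg (fun L : EuclideanSpace ℝ (Fin d) →L[ℝ] EuclideanSpace ℝ (Fin m) => L v) h
    let A : EuclideanSpace ℝ (Fin d) →L[ℝ] EuclideanSpace ℝ (Fin m) :=
      (ContinuousLinearMap.fst ℝ _ _).comp c.e.toContinuousLinearMap
    have h3 : mfderiv (𝓡 d) (𝓡 m) (fun u => (c.e u).1) (c.φ x) = A := by
      rw [mfderiv_eq_fderiv]
      exact A.fderiv
    rw [h3] at h2
    refine (h2.symm : A w = _).trans ?_
    exact (congrArg (fun z : EuclideanSpace ℝ (Fin m) => (mfderiv (𝓡 m) (𝓡 m) c.ψ (P x) :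
      EuclideanSpace ℝ (Fin m) →L[ℝ] EuclideanSpace ℝ (Fin m)) z) hv).trans (map_zero _)
  have h0 : c.φ x + (0 : ℝ) • w ∈ c.φ.target := by simpa using hx
  have ct : Continuous fun t : ℝ => c.φ x + t • w := by fun_prop
  refine ⟨c.line w, c.line_zero w, ?_, c.contMDiffAt_line w h0, ?_⟩
  · filter_upwards [ct.continuousAt.eventually (c.φ.open_target.mem_nhds h0)] with t ht
    exact c.apply_line hew ht
  · have hl : HasMFDerivAt 𝓘(ℝ, ℝ) (𝓡 d) (fun t : ℝ => c.φ x + t • w) 0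
        (ContinuousLinearMap.toSpanSingleton ℝ w) := by
      have : HasFDerivAt (fun t : ℝ => c.φ x + t • w)
        (ContinuousLinearMap.toSpanSingleton ℝ w) 0 := by
        have h := ((hasDerivAt_id (0 : ℝ)).smul_const w).const_add (c.φ x)
        simpa using h.hasFDerivAt
      exact this.hasMFDerivAt
    have e0 : c.φ x = c.φ x + (0 : ℝ) • w := by simp
    have hs : HasMFDerivAt (𝓡 d) (𝓡 d) c.φ.symm (c.φ x + (0 : ℝ) • w)
        (mfderiv (𝓡 d) (𝓡 d) c.φ.symm (c.φ x)) := by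
      rw [← e0]; exact dφs.hasMFDerivAt
    refine (HasMFDerivAt.comp (0 : ℝ) hs hl).congr_mfderiv ?_
    have hid : c.φ.symm ∘ c.φ =ᶠ[𝓝 x] id := by
      filter_upwards [c.φ.open_source.mem_nhds c.mem_φ] with y hy using c.φ.left_inv hy
    have h := hid.mfderiv_eq (I := 𝓡 d) (I' := 𝓡 d)
    rw [mfderiv_comp x dφs dφ, mfderiv_id] at h
    have h2 := congrArg (fun L : EuclideanSpace ℝ (Fin d) →L[ℝ] EuclideanSpace ℝ (Fin d) => L v) h
    ext1
    change (mfderiv (𝓡 d) (𝓡 d) c.φ.symm (c.φ x) : EuclideanSpace ℝ (Fin d) →L[ℝ]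
      EuclideanSpace ℝ (Fin d)) ((1 : ℝ) • w) = (1 : ℝ) • v
    rw [one_smul, one_smul]
    exact h2

/-- Points of a fiber of a submersion close to `x` can be joined to `x` by an analytic curve in the
fiber. -/
theorem eventually_exists_curve {P : M → M'} (hP : Manifold.IsSubmersion (𝓡 d) (𝓡 m) ω P) (x : M)
    {U : Set M} (hU : U ∈ 𝓝 x) :
    ∀ᶠ y in 𝓝 x, P y = P x → ∃ γ : ℝ → M, γ 0 = x ∧ γ 1 = y ∧ ∀ t ∈ Set.Icc (0 : ℝ) 1,
      P (γ t) = P x ∧ γ t ∈ U ∧ (∀ᶠ r in 𝓝 t, P (γ r) = P x) ∧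
      ContMDiffAt 𝓘(ℝ, ℝ) (𝓡 d) ω γ t := by
  obtain ⟨c⟩ := exists_submersionChart hP x
  have hx : c.φ x ∈ c.φ.target := c.φ.map_source c.mem_φ
  have cs : ContinuousAt c.φ.symm (c.φ x) := c.φ.continuousAt_symm hx
  have hV : c.φ.target ∩ c.φ.symm ⁻¹' U ∈ 𝓝 (c.φ x) :=
    Filter.inter_mem (c.φ.open_target.mem_nhds hx)
      (cs.preimage_mem_nhds (by rwa [c.φ.left_inv c.mem_φ]))
  obtain ⟨ε, hε, hball⟩ := Metric.mem_nhds_iff.1 hV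
  have cφ : ContinuousAt c.φ x := c.φ.continuousAt c.mem_φ
  filter_upwards [c.φ.open_source.mem_nhds c.mem_φ,
    cφ.eventually (Metric.ball_mem_nhds (c.φ x) hε)] with y hys hyb hPy
  set w := c.φ y - c.φ x with hw
  have hew : (c.e w).1 = 0 := by
    have h1 := c.apply_eq _ (c.φ.map_source hys)
    have h2 := c.apply_eq _ hx
    rw [c.φ.left_inv hys, hPy] at h1
    rw [c.φ.left_inv c.mem_φ] at h2
    rw [hw, map_sub, Prod.fst_sub, ← h1, ← h2, sub_self]
  -- The segment from `φ x` to `φ y` stays in the ball, hence in the chart and over `U`.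
  have ht : ∀ t ∈ Set.Icc (0 : ℝ) 1, c.φ x + t • w ∈ Metric.ball (c.φ x) ε := by
    intro t ht
    rw [Metric.mem_ball, dist_eq_norm]
    rw [dist_eq_norm] at hyb
    rw [add_sub_cancel_left, norm_smul, Real.norm_eq_abs, abs_of_nonneg ht.1]
    calc t * ‖w‖ ≤ 1 * ‖w‖ := by gcongr; exact ht.2
      _ < ε := by rw [one_mul]; exact hyb
  have ct : Continuous fun t : ℝ => c.φ x + t • w := by fun_prop
  refine ⟨c.line w, c.line_zero w, ?_, fun t h => ?_⟩
  · change c.φ.symm (c.φ x + (1 : ℝ) • w) = y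
    rw [one_smul, hw, add_sub_cancel, c.φ.left_inv hys]
  · have h' := hball (ht t h)
    refine ⟨c.apply_line hew h'.1, h'.2, ?_, c.contMDiffAt_line w h'.1⟩
    filter_upwards [ct.continuousAt.eventually (c.φ.open_target.mem_nhds h'.1)] with r hr
    exact c.apply_line hew hr

end Submersions

/-! ### The homogeneous space: analytic action, isotropy representation, lifts to the group. -/

section HomogeneousSpace

variable {d m : ℕ} {G : Type*} [TopologicalSpace G] [ChartedSpace (EuclideanSpace ℝ (Fin d)) G]
  [Group G] [LieGroup (𝓡 d) ω G] {K : Subgroup G}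
  [ChartedSpace (EuclideanSpace ℝ (Fin m)) (G ⧸ K)] [IsManifold (𝓡 m) ω (G ⧸ K)]

/-- Near any point the action is `(g, x) ↦ P (g σ(x))` for an analytic local section `σ`. -/
theorem contMDiff_smul_quotient
    (hP : Manifold.IsSubmersion (𝓡 d) (𝓡 m) ω (fun a : G => (a : G ⧸ K))) :
    ContMDiff ((𝓡 d).prod (𝓡 m)) (𝓡 m) ω (fun q : G × (G ⧸ K) => q.1 • q.2) := by
  rintro ⟨g, x⟩
  obtain ⟨a, rfl⟩ := QuotientGroup.mk_surjective x
  obtain ⟨σ, sσ, -, hσ⟩ := exists_local_section hP a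
  have h1 : ContMDiffAt ((𝓡 d).prod (𝓡 m)) (𝓡 m) ω
      (fun q : G × (G ⧸ K) => ((q.1 * σ q.2 : G) : G ⧸ K)) (g, (a : G ⧸ K)) := by
    refine ContMDiffAt.comp (g := fun a : G => (a : G ⧸ K)) _ hP.contMDiff.contMDiffAt ?_
    refine ContMDiffAt.mul contMDiffAt_fst ?_
    exact ContMDiffAt.comp (g := σ) (g, (a : G ⧸ K)) sσ contMDiffAt_snd
  refine h1.congr_of_eventuallyEq ?_
  have : Filter.Tendsto (fun q : G × (G ⧸ K) => q.2) (𝓝 (g, (a : G ⧸ K))) (𝓝 (a : G ⧸ K)) :=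
    continuous_snd.tendsto _
  filter_upwards [this.eventually hσ] with q hq
  change q.1 • q.2 = q.1 • ((σ q.2 : G) : G ⧸ K)
  rw [hq]

variable (d m K) in
/-- The differential at `a` of the projection `G → G/K`. -/
def projDeriv (a : G) : EuclideanSpace ℝ (Fin d) →L[ℝ] EuclideanSpace ℝ (Fin m) :=
  mfderiv (𝓡 d) (𝓡 m) (fun b : G => (b : G ⧸ K)) a

variable (d m K) in
/-- The differential at `1` of `b ↦ a b K`. -/
def transDeriv (a : G) : EuclideanSpace ℝ (Fin d) →L[ℝ] EuclideanSpace ℝ (Fin m) :=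
  (projDeriv d m K a).comp (smulDeriv d a (1 : G))

/-- `G` acts analytically on itself. -/
lemma contMDiff_smul_self :
    ContMDiff ((𝓡 d).prod (𝓡 d)) (𝓡 d) ω (fun q : G × G => q.1 • q.2) :=
  contMDiff_mul (𝓡 d) ω

lemma transDeriv_one (v : EuclideanSpace ℝ (Fin d)) :
    transDeriv d m K (1 : G) v = projDeriv d m K 1 v := by
  unfold transDeriv
  rw [ContinuousLinearMap.comp_apply, smulDeriv_one]

section

variable (hP : Manifold.IsSubmersion (𝓡 d) (𝓡 m) ω (fun a : G => (a : G ⧸ K)))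
include hP

lemma projDeriv_surjective (a : G) : Function.Surjective (projDeriv d m K a) :=
  mfderiv_surjective hP a

/-- The chain rule for `P ∘ L_a = a • P`. -/
lemma projDeriv_smulDeriv (a b : G) (v : EuclideanSpace ℝ (Fin d)) :
    projDeriv d m K (a * b) (smulDeriv d a b v) =
      smulDeriv m a (b : G ⧸ K) (projDeriv d m K b v) := by
  have dP : ∀ b : G, MDifferentiableAt (𝓡 d) (𝓡 m) (fun b : G => (b : G ⧸ K)) b := fun b =>
    hP.contMDiff.mdifferentiableAt (by simp)
  have dL : MDifferentiableAt (𝓡 d) (𝓡 d) (fun y : G => a • y) b :=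
    mdifferentiableAt_smul contMDiff_smul_self a b
  have dS : MDifferentiableAt (𝓡 m) (𝓡 m) (fun y : G ⧸ K => a • y) (b : G ⧸ K) :=
    mdifferentiableAt_smul (contMDiff_smul_quotient hP) a _
  have h1 := mfderiv_comp b (dP (a • b)) dL
  have h2 := mfderiv_comp b dS (dP b)
  have e : (fun b : G => (b : G ⧸ K)) ∘ (fun y : G => a • y) =
    (fun y : G ⧸ K => a • y) ∘ (fun b : G => (b : G ⧸ K)) := rfl
  rw [e, h2] at h1
  exact (congrArg (fun L : EuclideanSpace ℝ (Fin d) →L[ℝ] EuclideanSpace ℝ (Fin m) => L v) h1).symm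

lemma transDeriv_eq (a : G) (v : EuclideanSpace ℝ (Fin d)) :
    transDeriv d m K a v = smulDeriv m a ((1 : G) : G ⧸ K) (projDeriv d m K 1 v) := by
  rw [← projDeriv_smulDeriv hP, mul_one]
  rfl

lemma mk_inv_smul (a : G) : a⁻¹ • (a : G ⧸ K) = ((1 : G) : G ⧸ K) := by
  change ((a⁻¹ * a : G) : G ⧸ K) = _
  rw [inv_mul_cancel]

lemma smul_mk_one (a : G) : a • ((1 : G) : G ⧸ K) = (a : G ⧸ K) := by
  change ((a * 1 : G) : G ⧸ K) = _
  rw [mul_one]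

lemma smulDeriv_inv_smulDeriv_one (a : G) (u : EuclideanSpace ℝ (Fin m)) :
    smulDeriv m a⁻¹ (a : G ⧸ K) (smulDeriv m a ((1 : G) : G ⧸ K) u) = u := by
  have := smulDeriv_inv_smulDeriv (contMDiff_smul_quotient hP) a ((1 : G) : G ⧸ K) u
  rwa [smul_mk_one hP] at this

lemma smulDeriv_smulDeriv_inv_one (a : G) (u : EuclideanSpace ℝ (Fin m)) :
    smulDeriv m a ((1 : G) : G ⧸ K) (smulDeriv m a⁻¹ (a : G ⧸ K) u) = u := by
  have := smulDeriv_smulDeriv_inv (contMDiff_smul_quotient hP) a ((1 : G) : G ⧸ K) u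
  rwa [smul_mk_one hP] at this

lemma smulDeriv_one_injective (a : G) :
    Function.Injective (smulDeriv m a ((1 : G) : G ⧸ K)) :=
  Function.LeftInverse.injective (smulDeriv_inv_smulDeriv_one hP a)

/-- The isotropy representation of `K` is induced by the adjoint representation. -/
lemma projDeriv_adjoint {a : G} (ha : a ∈ K) (v : EuclideanSpace ℝ (Fin d)) :
    projDeriv d m K 1 (adjoint d a v) =
      smulDeriv m a ((1 : G) : G ⧸ K) (projDeriv d m K 1 v) := by
  have dP : ∀ b : G, MDifferentiableAt (𝓡 d) (𝓡 m) (fun b : G => (b : G ⧸ K)) b := fun b =>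
    hP.contMDiff.mdifferentiableAt (by simp)
  have dA : MDifferentiableAt (𝓡 d) (𝓡 d) (fun y : G => a * y * a⁻¹) 1 := by
    have : ContMDiff (𝓡 d) (𝓡 d) ω (fun y : G => a * y * a⁻¹) :=
      (contMDiff_const.mul contMDiff_id).mul contMDiff_const
    exact this.mdifferentiableAt (by simp)
  have dS : MDifferentiableAt (𝓡 m) (𝓡 m) (fun y : G ⧸ K => a • y) ((1 : G) : G ⧸ K) :=
    mdifferentiableAt_smul (contMDiff_smul_quotient hP) a _
  have h1 := mfderiv_comp (1 : G) (dP (a * 1 * a⁻¹)) dA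
  have h2 := mfderiv_comp (1 : G) dS (dP 1)
  -- Right multiplication by `a⁻¹ ∈ K` does not change the coset, so conjugation by `a` covers the
  -- translation by `a`.
  have e : (fun b : G => (b : G ⧸ K)) ∘ (fun y : G => a * y * a⁻¹) =
      (fun y : G ⧸ K => a • y) ∘ (fun b : G => (b : G ⧸ K)) := by
    funext y
    change ((a * y * a⁻¹ : G) : G ⧸ K) = ((a * y : G) : G ⧸ K)
    have e2 : (a * y * a⁻¹)⁻¹ * (a * y) = a := by group
    rw [QuotientGroup.eq, e2]
    exact ha
  rw [e, h2] at h1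
  have h3 := (congrArg (fun L : EuclideanSpace ℝ (Fin d) →L[ℝ] EuclideanSpace ℝ (Fin m) => L v)
    h1).symm
  have e1 : projDeriv d m K (a * 1 * a⁻¹) = projDeriv d m K 1 := by
    rw [mul_one, mul_inv_cancel]
  exact (congrArg (fun L => L (adjoint d a v)) e1.symm).trans h3

/-- The Lie algebra of `K` is the kernel of the differential of the projection. -/
theorem mem_lieAlgOf_iff (v : EuclideanSpace ℝ (Fin d)) :
    (v : GroupLieAlgebra (𝓡 d) G) ∈ lieAlgOf (d := d) K ↔ projDeriv d m K 1 v = 0 := by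
  constructor
  · rintro ⟨γ, h0, hK, -, hd⟩
    have dP : MDifferentiableAt (𝓡 d) (𝓡 m) (fun b : G => (b : G ⧸ K)) (γ 0) :=
      hP.contMDiff.mdifferentiableAt (by simp)
    have h := HasMFDerivAt.comp (0 : ℝ) dP.hasMFDerivAt hd
    -- A curve in `K` projects to a constant curve, so its velocity is in the kernel. For the
    -- converse, the fiber over the base point is `K`, and kernel vectors are velocities of curves
    -- in that fiber.
    have e : (fun b : G => (b : G ⧸ K)) ∘ γ =ᶠ[𝓝 0] fun _ => ((1 : G) : G ⧸ K) := by
      filter_upwards [hK] with t ht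
      exact (QuotientGroup.eq.2 (by simpa using ht)).symm
    have h2 := h.congr_of_eventuallyEq e.symm
    have h3 := (hasMFDerivAt_const (I := 𝓘(ℝ, ℝ)) (I' := 𝓡 m) ((1 : G) : G ⧸ K) (0 : ℝ))
    have h4 := h2.mfderiv.symm.trans h3.mfderiv
    have h5 := congrArg (fun L : ℝ →L[ℝ] EuclideanSpace ℝ (Fin m) => L 1) h4
    have h6 : projDeriv d m K (γ 0) ((1 : ℝ) • v) = 0 := h5
    rwa [h0, one_smul] at h6
  · intro hv
    obtain ⟨γ, h0, hK, hs, hd⟩ := exists_curve_of_mem_ker hP 1 v hv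
    refine ⟨γ, h0, ?_, hs.of_le (by simp), hd⟩
    filter_upwards [hK] with t ht
    have := QuotientGroup.eq.1 ht.symm
    simpa using this

/-! ### Lifting vector fields from `G/K` to `G` -/

omit hP in
variable (d) in
/-- The vector field `X` on `G/K`, pulled back to a function on `G` with values in `T_o(G/K)`. -/
def pullFun (X : VField m (G ⧸ K)) (b : G) : EuclideanSpace ℝ (Fin m) :=
  smulDeriv m b⁻¹ (b : G ⧸ K) (X (b : G ⧸ K))

lemma contMDiffAt_pullFun {k : ℕ∞ω} {X : VField m (G ⧸ K)} {a : G}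
    (hX : ContMDiffAt (𝓡 m) (𝓡 m).tangent k
      (fun y => (⟨y, X y⟩ : TangentBundle (𝓡 m) (G ⧸ K))) (a : G ⧸ K)) :
    ContMDiffAt (𝓡 d) 𝓘(ℝ, EuclideanSpace ℝ (Fin m)) k (pullFun X) a := by
  have h1 : ContMDiffAt (𝓡 d) ((𝓡 d).prod (𝓡 m).tangent) k
      (fun b : G => (b⁻¹, (⟨(b : G ⧸ K), X (b : G ⧸ K)⟩ : TangentBundle (𝓡 m) (G ⧸ K)))) a := by
    refine ContMDiffAt.prodMk ((contMDiff_inv (𝓡 d) ω).of_le le_top).contMDiffAt ?_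
    exact ContMDiffAt.comp (g := fun y => (⟨y, X y⟩ : TangentBundle (𝓡 m) (G ⧸ K))) a hX
      ((hP.contMDiff.of_le le_top).contMDiffAt)
  have h2 := ContMDiffAt.comp a
    ((contMDiff_tangent_smul (contMDiff_smul_quotient hP)).of_le le_top).contMDiffAt h1
  exact contMDiffAt_tangent_snd (z := ((1 : G) : G ⧸ K)) h2
    (Filter.Eventually.of_forall fun b => mk_inv_smul hP b)

lemma smulDeriv_pullFun (X : VField m (G ⧸ K)) (b : G) :
    smulDeriv m b ((1 : G) : G ⧸ K) (pullFun X b) = X (b : G ⧸ K) :=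
  smulDeriv_smulDeriv_inv_one hP b _

/-- The bracket of vector fields on `G/K` in terms of lifts to `G`. -/
theorem vbr_of_lift {X Y : VField m (G ⧸ K)} {f h : G → EuclideanSpace ℝ (Fin d)} {a : G}
    (hX : MDifferentiableAt (𝓡 m) (𝓡 m).tangent
      (fun y => (⟨y, X y⟩ : TangentBundle (𝓡 m) (G ⧸ K))) (a : G ⧸ K))
    (hY : MDifferentiableAt (𝓡 m) (𝓡 m).tangent
      (fun y => (⟨y, Y y⟩ : TangentBundle (𝓡 m) (G ⧸ K))) (a : G ⧸ K))
    (hf : MDifferentiableAt (𝓡 d) 𝓘(ℝ, EuclideanSpace ℝ (Fin d)) f a)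
    (hh : MDifferentiableAt (𝓡 d) 𝓘(ℝ, EuclideanSpace ℝ (Fin d)) h a)
    (lX : ∀ b : G, transDeriv d m K b (f b) = X (b : G ⧸ K))
    (lY : ∀ b : G, transDeriv d m K b (h b) = Y (b : G ⧸ K)) :
    vbr X Y (a : G ⧸ K) = transDeriv d m K a (lieBr d G (f a) (h a) +
      (mvfderiv (𝓡 d) h a (leftField f a) - mvfderiv (𝓡 d) f a (leftField h a))) := by
  -- The hypotheses `lX`, `lY` say that `leftField f`, `leftField h` are related to `X`, `Y` by the
  -- projection.
  have e := mlieBracket_of_related (F := fun a : G => (a : G ⧸ K)) (x := a)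
    hP.contMDiff.contMDiffAt (mdifferentiableAt_leftField hf) (mdifferentiableAt_leftField hh) hX hY
    (Filter.Eventually.of_forall lX) (Filter.Eventually.of_forall lY)
  have e2 := vbr_leftField hf hh
  have e3 : projDeriv d m K a (vbr (leftField f) (leftField h) a) = vbr X Y (a : G ⧸ K) := e
  rw [← e3, e2]
  rfl

end

end HomogeneousSpace

/-! ### Brackets and torsion on `G/K` in terms of the Lie algebra. -/

/-- The algebraic form of the vanishing of the Nijenhuis torsion of an invariant tensor: `π` is the
differential of `G → G/K` at `1`, and `N` is the value of the tensor at the base point. -/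
def IsAlgNijenhuis {L E : Type*} [LieRing L] [LieAlgebra ℝ L] [AddCommGroup E] [Module ℝ E]
    (π : L →ₗ[ℝ] E) (N : E →ₗ[ℝ] E) : Prop :=
  ∀ v w v' w' : L, π v' = N (π v) → π w' = N (π w) →
    π ⁅v', w'⁆ = N (π ⁅v', w⁆ + π ⁅v, w'⁆ - N (π ⁅v, w⁆))

section

variable {d m : ℕ} {G : Type*} [TopologicalSpace G] [ChartedSpace (EuclideanSpace ℝ (Fin d)) G]
  [Group G] [LieGroup (𝓡 d) ω G]

lemma lieBr_add_right (u v w : EuclideanSpace ℝ (Fin d)) :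
    lieBr d G u (v + w) = lieBr d G u v + lieBr d G u w :=
  lie_add (L := GroupLieAlgebra (𝓡 d) G) (M := GroupLieAlgebra (𝓡 d) G) u v w

lemma lieBr_add_left (u v w : EuclideanSpace ℝ (Fin d)) :
    lieBr d G (u + v) w = lieBr d G u w + lieBr d G v w :=
  add_lie (L := GroupLieAlgebra (𝓡 d) G) (M := GroupLieAlgebra (𝓡 d) G) u v w

lemma lieBr_smul_right (c : ℝ) (v w : EuclideanSpace ℝ (Fin d)) :
    lieBr d G v (c • w) = c • lieBr d G v w :=
  lie_smul (R := ℝ) (L := GroupLieAlgebra (𝓡 d) G) (M := GroupLieAlgebra (𝓡 d) G) c v w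

lemma lieBr_smul_left (c : ℝ) (v w : EuclideanSpace ℝ (Fin d)) :
    lieBr d G (c • v) w = c • lieBr d G v w :=
  smul_lie (R := ℝ) (L := GroupLieAlgebra (𝓡 d) G) (M := GroupLieAlgebra (𝓡 d) G) c v w

lemma mvfderiv_clm_comp {n k : ℕ} (L : EuclideanSpace ℝ (Fin n) →L[ℝ] EuclideanSpace ℝ (Fin k))
    {f : G → EuclideanSpace ℝ (Fin n)} {a : G}
    (hf : MDifferentiableAt (𝓡 d) 𝓘(ℝ, EuclideanSpace ℝ (Fin n)) f a) (v : TangentSpace (𝓡 d) a) :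
    mvfderiv (𝓡 d) (fun b => L (f b)) a v = L (mvfderiv (𝓡 d) f a v) := by
  have h := mfderiv_comp (I' := 𝓘(ℝ, EuclideanSpace ℝ (Fin n)))
    (I'' := 𝓘(ℝ, EuclideanSpace ℝ (Fin k))) a (g := L)
    L.differentiableAt.mdifferentiableAt hf
  rw [ContinuousLinearMap.mfderiv_eq] at h
  exact congrArg (fun L => L v) h

lemma mdifferentiableAt_clm_comp {n k : ℕ}
    (L : EuclideanSpace ℝ (Fin n) →L[ℝ] EuclideanSpace ℝ (Fin k))
    {f : G → EuclideanSpace ℝ (Fin n)} {a : G}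
    (hf : MDifferentiableAt (𝓡 d) 𝓘(ℝ, EuclideanSpace ℝ (Fin n)) f a) :
    MDifferentiableAt (𝓡 d) 𝓘(ℝ, EuclideanSpace ℝ (Fin k)) (fun b => L (f b)) a :=
  L.differentiable.comp_mdifferentiableAt hf

variable {K : Subgroup G}
  [ChartedSpace (EuclideanSpace ℝ (Fin m)) (G ⧸ K)] [IsManifold (𝓡 m) ω (G ⧸ K)]

/-- A field of endomorphisms, with values in the endomorphisms of the model space. -/
def endAt {n : ℕ} {M : Type*} [TopologicalSpace M] [ChartedSpace (EuclideanSpace ℝ (Fin n)) M]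
    (N : EndField n M) (x : M) : EuclideanSpace ℝ (Fin n) →L[ℝ] EuclideanSpace ℝ (Fin n) := N x

lemma AnalyticVFieldAt.app {n : ℕ} {M : Type*} [TopologicalSpace M]
    [ChartedSpace (EuclideanSpace ℝ (Fin n)) M] [IsManifold (𝓡 n) ω M] {N : EndField n M}
    (hN : AnalyticEndField N)
    {X : VField n M} {x : M} (h : AnalyticVFieldAt X x) : AnalyticVFieldAt (N.app X) x :=
  ContMDiffAt.comp x hN.contMDiffAt h

lemma AnalyticVFieldAt.eventually {n : ℕ} {M : Type*} [TopologicalSpace M]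
    [ChartedSpace (EuclideanSpace ℝ (Fin n)) M] [IsManifold (𝓡 n) ω M]
    {X : VField n M} {x : M} (h : AnalyticVFieldAt X x) :
    ∀ᶠ y in 𝓝 x, AnalyticVFieldAt X y :=
  (contMDiffAt_iff_contMDiffAt_nhds (by simp)).1 h

variable (hP : Manifold.IsSubmersion (𝓡 d) (𝓡 m) ω (fun a : G => (a : G ⧸ K)))
include hP

lemma exists_rightInverse_projDeriv :
    ∃ ρ : EuclideanSpace ℝ (Fin m) →L[ℝ] EuclideanSpace ℝ (Fin d),
      ∀ u, projDeriv d m K 1 (ρ u) = u := by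
  obtain ⟨g, hg⟩ := LinearMap.exists_rightInverse_of_surjective
    (projDeriv d m K 1 : EuclideanSpace ℝ (Fin d) →ₗ[ℝ] EuclideanSpace ℝ (Fin m))
    (LinearMap.range_eq_top.2 (projDeriv_surjective hP 1))
  exact ⟨LinearMap.toContinuousLinearMap g, fun u => congrArg (fun L => L u) hg⟩

lemma mdifferentiableAt_pullFun {X : VField m (G ⧸ K)} {a : G}
    (hX : AnalyticVFieldAt X (a : G ⧸ K)) :
    MDifferentiableAt (𝓡 d) 𝓘(ℝ, EuclideanSpace ℝ (Fin m)) (pullFun X) a :=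
  (contMDiffAt_pullFun hP hX).mdifferentiableAt (by simp)

variable (ρ : EuclideanSpace ℝ (Fin m) →L[ℝ] EuclideanSpace ℝ (Fin d))
  (hρ : ∀ u, projDeriv d m K 1 (ρ u) = u)
include hρ

/-- A fixed linear right inverse `ρ` of the projection gives the lift `ρ ∘ pullFun X` of every field
`X`. Since `ρ` is constant and `π ∘ ρ = id`, it disappears from the differentiated functions. -/
theorem vbr_eq_of_rightInverse {X Y : VField m (G ⧸ K)} {a : G}
    (hX : AnalyticVFieldAt X (a : G ⧸ K)) (hY : AnalyticVFieldAt Y (a : G ⧸ K)) :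
    vbr X Y (a : G ⧸ K) = smulDeriv m a ((1 : G) : G ⧸ K)
      (projDeriv d m K 1 (lieBr d G (ρ (pullFun X a)) (ρ (pullFun Y a))) +
        (mvfderiv (𝓡 d) (pullFun Y) a (leftField (fun b => ρ (pullFun X b)) a) -
        mvfderiv (𝓡 d) (pullFun X) a (leftField (fun b => ρ (pullFun Y b)) a))) := by
  have lift : ∀ (X : VField m (G ⧸ K)) (b : G),
      transDeriv d m K b (ρ (pullFun X b)) = X (b : G ⧸ K) := by
    intro X b
    rw [transDeriv_eq hP, hρ, smulDeriv_pullFun hP]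
  have e := vbr_of_lift hP (hX.mdifferentiableAt (by simp)) (hY.mdifferentiableAt (by simp))
    (mdifferentiableAt_clm_comp ρ (mdifferentiableAt_pullFun hP hX))
    (mdifferentiableAt_clm_comp ρ (mdifferentiableAt_pullFun hP hY)) (lift X) (lift Y)
  rw [e, transDeriv_eq hP, mvfderiv_clm_comp ρ (mdifferentiableAt_pullFun hP hX),
    mvfderiv_clm_comp ρ (mdifferentiableAt_pullFun hP hY), map_add, map_sub, hρ, hρ]

/-- The Nijenhuis torsion of an invariant tensor on `G/K`, in terms of the Lie algebra. -/
theorem nijenhuisTorsion_eq {N : EndField m (G ⧸ K)}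
    {N₀ : EuclideanSpace ℝ (Fin m) →L[ℝ] EuclideanSpace ℝ (Fin m)} (hNa : AnalyticEndField N)
    (hN : ∀ (a : G) u, endAt N (a : G ⧸ K) (smulDeriv m a ((1 : G) : G ⧸ K) u) =
      smulDeriv m a ((1 : G) : G ⧸ K) (N₀ u))
    {X Y : VField m (G ⧸ K)} {a : G}
    (hX : AnalyticVFieldAt X (a : G ⧸ K)) (hY : AnalyticVFieldAt Y (a : G ⧸ K)) :
    nijenhuisTorsion N X Y (a : G ⧸ K) = smulDeriv m a ((1 : G) : G ⧸ K)
      (projDeriv d m K 1 (lieBr d G (ρ (N₀ (pullFun X a))) (ρ (N₀ (pullFun Y a)))) -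
      N₀ (projDeriv d m K 1 (lieBr d G (ρ (N₀ (pullFun X a))) (ρ (pullFun Y a))) +
        projDeriv d m K 1 (lieBr d G (ρ (pullFun X a)) (ρ (N₀ (pullFun Y a)))) -
        N₀ (projDeriv d m K 1 (lieBr d G (ρ (pullFun X a)) (ρ (pullFun Y a)))))) := by
  -- Invariance of `N` means that it acts on pulled back functions as the constant matrix `N₀`.
  have pull : ∀ (X : VField m (G ⧸ K)), pullFun (N.app X) = fun b : G => N₀ (pullFun X b) := by
    intro X
    funext b
    apply smulDeriv_one_injective hP b
    rw [smulDeriv_pullFun hP, ← hN, smulDeriv_pullFun hP]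
    rfl
  have e : nijenhuisTorsion N X Y (a : G ⧸ K) = vbr (N.app X) (N.app Y) (a : G ⧸ K) -
      endAt N (a : G ⧸ K) (vbr (N.app X) Y (a : G ⧸ K) + vbr X (N.app Y) (a : G ⧸ K) -
        endAt N (a : G ⧸ K) (vbr X Y (a : G ⧸ K))) := rfl
  have pX := mdifferentiableAt_pullFun hP hX
  have pY := mdifferentiableAt_pullFun hP hY
  have hNX := AnalyticVFieldAt.app hNa hX
  have hNY := AnalyticVFieldAt.app hNa hY
  rw [e, vbr_eq_of_rightInverse hP ρ hρ hNX hNY, vbr_eq_of_rightInverse hP ρ hρ hNX hY,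
    vbr_eq_of_rightInverse hP ρ hρ hX hNY, vbr_eq_of_rightInverse hP ρ hρ hX hY, pull X, pull Y]
  -- The constant `N₀` commutes with differentiation. All derivative terms then cancel in pairs, and
  -- only Lie brackets remain.
  simp only [mvfderiv_clm_comp N₀ pX, mvfderiv_clm_comp N₀ pY, ← map_add, ← map_sub, hN]
  congr 1
  simp only [map_add, map_sub]
  abel

/-- Brackets with a vertical vector. -/
theorem mvfderiv_pullFun_vertical {X : VField m (G ⧸ K)} {a : G}
    (hX : AnalyticVFieldAt X (a : G ⧸ K)) {κ : EuclideanSpace ℝ (Fin d)}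
    (hκ : projDeriv d m K 1 κ = 0) :
    mvfderiv (𝓡 d) (pullFun X) a (leftField (fun _ => κ) a) =
      - projDeriv d m K 1 (lieBr d G κ (ρ (pullFun X a))) := by
  have lift : ∀ (X : VField m (G ⧸ K)) (b : G),
      transDeriv d m K b (ρ (pullFun X b)) = X (b : G ⧸ K) := by
    intro X b
    rw [transDeriv_eq hP, hρ, smulDeriv_pullFun hP]
  have h0 : AnalyticVFieldAt (fun _ => 0 : VField m (G ⧸ K)) (a : G ⧸ K) :=
    Bundle.contMDiff_zeroSection _ _ _
  -- The left invariant field of a vertical `κ` is a lift of the zero field. The bracket downstairs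
  -- is therefore zero, and the equation can be solved for the derivative along `κ`.
  have e := vbr_of_lift hP (X := fun _ => 0) (Y := X) (f := fun _ => κ) (a := a)
    (h0.mdifferentiableAt (by simp)) (hX.mdifferentiableAt (by simp)) mdifferentiableAt_const
    (mdifferentiableAt_clm_comp ρ (mdifferentiableAt_pullFun hP hX))
    (fun b => by rw [transDeriv_eq hP, hκ]; exact map_zero _) (lift X)
  have e0 : vbr (fun _ => 0 : VField m (G ⧸ K)) X (a : G ⧸ K) = 0 :=
    congrFun (mlieBracket_zero_left (I := 𝓡 m) (W := X)) _
  rw [e0, mvfderiv_clm_comp ρ (mdifferentiableAt_pullFun hP hX), mvfderiv_const,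
    transDeriv_eq hP] at e
  have e1 := smulDeriv_one_injective hP a (e.symm.trans (map_zero _).symm)
  have e2 : (0 : TangentSpace (𝓡 d) a →L[ℝ] EuclideanSpace ℝ (Fin d))
    (leftField (fun b => ρ (pullFun X b)) a) = 0 := rfl
  rw [e2, sub_zero, map_add, hρ] at e1
  exact (neg_eq_of_add_eq_zero_right e1).symm

omit hρ in
/-- The Lie algebra of `K` is a subalgebra. -/
theorem projDeriv_lieBr_vertical {κ κ' : EuclideanSpace ℝ (Fin d)}
    (hκ : projDeriv d m K 1 κ = 0) (hκ' : projDeriv d m K 1 κ' = 0) :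
    projDeriv d m K 1 (lieBr d G κ κ') = 0 := by
  have h0 : AnalyticVFieldAt (fun _ => 0 : VField m (G ⧸ K)) ((1 : G) : G ⧸ K) :=
    Bundle.contMDiff_zeroSection _ _ _
  -- Both left invariant fields lift the zero field, so their bracket projects to zero.
  have e := vbr_of_lift hP (X := fun _ => 0) (Y := fun _ => 0) (f := fun _ => κ) (h := fun _ => κ')
    (a := 1)
    (h0.mdifferentiableAt (by simp)) (h0.mdifferentiableAt (by simp)) mdifferentiableAt_const
    mdifferentiableAt_const
    (fun b => by rw [transDeriv_eq hP, hκ]; exact map_zero _)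
    (fun b => by rw [transDeriv_eq hP, hκ']; exact map_zero _)
  have e0 : vbr (fun _ => 0 : VField m (G ⧸ K)) (fun _ => 0) ((1 : G) : G ⧸ K) = 0 :=
    congrFun (mlieBracket_zero_left (I := 𝓡 m) (W := fun _ => 0)) _
  rw [e0, mvfderiv_const, mvfderiv_const, transDeriv_one] at e
  have e2 : lieBr d G κ κ' + ((0 : TangentSpace (𝓡 d) (1 : G) →L[ℝ] EuclideanSpace ℝ (Fin d))
    (leftField (fun _ => κ) 1) - (0 : TangentSpace (𝓡 d) (1 : G) →L[ℝ] EuclideanSpace ℝ (Fin d))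
    (leftField (fun _ => κ') 1)) = lieBr d G κ κ' := by
      simp
  rw [e2] at e
  exact e.symm

omit hρ in
/-- The local vector field `x ↦ σ(x)_* u` for a local section `σ`. -/
theorem analyticVFieldAt_section {σ : G ⧸ K → G} {a : G}
    (sσ : ContMDiffAt (𝓡 m) (𝓡 d) ω σ (a : G ⧸ K))
    (hσ : ∀ᶠ y in 𝓝 (a : G ⧸ K), ((σ y : G) : G ⧸ K) = y) (u : EuclideanSpace ℝ (Fin m)) :
    AnalyticVFieldAt (fun y => smulDeriv m (σ y) ((1 : G) : G ⧸ K) u : VField m (G ⧸ K))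
      (a : G ⧸ K) := by
  have h1 : ContMDiffAt (𝓡 m) ((𝓡 d).prod (𝓡 m).tangent) ω
      (fun y : G ⧸ K => (σ y, (⟨((1 : G) : G ⧸ K), u⟩ : TangentBundle (𝓡 m) (G ⧸ K))))
      (a : G ⧸ K) := sσ.prodMk contMDiffAt_const
  have h2 := ContMDiffAt.comp (a : G ⧸ K)
    (contMDiff_tangent_smul (contMDiff_smul_quotient hP)).contMDiffAt h1
  refine h2.congr_of_eventuallyEq ?_
  filter_upwards [hσ] with y hy
  have : σ y • ((1 : G) : G ⧸ K) = y := (smul_mk_one hP _).trans hy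
  exact Bundle.TotalSpace.ext this.symm (by rfl)

omit hρ in
-- Every tangent vector extends to a local analytic field, so the vanishing of the torsion on fields
-- gives an identity for all vectors.
theorem exists_analyticVField (a : G) (u : EuclideanSpace ℝ (Fin m)) :
    ∃ X : VField m (G ⧸ K), AnalyticVFieldAt X (a : G ⧸ K) ∧ pullFun X a = u := by
  obtain ⟨σ, sσ, hσa, hσ⟩ := exists_local_section hP a
  refine ⟨_, analyticVFieldAt_section hP sσ hσ u, ?_⟩
  apply smulDeriv_one_injective hP a
  refine (smulDeriv_pullFun hP _ a).trans ?_
  rw [hσa]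

end

/-! ### Invariant extensions of an endomorphism at the base point. -/

section

variable {d m : ℕ} {G : Type*} [TopologicalSpace G] [ChartedSpace (EuclideanSpace ℝ (Fin d)) G]
  [Group G] [LieGroup (𝓡 d) ω G] {K : Subgroup G}
  [ChartedSpace (EuclideanSpace ℝ (Fin m)) (G ⧸ K)] [IsManifold (𝓡 m) ω (G ⧸ K)]

variable (d K) in
/-- The differential of the projection at `1`, on the Lie algebra. -/
def lieProj : GroupLieAlgebra (𝓡 d) G →ₗ[ℝ] EuclideanSpace ℝ (Fin m) :=
  (projDeriv d m K 1 : EuclideanSpace ℝ (Fin d) →ₗ[ℝ] EuclideanSpace ℝ (Fin m))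

/-- The tensor `N` on `G/K` is the invariant extension of `N₀`. -/
def IsInvariantExtension (N : EndField m (G ⧸ K))
    (N₀ : EuclideanSpace ℝ (Fin m) →L[ℝ] EuclideanSpace ℝ (Fin m)) : Prop :=
  ∀ (a : G) u, endAt N (a : G ⧸ K) (smulDeriv m a ((1 : G) : G ⧸ K) u) =
      smulDeriv m a ((1 : G) : G ⧸ K) (N₀ u)

variable (hP : Manifold.IsSubmersion (𝓡 d) (𝓡 m) ω (fun a : G => (a : G ⧸ K)))
include hP

theorem IsInvariantEndField.isInvariantExtension {N : EndField m (G ⧸ K)}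
    (h : IsInvariantEndField N) : IsInvariantExtension N (endAt N ((1 : G) : G ⧸ K)) := by
  intro a u
  have := h a ((1 : G) : G ⧸ K) u
  rw [smul_mk_one hP] at this
  exact this

theorem IsInvariantExtension.isInvariantEndField {N : EndField m (G ⧸ K)}
    {N₀ : EuclideanSpace ℝ (Fin m) →L[ℝ] EuclideanSpace ℝ (Fin m)}
    (h : IsInvariantExtension N N₀) : IsInvariantEndField N := by
  intro a x v
  obtain ⟨b, rfl⟩ := QuotientGroup.mk_surjective x
  have key : endAt N ((a * b : G) : G ⧸ K) (smulDeriv m a (b : G ⧸ K) v) =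
      smulDeriv m a (b : G ⧸ K) (endAt N (b : G ⧸ K) v) := by
    have e1 := smulDeriv_smulDeriv_inv_one hP b v
    set u := smulDeriv m b⁻¹ (b : G ⧸ K) v with hu
    have e2 : ∀ u, smulDeriv m a (b : G ⧸ K) (smulDeriv m b ((1 : G) : G ⧸ K) u) =
        smulDeriv m (a * b) ((1 : G) : G ⧸ K) u := by
      intro u
      rw [smulDeriv_mul (contMDiff_smul_quotient hP), smul_mk_one hP]
    rw [← e1, e2, h, h, e2]
  exact key

theorem IsInvariantExtension.unique {N N' : EndField m (G ⧸ K)}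
    {N₀ : EuclideanSpace ℝ (Fin m) →L[ℝ] EuclideanSpace ℝ (Fin m)}
    (h : IsInvariantExtension N N₀) (h' : IsInvariantExtension N' N₀) : N = N' := by
  funext x
  obtain ⟨b, rfl⟩ := QuotientGroup.mk_surjective x
  have : endAt N (b : G ⧸ K) = endAt N' (b : G ⧸ K) := by
    ext1 v
    rw [← smulDeriv_smulDeriv_inv_one hP b v, h, h']
  exact this

/-- An endomorphism of `T_o(G/K)` which commutes with the isotropy representation has an invariant
extension. -/
theorem exists_isInvariantExtension
    (N₀ : EuclideanSpace ℝ (Fin m) →L[ℝ] EuclideanSpace ℝ (Fin m))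
    (hc : ∀ a ∈ K, ∀ u, N₀ (smulDeriv m a ((1 : G) : G ⧸ K) u) =
      smulDeriv m a ((1 : G) : G ⧸ K) (N₀ u)) :
    ∃ N : EndField m (G ⧸ K), IsInvariantExtension N N₀ := by
  -- The tensor is `b_* N₀ b_*⁻¹` for a chosen representative `b` of the coset. Another
  -- representative differs by an element of `K`, with which `N₀` commutes by `hc`. The choice need
  -- not be continuous, because analyticity follows separately from local sections.
  refine ⟨fun x => (smulDeriv m (Quotient.out x : G) ((1 : G) : G ⧸ K)).comp
    (N₀.comp (smulDeriv m (Quotient.out x : G)⁻¹ x)), fun a u => ?_⟩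
  set b : G := Quotient.out (a : G ⧸ K) with hb
  have hba : (b : G ⧸ K) = (a : G ⧸ K) := Quotient.out_eq _
  have hk : b⁻¹ * a ∈ K := QuotientGroup.eq.1 hba
  change smulDeriv m b ((1 : G) : G ⧸ K) (N₀ (smulDeriv m b⁻¹ (a : G ⧸ K)
    (smulDeriv m a ((1 : G) : G ⧸ K) u))) = _
  have e1 : smulDeriv m b⁻¹ (a : G ⧸ K) (smulDeriv m a ((1 : G) : G ⧸ K) u) =
      smulDeriv m (b⁻¹ * a) ((1 : G) : G ⧸ K) u := by
    rw [smulDeriv_mul (contMDiff_smul_quotient hP), smul_mk_one hP]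
  have e2 : ∀ u, smulDeriv m b ((1 : G) : G ⧸ K) (smulDeriv m (b⁻¹ * a) ((1 : G) : G ⧸ K) u) =
      smulDeriv m a ((1 : G) : G ⧸ K) u := by
    intro u
    have h1 : (b⁻¹ * a) • ((1 : G) : G ⧸ K) = ((1 : G) : G ⧸ K) := by
      rw [smul_mk_one hP]
      exact (QuotientGroup.eq.2 (by simpa using hk)).symm
    have := smulDeriv_mul (contMDiff_smul_quotient hP) b (b⁻¹ * a) ((1 : G) : G ⧸ K) u
    rw [h1, mul_inv_cancel_left] at this
    exact this.symm
  rw [e1, hc _ hk, e2]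

theorem IsInvariantExtension.commute_isotropy {N : EndField m (G ⧸ K)}
    {N₀ : EuclideanSpace ℝ (Fin m) →L[ℝ] EuclideanSpace ℝ (Fin m)}
    (h : IsInvariantExtension N N₀) (a : G) (ha : a ∈ K) (u : EuclideanSpace ℝ (Fin m)) :
    N₀ (smulDeriv m a ((1 : G) : G ⧸ K) u) = smulDeriv m a ((1 : G) : G ⧸ K) (N₀ u) := by
  have h1 := h 1 (smulDeriv m a ((1 : G) : G ⧸ K) u)
  rw [smulDeriv_one, smulDeriv_one] at h1
  have e : (a : G ⧸ K) = ((1 : G) : G ⧸ K) := (QuotientGroup.eq.2 (by simpa using ha)).symm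
  rw [← h1, ← h a, e]

/-- Invariant extensions are analytic. -/
theorem IsInvariantExtension.analytic {N : EndField m (G ⧸ K)}
    {N₀ : EuclideanSpace ℝ (Fin m) →L[ℝ] EuclideanSpace ℝ (Fin m)}
    (h : IsInvariantExtension N N₀) : AnalyticEndField N := by
  rintro ⟨x, v⟩
  obtain ⟨a, rfl⟩ := QuotientGroup.mk_surjective x
  obtain ⟨σ, sσ, hσa, hσ⟩ := exists_local_section hP a
  set w₀ : TangentBundle (𝓡 m) (G ⧸ K) := ⟨(a : G ⧸ K), v⟩ with hw
  have hact := contMDiff_tangent_smul (contMDiff_smul_quotient hP)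
  have cproj : ContMDiffAt (𝓡 m).tangent (𝓡 m) ω
      (fun w : TangentBundle (𝓡 m) (G ⧸ K) => w.1) w₀ :=
    (Bundle.contMDiff_proj (TangentSpace (𝓡 m))).contMDiffAt
  have cσ : ContMDiffAt (𝓡 m).tangent (𝓡 d) ω
      (fun w : TangentBundle (𝓡 m) (G ⧸ K) => σ w.1) w₀ := ContMDiffAt.comp w₀ sσ cproj
  have hσ' : ∀ᶠ w in 𝓝 w₀, ((σ w.1 : G) : G ⧸ K) = w.1 := cproj.continuousAt.eventually hσ
  have c1 := ContMDiffAt.comp w₀ hact.contMDiffAt (cσ.inv.prodMk contMDiffAt_id)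
  have c2 := contMDiffAt_tangent_snd (z := ((1 : G) : G ⧸ K)) c1 (by
    filter_upwards [hσ'] with w hw
    change (σ w.1)⁻¹ • w.1 = _
    rw [← mk_inv_smul hP (σ w.1), hw])
  -- Near `a K` the tensor is `σ_* N₀ σ_*⁻¹`: translate back to the fixed space `T_o(G/K)`, apply
  -- the constant `N₀`, translate forward.
  have c3 : ContMDiffAt (𝓡 m).tangent 𝓘(ℝ, EuclideanSpace ℝ (Fin m)) ω
      (fun w : TangentBundle (𝓡 m) (G ⧸ K) => N₀ (smulDeriv m (σ w.1)⁻¹ w.1 w.2)) w₀ :=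
    ContMDiffAt.comp w₀ (N₀.contDiff.contMDiff.contMDiffAt) c2
  have c4 := (contMDiffAt_tangent_fiber_iff ((1 : G) : G ⧸ K) _ w₀).2 c3
  have c5 := ContMDiffAt.comp w₀ hact.contMDiffAt (cσ.prodMk c4)
  refine c5.congr_of_eventuallyEq ?_
  filter_upwards [hσ'] with w hw
  have e1 : σ w.1 • ((1 : G) : G ⧸ K) = w.1 := (smul_mk_one hP _).trans hw
  have e2 : endAt N w.1 w.2 = smulDeriv m (σ w.1) ((1 : G) : G ⧸ K)
      (N₀ (smulDeriv m (σ w.1)⁻¹ w.1 w.2)) := by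
    have h1 := h (σ w.1) (smulDeriv m (σ w.1)⁻¹ w.1 w.2)
    have h2 := smulDeriv_smulDeriv_inv_one hP (σ w.1) w.2
    rw [hw] at h1 h2
    rw [h2] at h1
    exact h1
  refine Bundle.TotalSpace.ext e1.symm ?_
  exact heq_of_eq e2

variable (ρ : EuclideanSpace ℝ (Fin m) →L[ℝ] EuclideanSpace ℝ (Fin d))
  (hρ : ∀ u, projDeriv d m K 1 (ρ u) = u)

omit hP in
lemma projDeriv_sub_rightInverse (hρ : ∀ u, projDeriv d m K 1 (ρ u) = u)
    (v : EuclideanSpace ℝ (Fin d)) : projDeriv d m K 1 (v - ρ (projDeriv d m K 1 v)) = 0 := by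
  rw [map_sub, hρ, sub_self]

include hρ

/-- The value at the base point of an invariant tensor commutes with the isotropy representation of
the Lie algebra of `K`. -/
theorem projDeriv_lieBr_of_isInvariantExtension {N : EndField m (G ⧸ K)}
    {N₀ : EuclideanSpace ℝ (Fin m) →L[ℝ] EuclideanSpace ℝ (Fin m)}
    (h : IsInvariantExtension N N₀) {κ : EuclideanSpace ℝ (Fin d)}
    (hκ : projDeriv d m K 1 κ = 0) (u : EuclideanSpace ℝ (Fin m)) :
    projDeriv d m K 1 (lieBr d G κ (ρ (N₀ u))) = N₀ (projDeriv d m K 1 (lieBr d G κ (ρ u))) := by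
  obtain ⟨X, hX, rfl⟩ := exists_analyticVField hP (1 : G) u
  have hNX := AnalyticVFieldAt.app (h.analytic hP) hX
  have pull : pullFun (N.app X) = fun b : G => N₀ (pullFun X b) := by
    funext b
    apply smulDeriv_one_injective hP b
    rw [smulDeriv_pullFun hP, ← h, smulDeriv_pullFun hP]
    rfl
  -- The vertical derivatives of the functions of `X` and `N X` are computed by brackets with `κ`,
  -- and these functions differ by the constant `N₀`.
  have h1 := mvfderiv_pullFun_vertical hP ρ hρ hX hκ
  have h2 := mvfderiv_pullFun_vertical hP ρ hρ hNX hκ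
  rw [pull, mvfderiv_clm_comp N₀ (mdifferentiableAt_pullFun hP hX), h1, map_neg] at h2
  exact (neg_injective h2).symm

theorem isAlgNijenhuis_of_isNijenhuis {N : EndField m (G ⧸ K)}
    {N₀ : EuclideanSpace ℝ (Fin m) →L[ℝ] EuclideanSpace ℝ (Fin m)}
    (h : IsInvariantExtension N N₀) (hn : IsNijenhuis N) :
    IsAlgNijenhuis (lieProj d K) (N₀ : EuclideanSpace ℝ (Fin m) →ₗ[ℝ] EuclideanSpace ℝ
      (Fin m)) := by
  have hτ : ∀ u w : EuclideanSpace ℝ (Fin m),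
      projDeriv d m K 1 (lieBr d G (ρ (N₀ u)) (ρ (N₀ w))) =
      N₀ (projDeriv d m K 1 (lieBr d G (ρ (N₀ u)) (ρ w)) +
        projDeriv d m K 1 (lieBr d G (ρ u) (ρ (N₀ w))) -
        N₀ (projDeriv d m K 1 (lieBr d G (ρ u) (ρ w)))) := by
    intro u w
    obtain ⟨X, hX, rfl⟩ := exists_analyticVField hP (1 : G) u
    obtain ⟨Y, hY, rfl⟩ := exists_analyticVField hP (1 : G) w
    have e := nijenhuisTorsion_eq hP ρ hρ (h.analytic hP) h hX hY
    rw [hn _ X Y hX hY] at e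
    exact sub_eq_zero.1 (smulDeriv_one_injective hP 1 (e.symm.trans (map_zero _).symm))
  have hv := fun {κ : EuclideanSpace ℝ (Fin d)} (hκ : projDeriv d m K 1 κ = 0)
    (u : EuclideanSpace ℝ (Fin m)) => projDeriv_lieBr_of_isInvariantExtension hP ρ hρ h hκ u
  have hv' : ∀ {κ : EuclideanSpace ℝ (Fin d)} (_ : projDeriv d m K 1 κ = 0)
    (u : EuclideanSpace ℝ (Fin m)),
    projDeriv d m K 1 (lieBr d G (ρ (N₀ u)) κ) = N₀ (projDeriv d m K 1 (lieBr d G (ρ u) κ)) := by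
    intro κ hκ u
    rw [lieBr_skew κ, lieBr_skew κ, map_neg, map_neg, hv hκ, map_neg]
  -- Passing from the lifts given by `ρ` to arbitrary ones adds vertical vectors. Mixed terms cancel
  -- because `N₀` commutes with the action of `𝔨`, and purely vertical ones vanish because `𝔨` is a
  -- subalgebra.
  have main : ∀ (u w : EuclideanSpace ℝ (Fin m)) (k l k' l' : EuclideanSpace ℝ (Fin d)),
      projDeriv d m K 1 k = 0 → projDeriv d m K 1 l = 0 → projDeriv d m K 1 k' = 0 →
      projDeriv d m K 1 l' = 0 →
      projDeriv d m K 1 (lieBr d G (ρ (N₀ u) + k') (ρ (N₀ w) + l')) =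
      N₀ (projDeriv d m K 1 (lieBr d G (ρ (N₀ u) + k') (ρ w + l)) +
        projDeriv d m K 1 (lieBr d G (ρ u + k) (ρ (N₀ w) + l')) -
        N₀ (projDeriv d m K 1 (lieBr d G (ρ u + k) (ρ w + l)))) := by
    intro u w k l k' l' hk hl hk' hl'
    simp only [lieBr_add_left, lieBr_add_right, map_add, map_sub, hτ, hv hk, hv hk', hv' hl,
      hv' hl', projDeriv_lieBr_vertical hP hk hl, projDeriv_lieBr_vertical hP hk' hl,
      projDeriv_lieBr_vertical hP hk hl', projDeriv_lieBr_vertical hP hk' hl', map_zero]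
    abel
  have main' : ∀ v w v' w' : EuclideanSpace ℝ (Fin d),
      projDeriv d m K 1 v' = N₀ (projDeriv d m K 1 v) →
      projDeriv d m K 1 w' = N₀ (projDeriv d m K 1 w) →
      projDeriv d m K 1 (lieBr d G v' w') =
      N₀ (projDeriv d m K 1 (lieBr d G v' w) + projDeriv d m K 1 (lieBr d G v w') -
        N₀ (projDeriv d m K 1 (lieBr d G v w))) := by
    intro v w v' w' e1 e2
    have := main (projDeriv d m K 1 v) (projDeriv d m K 1 w) _ _ _ _
      (projDeriv_sub_rightInverse ρ hρ v) (projDeriv_sub_rightInverse ρ hρ w)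
      (projDeriv_sub_rightInverse ρ hρ v') (projDeriv_sub_rightInverse ρ hρ w')
    rw [e1, e2] at this
    simpa only [add_sub_cancel] using this
  exact main'

theorem isNijenhuis_of_isAlgNijenhuis {N : EndField m (G ⧸ K)}
    {N₀ : EuclideanSpace ℝ (Fin m) →L[ℝ] EuclideanSpace ℝ (Fin m)}
    (h : IsInvariantExtension N N₀)
    (hn : IsAlgNijenhuis (lieProj d K)
      (N₀ : EuclideanSpace ℝ (Fin m) →ₗ[ℝ] EuclideanSpace ℝ (Fin m))) : IsNijenhuis N := by
  intro x X Y hX hY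
  obtain ⟨a, rfl⟩ := QuotientGroup.mk_surjective x
  refine (nijenhuisTorsion_eq hP ρ hρ (h.analytic hP) h hX hY).trans ?_
  have := hn (ρ (pullFun X a)) (ρ (pullFun Y a)) (ρ (N₀ (pullFun X a))) (ρ (N₀ (pullFun Y a)))
    ((hρ _).trans (congrArg N₀ (hρ _).symm)) ((hρ _).trans (congrArg N₀ (hρ _).symm))
  have e : projDeriv d m K 1 (lieBr d G (ρ (N₀ (pullFun X a))) (ρ (N₀ (pullFun Y a)))) = _ := this
  rw [e]
  refine Eq.trans ?_ (map_zero (smulDeriv m a ((1 : G) : G ⧸ K)))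
  congr 1
  exact sub_self _

end

/-! ### Velocities of curves in the left trivialization. -/

section

variable {d m : ℕ} {G : Type*} [TopologicalSpace G] [ChartedSpace (EuclideanSpace ℝ (Fin d)) G]
  [Group G] [LieGroup (𝓡 d) ω G] {K : Subgroup G}
  [ChartedSpace (EuclideanSpace ℝ (Fin m)) (G ⧸ K)] [IsManifold (𝓡 m) ω (G ⧸ K)]

/-- The velocity of a curve. -/
def velocity {n : ℕ} {M : Type*} [TopologicalSpace M] [ChartedSpace (EuclideanSpace ℝ (Fin n)) M]
    (γ : ℝ → M) (t : ℝ) : EuclideanSpace ℝ (Fin n) :=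
  (mfderiv 𝓘(ℝ, ℝ) (𝓡 n) γ t : ℝ →L[ℝ] EuclideanSpace ℝ (Fin n)) 1

/-- This is the tangent map of `γ` composed with the section `r ↦ (r, 1)`. The curve is analytic
only near `t`, hence the detour through the tangent map within an open set. -/
lemma contMDiffAt_velocity {n : ℕ} {M : Type*} [TopologicalSpace M]
    [ChartedSpace (EuclideanSpace ℝ (Fin n)) M] [IsManifold (𝓡 n) ω M] {γ : ℝ → M} {t : ℝ}
    (h : ContMDiffAt 𝓘(ℝ, ℝ) (𝓡 n) ω γ t) :
    ContMDiffAt 𝓘(ℝ, ℝ) (𝓡 n).tangent ω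
      (fun r => (⟨γ r, velocity γ r⟩ : TangentBundle (𝓡 n) M)) t := by
  obtain ⟨u, hu, hut, hγ⟩ : ∃ u, IsOpen u ∧ t ∈ u ∧ ContMDiffOn 𝓘(ℝ, ℝ) (𝓡 n) ω γ u := by
    have := (contMDiffAt_iff_contMDiffAt_nhds (by simp)).1 h
    obtain ⟨u, h1, h2, h3⟩ := mem_nhds_iff.1 this
    exact ⟨u, h2, h3, fun x hx => (h1 hx).contMDiffWithinAt⟩
  have hT := hγ.contMDiffOn_tangentMapWithin (m := ω) (by simp) hu.uniqueMDiffOn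
  have h1 : ContMDiffAt 𝓘(ℝ, ℝ) 𝓘(ℝ, ℝ).tangent ω
      (fun r : ℝ => (⟨r, (1 : ℝ)⟩ : TangentBundle 𝓘(ℝ, ℝ) ℝ)) t :=
    contMDiffAt_vectorSpace_iff_contDiffAt.2 contDiffAt_const
  have hmem : (Bundle.TotalSpace.proj ⁻¹' u : Set (TangentBundle 𝓘(ℝ, ℝ) ℝ)) ∈
      𝓝 (⟨t, (1 : ℝ)⟩ : TangentBundle 𝓘(ℝ, ℝ) ℝ) :=
    (FiberBundle.continuous_proj ℝ (TangentSpace 𝓘(ℝ, ℝ))).continuousAt.preimage_mem_nhds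
      (hu.mem_nhds hut)
  have h2 := ContMDiffAt.comp t (hT.contMDiffAt hmem) h1
  refine h2.congr_of_eventuallyEq ?_
  filter_upwards [hu.mem_nhds hut] with r hr
  have e := tangentMapWithin_eq_tangentMap (p := (⟨r, (1 : ℝ)⟩ : TangentBundle 𝓘(ℝ, ℝ) ℝ))
    (hu.uniqueMDiffOn r hr)
    ((hγ.contMDiffAt (hu.mem_nhds hr)).mdifferentiableAt (by simp))
  exact e.symm

variable (d) in
/-- The velocity of a curve in the left trivialization of `TG`. -/
def leftVelocity (γ : ℝ → G) (t : ℝ) : EuclideanSpace ℝ (Fin d) :=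
  smulDeriv d (γ t)⁻¹ (γ t) (velocity γ t)

lemma contMDiffAt_leftVelocity {γ : ℝ → G} {t : ℝ}
    (h : ContMDiffAt 𝓘(ℝ, ℝ) (𝓡 d) ω γ t) :
    ContMDiffAt 𝓘(ℝ, ℝ) 𝓘(ℝ, EuclideanSpace ℝ (Fin d)) ω (leftVelocity d γ) t := by
  have h1 := ContMDiffAt.comp t
    (contMDiff_tangent_smul (d := d) (contMDiff_smul_self (d := d) (G := G))).contMDiffAt
    (h.inv.prodMk (contMDiffAt_velocity h))
  exact contMDiffAt_tangent_snd (z := (1 : G)) h1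
    (Filter.Eventually.of_forall fun r => inv_mul_cancel (γ r))

lemma leftField_leftVelocity (γ : ℝ → G) (t : ℝ) :
    leftField (fun _ => leftVelocity d γ t) (γ t) = velocity γ t := by
  have h := smulDeriv_smulDeriv_inv (contMDiff_smul_self (d := d) (G := G)) (γ t) (1 : G)
    (velocity γ t)
  rw [smul_eq_mul, mul_one] at h
  exact h

lemma hasDerivAt_comp_curve {γ : ℝ → G} {t : ℝ} (hγ : ContMDiffAt 𝓘(ℝ, ℝ) (𝓡 d) ω γ t)
    {f : G → EuclideanSpace ℝ (Fin m)}
    (hf : MDifferentiableAt (𝓡 d) 𝓘(ℝ, EuclideanSpace ℝ (Fin m)) f (γ t)) :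
    HasDerivAt (fun r => f (γ r))
      (mvfderiv (𝓡 d) f (γ t) (leftField (fun _ => leftVelocity d γ t) (γ t))) t := by
  have h1 := HasMFDerivAt.comp t hf.hasMFDerivAt (hγ.mdifferentiableAt (by simp)).hasMFDerivAt
  rw [leftField_leftVelocity]
  have key : ∀ L : ℝ →L[ℝ] EuclideanSpace ℝ (Fin m),
      HasFDerivAt (fun r => f (γ r)) L t → HasDerivAt (fun r => f (γ r)) (L 1) t :=
    fun L hL => hL.hasDerivAt
  exact key _ (hasMFDerivAt_iff_hasFDerivAt.1 h1)

variable (hP : Manifold.IsSubmersion (𝓡 d) (𝓡 m) ω (fun a : G => (a : G ⧸ K)))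
include hP

/-- The projected curve is constant near `t`, and translating to the unit element commutes with
projecting. -/
lemma projDeriv_leftVelocity {γ : ℝ → G} {t : ℝ} (hγ : ContMDiffAt 𝓘(ℝ, ℝ) (𝓡 d) ω γ t)
    {z : G ⧸ K} (hz : ∀ᶠ r in 𝓝 t, ((γ r : G) : G ⧸ K) = z) :
    projDeriv d m K 1 (leftVelocity d γ t) = 0 := by
  have h0 : projDeriv d m K (γ t) (velocity γ t) = 0 := by
    have h1 := mfderiv_comp t (I' := 𝓡 d) (I'' := 𝓡 m) (g := fun a : G => (a : G ⧸ K))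
      (hP.contMDiff.mdifferentiableAt (by simp)) (hγ.mdifferentiableAt (by simp))
    have h2 : mfderiv 𝓘(ℝ, ℝ) (𝓡 m) ((fun a : G => (a : G ⧸ K)) ∘ γ) t =
        mfderiv 𝓘(ℝ, ℝ) (𝓡 m) (fun _ : ℝ => z) t := Filter.EventuallyEq.mfderiv_eq hz
    have h3 := h1.symm.trans (h2.trans mfderiv_const)
    exact congrArg (fun L : ℝ →L[ℝ] EuclideanSpace ℝ (Fin m) => L 1) h3
  have h1 := projDeriv_smulDeriv hP (γ t)⁻¹ (γ t) (velocity γ t)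
  rw [h0, inv_mul_cancel] at h1
  exact h1.trans (map_zero _)

end

/-! ### Integrating infinitesimal invariance when `K` is connected. -/

section

variable {d m : ℕ} {G : Type*} [TopologicalSpace G] [ChartedSpace (EuclideanSpace ℝ (Fin d)) G]
  [Group G] [LieGroup (𝓡 d) ω G] {K : Subgroup G}
  [ChartedSpace (EuclideanSpace ℝ (Fin m)) (G ⧸ K)] [IsManifold (𝓡 m) ω (G ⧸ K)]

variable (d G) in
/-- The Lie bracket as a continuous bilinear map. -/
def lieBrCLM : EuclideanSpace ℝ (Fin d) →L[ℝ] EuclideanSpace ℝ (Fin d) →L[ℝ]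
    EuclideanSpace ℝ (Fin d) :=
  LinearMap.toContinuousLinearMap (LinearMap.toContinuousLinearMap.toLinearMap.comp
    (LinearMap.mk₂ ℝ (lieBr d G) lieBr_add_left lieBr_smul_left lieBr_add_right lieBr_smul_right))

lemma lieBrCLM_apply (v w : EuclideanSpace ℝ (Fin d)) : lieBrCLM d G v w = lieBr d G v w := rfl

variable (hP : Manifold.IsSubmersion (𝓡 d) (𝓡 m) ω (fun a : G => (a : G ⧸ K)))
include hP

/-- On `K` the pulled back function only sees the value of `X` at the base point, moved by the
isotropy representation. -/
lemma pullFun_of_mem {X : VField m (G ⧸ K)} {b : G} (hb : b ∈ K) :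
    pullFun X b = smulDeriv m b⁻¹ ((1 : G) : G ⧸ K) (pullFun X 1) := by
  have e : (b : G ⧸ K) = ((1 : G) : G ⧸ K) := (QuotientGroup.eq.2 (by simpa using hb)).symm
  unfold pullFun
  rw [e, inv_one]
  exact congrArg _ (smulDeriv_one (G := G) ((1 : G) : G ⧸ K) (X ((1 : G) : G ⧸ K))).symm

/-- Infinitesimal invariance implies invariance near the unit element. -/
theorem eventually_commute_isotropy
    {N₀ : EuclideanSpace ℝ (Fin m) →L[ℝ] EuclideanSpace ℝ (Fin m)}
    (ρ : EuclideanSpace ℝ (Fin m) →L[ℝ] EuclideanSpace ℝ (Fin d))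
    (hρ : ∀ u, projDeriv d m K 1 (ρ u) = u)
    (hv : ∀ κ, projDeriv d m K 1 κ = 0 → ∀ u,
      projDeriv d m K 1 (lieBr d G κ (ρ (N₀ u))) = N₀ (projDeriv d m K 1 (lieBr d G κ (ρ u))))
    (u : EuclideanSpace ℝ (Fin m)) :
    ∀ᶠ b in 𝓝 (1 : G), b ∈ K → N₀ (smulDeriv m b⁻¹ ((1 : G) : G ⧸ K) u) =
      smulDeriv m b⁻¹ ((1 : G) : G ⧸ K) (N₀ u) := by
  obtain ⟨X, hX, hXu⟩ := exists_analyticVField hP (1 : G) u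
  obtain ⟨Y, hY, hYu⟩ := exists_analyticVField hP (1 : G) (N₀ u)
  have hcont : Filter.Tendsto (fun b : G => (b : G ⧸ K)) (𝓝 1) (𝓝 ((1 : G) : G ⧸ K)) :=
    hP.contMDiff.continuous.continuousAt
  have hU := (hcont.eventually hX.eventually).and (hcont.eventually hY.eventually)
  filter_upwards [eventually_exists_curve hP (1 : G) hU] with b hb hbK
  obtain ⟨γ, h0, h1, hγ⟩ := hb (QuotientGroup.eq.2 (by simpa using hbK)).symm
  -- Since `X`, `Y` have the values `u`, `N₀ u` at the base point, `δ t` is the failure of `N₀` to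
  -- commute with the isotropy action of `(γ t)⁻¹` on `u`.
  set δ : ℝ → EuclideanSpace ℝ (Fin m) := fun t => N₀ (pullFun X (γ t)) - pullFun Y (γ t) with hδ
  have hd : ∀ t ∈ Set.Icc (0 : ℝ) 1, HasDerivAt δ
      (- projDeriv d m K 1 (lieBrCLM d G (leftVelocity d γ t) (ρ (δ t)))) t := by
    intro t ht
    obtain ⟨-, ⟨aX, aY⟩, hev, hs⟩ := hγ t ht
    have hκ := projDeriv_leftVelocity hP hs hev
    have dX := hasDerivAt_comp_curve hs (mdifferentiableAt_pullFun hP aX)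
    have dY := hasDerivAt_comp_curve hs (mdifferentiableAt_pullFun hP aY)
    rw [mvfderiv_pullFun_vertical hP ρ hρ aX hκ] at dX
    rw [mvfderiv_pullFun_vertical hP ρ hρ aY hκ] at dY
    have dX' := N₀.hasFDerivAt.comp_hasDerivAt t dX
    refine (dX'.sub dY).congr_deriv ?_
    -- Infinitesimal invariance moves `N₀` inside the bracket, so that the derivative becomes linear
    -- in `δ` itself.
    rw [map_neg, ← hv _ hκ, hδ]
    simp only [map_sub, lieBrCLM_apply]
    abel
  have hκc : ContinuousOn (leftVelocity d γ) (Set.Icc 0 1) := fun t ht =>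
    (contMDiffAt_leftVelocity (hγ t ht).2.2.2).continuousAt.continuousWithinAt
  obtain ⟨C, hC⟩ := isCompact_Icc.exists_bound_of_continuousOn hκc
  set π := projDeriv d m K (1 : G)
  -- Grönwall: the linear equation gives `‖δ'‖ ≤ const * ‖δ‖`, where `C` bounds the left velocity on
  -- the compact interval, and `δ 0 = 0`.
  have hz := eq_zero_of_abs_deriv_le_mul_abs_self_of_eq_zero_right
    (f := δ) (K := ‖π‖ * (‖lieBrCLM d G‖ * C * ‖ρ‖)) (a := 0) (b := 1)
    (fun t ht => (hd t ht).continuousAt.continuousWithinAt)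
    (fun t ht => (hd t ⟨ht.1, ht.2.le⟩).hasDerivWithinAt)
    (by simp only [hδ, h0, hXu, hYu, sub_self])
    (fun t ht => by
      have hCt := hC t ⟨ht.1, ht.2.le⟩
      rw [norm_neg]
      calc ‖π (lieBrCLM d G (leftVelocity d γ t) (ρ (δ t)))‖
          ≤ ‖π‖ * (‖lieBrCLM d G‖ * ‖leftVelocity d γ t‖ * ‖ρ (δ t)‖) :=
            π.le_opNorm_of_le ((lieBrCLM d G).le_opNorm₂ _ _)
        _ ≤ ‖π‖ * (‖lieBrCLM d G‖ * C * (‖ρ‖ * ‖δ t‖)) := by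
            gcongr
            · exact mul_nonneg (lieBrCLM d G).opNorm_nonneg ((norm_nonneg _).trans hCt)
            · exact ρ.le_opNorm _
        _ = _ := by ring)
    1 ⟨zero_le_one, le_rfl⟩
  simp only [hδ, h1, sub_eq_zero] at hz
  rwa [pullFun_of_mem hP hbK, pullFun_of_mem hP hbK, hXu, hYu] at hz

/-- If `K` is connected, the algebraic Nijenhuis condition implies invariance under the isotropy
representation. -/
theorem IsAlgNijenhuis.commute_isotropy
    {N₀ : EuclideanSpace ℝ (Fin m) →L[ℝ] EuclideanSpace ℝ (Fin m)}
    (hn : IsAlgNijenhuis (lieProj d K)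
      (N₀ : EuclideanSpace ℝ (Fin m) →ₗ[ℝ] EuclideanSpace ℝ (Fin m)))
    (hK : IsConnected (K : Set G)) (a : G) (ha : a ∈ K) (u : EuclideanSpace ℝ (Fin m)) :
    N₀ (smulDeriv m a ((1 : G) : G ⧸ K) u) = smulDeriv m a ((1 : G) : G ⧸ K) (N₀ u) := by
  obtain ⟨ρ, hρ⟩ := exists_rightInverse_projDeriv hP
  have hv : ∀ κ, projDeriv d m K 1 κ = 0 → ∀ u,
      projDeriv d m K 1 (lieBr d G κ (ρ (N₀ u))) =
        N₀ (projDeriv d m K 1 (lieBr d G κ (ρ u))) := by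
    intro κ hκ u
    -- The algebraic identity with `v = 0` and `v' = κ`, an admissible lift because `κ` is vertical.
    have e1 : projDeriv d m K 1 (lieBr d G κ (ρ (N₀ u))) =
        N₀ (projDeriv d m K 1 (lieBr d G κ (ρ u)) +
          projDeriv d m K 1 (lieBr d G 0 (ρ (N₀ u))) -
          N₀ (projDeriv d m K 1 (lieBr d G 0 (ρ u)))) :=
      hn 0 (ρ u) κ (ρ (N₀ u)) (hκ.trans (by simp)) ((hρ _).trans (congrArg N₀ (hρ _).symm))
    have e2 : ∀ w : EuclideanSpace ℝ (Fin d), lieBr d G 0 w = 0 := fun w => by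
      have := lieBr_smul_left (G := G) (d := d) 0 0 w
      rwa [zero_smul, zero_smul] at this
    rw [e1, e2, e2, map_zero, map_zero, add_zero, sub_zero]
  have : IsTopologicalGroup G := topologicalGroup_of_lieGroup (𝓡 d) ω
  have hsm := contMDiff_smul_quotient hP
  have fix : ∀ b ∈ K, b • ((1 : G) : G ⧸ K) = ((1 : G) : G ⧸ K) := fun b hb => by
    rw [smul_mk_one hP]
    exact (QuotientGroup.eq.2 (by simpa using hb)).symm
  let H : Subgroup K :=
    { carrier := {b | ∀ u, N₀ (smulDeriv m (b : G) ((1 : G) : G ⧸ K) u) =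
        smulDeriv m (b : G) ((1 : G) : G ⧸ K) (N₀ u)}
      mul_mem' := by
        intro b c hb hc u
        have e : ∀ u, smulDeriv m ((b * c : K) : G) ((1 : G) : G ⧸ K) u =
            smulDeriv m (b : G) ((1 : G) : G ⧸ K)
              (smulDeriv m (c : G) ((1 : G) : G ⧸ K) u) := fun u => by
          rw [Subgroup.coe_mul, smulDeriv_mul hsm, fix c c.2]
        rw [e, e, hb, hc]
      one_mem' := by
        intro u
        rw [Subgroup.coe_one, smulDeriv_one, smulDeriv_one]
      inv_mem' := by
        intro b hb u
        have e1 : ∀ u, smulDeriv m (b : G) ((1 : G) : G ⧸ K)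
            (smulDeriv m ((b⁻¹ : K) : G) ((1 : G) : G ⧸ K) u) = u := fun u => by
          have := smulDeriv_smulDeriv_inv hsm (b : G) ((1 : G) : G ⧸ K) u
          rwa [fix b b.2] at this
        have e2 : ∀ u, smulDeriv m ((b⁻¹ : K) : G) ((1 : G) : G ⧸ K)
            (smulDeriv m (b : G) ((1 : G) : G ⧸ K) u) = u := fun u => by
          have := smulDeriv_inv_smulDeriv hsm (b : G) ((1 : G) : G ⧸ K) u
          rwa [fix b b.2] at this
        have h := hb (smulDeriv m ((b⁻¹ : K) : G) ((1 : G) : G ⧸ K) u)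
        rw [e1] at h
        rw [h, e2] }
  have hH : (H : Set K) ∈ 𝓝 (1 : K) := by
    -- The neighborhood depends on the vector, so finitely many basis vectors are treated at once
    -- and linearity does the rest.
    have h1 : ∀ᶠ b in 𝓝 (1 : G), ∀ i : Fin m, b ∈ K →
        N₀ (smulDeriv m b⁻¹ ((1 : G) : G ⧸ K) (EuclideanSpace.basisFun (Fin m) ℝ i)) =
        smulDeriv m b⁻¹ ((1 : G) : G ⧸ K) (N₀ (EuclideanSpace.basisFun (Fin m) ℝ i)) :=
      Filter.eventually_all.2 fun i => eventually_commute_isotropy hP ρ hρ hv _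
    have h2 : Filter.Tendsto (fun b : K => (b : G)) (𝓝 1) (𝓝 (1 : G)) :=
      continuous_subtype_val.tendsto' _ _ rfl
    filter_upwards [h2.eventually h1] with b hb
    rw [SetLike.mem_coe, ← inv_mem_iff]
    intro u
    have := (EuclideanSpace.basisFun (Fin m) ℝ).toBasis.ext
      (f₁ := (N₀.comp (smulDeriv m (b : G)⁻¹ ((1 : G) : G ⧸ K))).toLinearMap)
      (f₂ := ((smulDeriv m (b : G)⁻¹ ((1 : G) : G ⧸ K)).comp N₀).toLinearMap)
      (fun i => by simpa using hb i b.2)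
    exact congrArg (fun L => L u) this
  have hopen : IsOpen (H : Set K) := H.isOpen_of_mem_nhds hH
  have : ConnectedSpace K := Subtype.connectedSpace hK
  -- An open subgroup is closed, hence everything in the connected group `K`.
  have htop : (H : Set K) = Set.univ :=
    IsClopen.eq_univ ⟨H.isClosed_of_isOpen hopen, hopen⟩ ⟨1, H.one_mem⟩
  have hmem : (⟨a, ha⟩ : K) ∈ (H : Set K) := htop ▸ Set.mem_univ _
  exact hmem u

end

/-! ### Complexification in real and imaginary parts. -/

section

variable {V W L : Type*} [AddCommGroup V] [Module ℝ V] [AddCommGroup W] [Module ℝ W] [LieRing L]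
  [LieAlgebra ℝ L]

/-- The real part of a complex vector. -/
def rePart : (ℂ ⊗[ℝ] V) →ₗ[ℝ] V :=
  (TensorProduct.lid ℝ V).toLinearMap.comp (LinearMap.rTensor V Complex.reLm)

/-- The imaginary part of a complex vector. -/
def imPart : (ℂ ⊗[ℝ] V) →ₗ[ℝ] V :=
  (TensorProduct.lid ℝ V).toLinearMap.comp (LinearMap.rTensor V Complex.imLm)

lemma rePart_tmul (z : ℂ) (v : V) : rePart (z ⊗ₜ[ℝ] v) = z.re • v := rfl
lemma imPart_tmul (z : ℂ) (v : V) : imPart (z ⊗ₜ[ℝ] v) = z.im • v := rfl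

@[simp] lemma rePart_complexVector (v w : V) : rePart (complexVector v w) = v := by
  simp [complexVector, rePart_tmul]
@[simp] lemma imPart_complexVector (v w : V) : imPart (complexVector v w) = w := by
  simp [complexVector, imPart_tmul]

lemma complexVector_add (v w v' w' : V) :
    complexVector v w + complexVector v' w' = complexVector (v + v') (w + w') := by
  simp only [complexVector, TensorProduct.tmul_add]; abel

lemma smul_complexVector (z : ℂ) (v w : V) : z • complexVector v w =
    complexVector (z.re • v - z.im • w) (z.re • w + z.im • v) := by
  have h : ∀ (c : ℂ) (v : V),
    c ⊗ₜ[ℝ] v = (1 : ℂ) ⊗ₜ[ℝ] (c.re • v) + Complex.I ⊗ₜ[ℝ] (c.im • v) := by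
    intro c v
    rw [← TensorProduct.smul_tmul, ← TensorProduct.smul_tmul, ← TensorProduct.add_tmul]
    congr 1
    apply Complex.ext <;> simp
  simp only [complexVector, smul_add, TensorProduct.smul_tmul', smul_eq_mul]
  rw [h (z * 1), h (z * Complex.I)]
  simp only [Complex.mul_re, Complex.mul_im, Complex.I_re, Complex.I_im, mul_zero, mul_one,
    zero_sub, add_zero, neg_smul, TensorProduct.tmul_sub, TensorProduct.tmul_add,
    TensorProduct.tmul_neg]
  abel

lemma complexVector_re_im (z : ℂ ⊗[ℝ] V) : complexVector (rePart z) (imPart z) = z := by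
  induction z with
  | zero => simp [complexVector]
  | add x y hx hy => rw [map_add, map_add, ← complexVector_add, hx, hy]
  | tmul c v =>
    rw [rePart_tmul, imPart_tmul, complexVector, ← TensorProduct.smul_tmul,
      ← TensorProduct.smul_tmul, ← TensorProduct.add_tmul]
    congr 1
    apply Complex.ext <;> simp

lemma exists_complexVector (z : ℂ ⊗[ℝ] V) : ∃ v w, complexVector v w = z :=
  ⟨_, _, complexVector_re_im z⟩

lemma complexVector_inj {v w v' w' : V} :
    complexVector v w = complexVector v' w' ↔ v = v' ∧ w = w' := by
  constructor
  · intro h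
    exact ⟨by simpa using congrArg rePart h, by simpa using congrArg imPart h⟩
  · rintro ⟨rfl, rfl⟩; rfl

@[simp] lemma conjugation_complexVector (v w : V) :
    conjugation V (complexVector v w) = complexVector v (-w) := by
  simp [conjugation, complexVector, TensorProduct.neg_tmul, TensorProduct.tmul_neg]

@[simp] lemma baseChange_complexVector (f : V →ₗ[ℝ] W) (v w : V) :
    f.baseChange ℂ (complexVector v w) = complexVector (f v) (f w) := by
  simp [complexVector]

lemma lie_complexVector (a b c e : L) : ⁅complexVector a b, complexVector c e⁆ =
    complexVector (⁅a, c⁆ - ⁅b, e⁆) (⁅a, e⁆ + ⁅b, c⁆) := by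
  simp only [complexVector, add_lie, lie_add, LieAlgebra.ExtendScalars.bracket_tmul, one_mul,
    mul_one, Complex.I_mul_I, TensorProduct.neg_tmul, TensorProduct.tmul_sub,
    TensorProduct.tmul_add]
  abel

lemma mem_baseChange_iff (p : Submodule ℝ V) (z : ℂ ⊗[ℝ] V) :
    z ∈ p.baseChange ℂ ↔ rePart z ∈ p ∧ imPart z ∈ p := by
  constructor
  · intro h
    rw [Submodule.baseChange_eq_span] at h
    induction h using Submodule.span_induction with
    | zero => simp
    | mem x hx => 
      obtain ⟨v, hv, rfl⟩ := hx
      constructor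
      · simpa [rePart_tmul] using hv
      · simp [imPart_tmul]
    | add x y _ _ hx hy => exact ⟨by rw [map_add]; exact p.add_mem hx.1 hy.1,
      by rw [map_add]; exact p.add_mem hx.2 hy.2⟩
    | smul c x _ hx =>
      obtain ⟨v, w, rfl⟩ := exists_complexVector x
      rw [smul_complexVector]
      simp only [rePart_complexVector, imPart_complexVector] at hx ⊢
      exact ⟨p.sub_mem (p.smul_mem _ hx.1) (p.smul_mem _ hx.2),
        p.add_mem (p.smul_mem _ hx.2) (p.smul_mem _ hx.1)⟩
  · rintro ⟨h1, h2⟩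
    rw [← complexVector_re_im z, complexVector]
    exact add_mem (Submodule.tmul_mem_baseChange_of_mem 1 h1)
      (Submodule.tmul_mem_baseChange_of_mem _ h2)

lemma ker_baseChange (f : V →ₗ[ℝ] W) :
    (LinearMap.ker f).baseChange ℂ = LinearMap.ker (f.baseChange ℂ) := by
  ext z
  obtain ⟨v, w, rfl⟩ := exists_complexVector z
  rw [mem_baseChange_iff, LinearMap.mem_ker (f := f.baseChange ℂ), baseChange_complexVector]
  have : complexVector (0 : W) 0 = 0 := by simp [complexVector]
  rw [← this, complexVector_inj]
  simp

lemma conjugation_smul (c : ℂ) (z : ℂ ⊗[ℝ] V) :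
    conjugation V (c • z) = starRingEnd ℂ c • conjugation V z := by
  obtain ⟨v, w, rfl⟩ := exists_complexVector z
  simp only [smul_complexVector, conjugation_complexVector, complexVector_inj, Complex.conj_re,
    Complex.conj_im, neg_smul, smul_neg]
  exact ⟨by abel, by abel⟩

@[simp] lemma conjugation_conjugation (z : ℂ ⊗[ℝ] V) : conjugation V (conjugation V z) = z := by
  obtain ⟨v, w, rfl⟩ := exists_complexVector z
  simp

lemma baseChange_apply_conjugation (f : V →ₗ[ℝ] W) (z : ℂ ⊗[ℝ] V) :
    f.baseChange ℂ (conjugation V z) = conjugation W (f.baseChange ℂ z) := by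
  obtain ⟨v, w, rfl⟩ := exists_complexVector z
  simp
end

/-! ### Preimages of subspaces under a surjection. -/

section Preimages

variable {R F W ι : Type*} [CommRing R] [AddCommGroup F] [Module R F] [AddCommGroup W] [Module R W]
  {f : F →ₗ[R] W} (hf : Function.Surjective f)
include hf

/-- Each preimage contains the kernel, which absorbs the ambiguity of lifts. The index type must be
nonempty: the preimage of the empty supremum is the kernel. -/
lemma comap_iSup_of_surjective [Nonempty ι] (e : ι → Submodule R W) :
    (⨆ i, e i).comap f = ⨆ i, (e i).comap f := by
  apply le_antisymm
  · intro v hv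
    have h1 : (⨆ i, e i) = (⨆ i, (e i).comap f).map f := by
      rw [Submodule.map_iSup]
      exact iSup_congr fun i => (Submodule.map_comap_eq_of_surjective hf _).symm
    rw [Submodule.mem_comap, h1] at hv
    obtain ⟨w, hw, hvw⟩ := hv
    have h2 : v - w ∈ ⨆ i, (e i).comap f := by
      obtain ⟨i⟩ := ‹Nonempty ι›
      refine Submodule.mem_iSup_of_mem i ?_
      rw [Submodule.mem_comap, map_sub, hvw, sub_self]
      exact zero_mem _
    simpa using add_mem h2 hw
  · exact iSup_le fun i => Submodule.comap_mono (le_iSup e i)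

lemma comap_sup_of_surjective (a b : Submodule R W) :
    (a ⊔ b).comap f = a.comap f ⊔ b.comap f := by
  rw [sup_eq_iSup, sup_eq_iSup, comap_iSup_of_surjective hf]
  exact iSup_congr fun i => by cases i <;> rfl

/-- The preimages of subspaces form a direct sum decomposition of the source modulo the kernel if
and only if the subspaces form a direct sum decomposition. -/
lemma isInternal_map_mkQ_comap_iff [DecidableEq ι] (e : ι → Submodule R W) :
    DirectSum.IsInternal (fun i => ((e i).comap f).map (LinearMap.ker f).mkQ) ↔
      DirectSum.IsInternal e := by
  -- The quotient by the kernel is identified with the target, so independence and spanning are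
  -- transported by an isomorphism of submodule lattices.
  set E := f.quotKerEquivOfSurjective hf with hE
  have h : ∀ i, ((e i).comap f).map (LinearMap.ker f).mkQ =
      Submodule.orderIsoMapComap E.symm (e i) := by
    intro i
    change _ = (e i).map (E.symm : W →ₗ[R] F ⧸ LinearMap.ker f)
    ext z
    obtain ⟨v, rfl⟩ := Submodule.mkQ_surjective _ z
    constructor
    · rintro ⟨w, hw, hwz⟩
      refine ⟨f w, hw, ?_⟩
      rw [← hwz]
      exact E.symm_apply_apply (Submodule.Quotient.mk w)
    · rintro ⟨y, hy, hyz⟩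
      refine ⟨v, ?_, rfl⟩
      have : f v = y := by
        have := congrArg E hyz
        rw [LinearEquiv.coe_coe, E.apply_symm_apply] at this
        exact this.symm
      change f v ∈ e i
      rwa [this]
  simp only [h]
  rw [DirectSum.isInternal_submodule_iff_iSupIndep_and_iSup_eq_top,
    DirectSum.isInternal_submodule_iff_iSupIndep_and_iSup_eq_top]
  refine and_congr (iSupIndep_map_orderIso_iff (Submodule.orderIsoMapComap E.symm)) ?_
  rw [← OrderIso.map_iSup, map_eq_top_iff]

lemma comap_eq_ker_iff (e : Submodule R W) : e.comap f = LinearMap.ker f ↔ e = ⊥ := by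
  rw [← Submodule.comap_bot]
  exact (Submodule.comap_injective_of_surjective hf).eq_iff

end Preimages

/-! ### Eigenspaces of semisimple complex operators. -/

section Eigen

open Module.End

variable {W : Type*} [AddCommGroup W] [Module ℂ W] [FiniteDimensional ℂ W]

lemma iSup_eigenspace_range {ι : Type*} {N : Module.End ℂ W} (hN : N.IsSemisimple) {lam : ι → ℂ}
    (hs : spectrum ℂ N = Set.range lam) : ⨆ i, eigenspace N (lam i) = ⊤ := by
  rw [← hN.iSup_eigenspace_eq_top]
  apply le_antisymm
  · exact iSup_le fun i => le_iSup (fun μ => eigenspace N μ) _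
  · refine iSup_le fun μ => ?_
    by_cases hμ : μ ∈ spectrum ℂ N
    · rw [hs] at hμ
      obtain ⟨i, rfl⟩ := hμ
      exact le_iSup (fun i => eigenspace N (lam i)) i
    · have : eigenspace N μ = ⊥ := by
        by_contra h
        exact hμ (HasEigenvalue.mem_spectrum h)
      rw [this]
      exact bot_le

lemma isInternal_eigenspace {ι : Type*} [DecidableEq ι] {N : Module.End ℂ W}
    (hN : N.IsSemisimple) {lam : ι → ℂ} (hl : Function.Injective lam)
    (hs : spectrum ℂ N = Set.range lam) :
    DirectSum.IsInternal fun i => eigenspace N (lam i) := by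
  rw [DirectSum.isInternal_submodule_iff_iSupIndep_and_iSup_eq_top]
  exact ⟨N.eigenspaces_iSupIndep.comp hl, iSup_eigenspace_range hN hs⟩

/-- A further eigenspace would be independent of the given ones, which already span. -/
lemma spectrum_eq_range_of_iSup_eq_top {ι : Type*} {N : Module.End ℂ W} {lam : ι → ℂ}
    (h : ⨆ i, eigenspace N (lam i) = ⊤) (hne : ∀ i, eigenspace N (lam i) ≠ ⊥) :
    spectrum ℂ N = Set.range lam := by
  ext μ
  rw [← hasEigenvalue_iff_mem_spectrum]
  constructor
  · intro hμ
    by_contra hn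
    refine hμ (disjoint_self.1 ((N.eigenspaces_iSupIndep μ).mono_right ?_))
    refine le_top.trans (h.symm.trans_le (iSup_le fun i => ?_))
    exact le_iSup₂_of_le (lam i) (fun e => hn ⟨i, e⟩) le_rfl
  · rintro ⟨i, rfl⟩
    exact hne i

/-- A vector killed by `(N - a)(N - b)` lies in the sum of the eigenspaces. -/
lemma mem_eigenspace_sup {N : Module.End ℂ W} (hN : N.IsSemisimple) {a b : ℂ} {u : W}
    (h : (a * b) • u = N (a • u + b • u - N u)) :
    u ∈ eigenspace N a ⊔ eigenspace N b := by
  -- If `a = b`, the vector lies in a generalized eigenspace of order two, which for a semisimple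
  -- operator is the eigenspace. If `a ≠ b`, semisimplicity is not needed: `(N - a) u` and `(N - b)
  -- u` are eigenvectors, and `u` is a multiple of their difference.
  by_cases hab : a = b
  · subst hab
    rw [sup_idem,
      ← hN.isFinitelySemisimple.genEigenspace_eq_eigenspace a (k := (2 : ℕ)) (by norm_num),
      mem_genEigenspace_nat, LinearMap.mem_ker, pow_two, Module.End.mul_apply]
    simp only [LinearMap.sub_apply, map_sub, map_add, map_smul, LinearMap.smul_apply,
      Module.End.one_apply] at h ⊢
    rw [smul_sub, smul_smul, h]
    abel
  · have h1 : N u - a • u ∈ eigenspace N b := by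
      rw [mem_eigenspace_iff]
      simp only [map_sub, map_add, map_smul, smul_sub, smul_smul] at h ⊢
      rw [mul_comm b a, h]
      abel
    have h2 : N u - b • u ∈ eigenspace N a := by
      rw [mem_eigenspace_iff]
      simp only [map_sub, map_add, map_smul, smul_sub, smul_smul] at h ⊢
      rw [h]
      abel
    have e : u = (a - b)⁻¹ • (N u - b • u) - (a - b)⁻¹ • (N u - a • u) := by
      rw [← smul_sub, sub_sub_sub_cancel_left, ← sub_smul, smul_smul,
        inv_mul_cancel₀ (sub_ne_zero.2 hab), one_smul]
    rw [e]
    exact sub_mem (Submodule.mem_sup_left (Submodule.smul_mem _ _ h2))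
      (Submodule.mem_sup_right (Submodule.smul_mem _ _ h1))

lemma eq_of_mem_eigenspace_sup {N : Module.End ℂ W} {a b : ℂ} {u : W}
    (hu : u ∈ eigenspace N a ⊔ eigenspace N b) :
    (a * b) • u = N (a • u + b • u - N u) := by
  obtain ⟨x, hx, y, hy, rfl⟩ := Submodule.mem_sup.1 hu
  rw [mem_eigenspace_iff] at hx hy
  simp only [map_add, map_sub, map_smul, hx, hy, smul_add, smul_smul, mul_comm b a]
  abel

end Eigen

/-! ### Semisimplicity under complexification. -/

section Semisimple

open Module.End Polynomial

variable {E : Type*} [AddCommGroup E] [Module ℝ E] [FiniteDimensional ℝ E]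

lemma aeval_baseChange (N : Module.End ℝ E) (q : ℝ[X]) :
    aeval (N.baseChange ℂ : Module.End ℂ (ℂ ⊗[ℝ] E)) q =
      ((aeval N q : Module.End ℝ E).baseChange ℂ : Module.End ℂ (ℂ ⊗[ℝ] E)) :=
  (Polynomial.aeval_algHom_apply (Module.End.baseChangeHom ℝ ℂ E) N q)

lemma baseChange_injective {E' : Type*} [AddCommGroup E'] [Module ℝ E'] {f g : E →ₗ[ℝ] E'}
    (h : f.baseChange ℂ = g.baseChange ℂ) : f = g := by
  ext v
  have := congrArg (fun L => L (complexVector v 0)) h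
  simp only [baseChange_complexVector, complexVector_inj] at this
  exact this.1

/-- Squarefreeness of the minimal polynomial is the same as separability over `ℝ`, and separability
survives the passage to `ℂ`. -/
lemma IsSemisimple.baseChange {N : Module.End ℝ E} (hN : N.IsSemisimple) :
    Module.End.IsSemisimple (N.baseChange ℂ : Module.End ℂ (ℂ ⊗[ℝ] E)) := by
  have h1 := hN.minpoly_squarefree
  have h2 : (minpoly ℝ N).Separable := PerfectField.separable_iff_squarefree.2 h1
  have h3 : ((minpoly ℝ N).map (algebraMap ℝ ℂ)).Separable := h2.map
  refine isSemisimple_of_squarefree_aeval_eq_zero h3.squarefree ?_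
  rw [aeval_map_algebraMap, aeval_baseChange, minpoly.aeval]
  exact LinearMap.baseChange_zero

/-- A real polynomial annihilates `N` as soon as it vanishes at every `lam i` with nonzero
eigenspace. This condition is insensitive to multiplicities, so the minimal polynomial is
squarefree. -/
lemma isSemisimple_of_iSup_eigenspace {ι : Type*} {N : Module.End ℝ E} {lam : ι → ℂ}
    (h : ⨆ i, eigenspace (N.baseChange ℂ : Module.End ℂ (ℂ ⊗[ℝ] E)) (lam i) = ⊤) :
    N.IsSemisimple := by
  set NC : Module.End ℂ (ℂ ⊗[ℝ] E) := N.baseChange ℂ with hNC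
  have hap : ∀ (q : ℝ[X]) (i : ι), ∀ u ∈ eigenspace NC (lam i),
      (aeval N q : Module.End ℝ E).baseChange ℂ u = (aeval (lam i) q) • u := by
    intro q i u hu
    rw [← aeval_baseChange, ← aeval_map_algebraMap ℂ, ← aeval_map_algebraMap ℂ (lam i)]
    by_cases hu0 : u = 0
    · simp [hu0]
    · have := aeval_apply_of_hasEigenvector (p := q.map (algebraMap ℝ ℂ))
        (f := NC) (μ := lam i) (x := u) ⟨hu, hu0⟩
      rw [this, coe_aeval_eq_eval]
  have hz : ∀ q : ℝ[X], aeval N q = 0 ↔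
      ∀ i, ∀ u ∈ eigenspace NC (lam i), (aeval (lam i) q) • u = 0 := by
    intro q
    constructor
    · intro hq i u hu
      rw [← hap q i u hu, hq, LinearMap.baseChange_zero, LinearMap.zero_apply]
    · intro hq
      apply baseChange_injective
      rw [LinearMap.baseChange_zero]
      have : (⊤ : Submodule ℂ (ℂ ⊗[ℝ] E)) ≤
          LinearMap.ker ((aeval N q : Module.End ℝ E).baseChange ℂ) := by
        rw [← h]
        exact iSup_le fun i u hu => by rw [LinearMap.mem_ker, hap q i u hu, hq i u hu]
      exact LinearMap.ker_eq_top.1 (top_le_iff.1 this)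
  have hint : IsIntegral ℝ N := Algebra.IsIntegral.isIntegral N
  refine isSemisimple_of_squarefree_aeval_eq_zero (p := minpoly ℝ N) ?_ (minpoly.aeval ℝ N)
  -- If `x * x * q` is the minimal polynomial, then `x * q` has the same zeros and already
  -- annihilates `N`. By minimality `x` is a unit.
  rintro x ⟨q, hq⟩
  have hm := (hz _).1 (minpoly.aeval ℝ N)
  have h1 : aeval N (x * q) = 0 := by
    rw [hz]
    intro i u hu
    have := hm i u hu
    rw [smul_eq_zero] at this ⊢
    refine this.imp_left fun e => ?_
    rw [hq, map_mul, map_mul, mul_assoc, mul_eq_zero] at e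
    rw [map_mul]
    rcases e with e | e
    · rw [e, zero_mul]
    · exact e
  obtain ⟨c, hc⟩ := minpoly.dvd ℝ N h1
  have hxq : x * q ≠ 0 := by
    intro h0
    apply minpoly.ne_zero hint
    rw [hq, mul_assoc, h0, mul_zero]
  have e : x * q * 1 = x * q * (x * c) := by
    rw [mul_one]
    conv_lhs => rw [hc, hq]
    ring
  exact IsUnit.of_mul_eq_one _ (mul_left_cancel₀ hxq e).symm

end Semisimple

/-! ### The algebraic Nijenhuis identity and eigenspace preimages. -/

section

open Module.End

variable {L E : Type*} [LieRing L] [LieAlgebra ℝ L] [AddCommGroup E] [Module ℝ E]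
  [FiniteDimensional ℝ E] {π : L →ₗ[ℝ] E} {N : Module.End ℝ E}

lemma baseChange_surjective (hπ : Function.Surjective π) :
    Function.Surjective (π.baseChange ℂ) := by
  intro z
  obtain ⟨x, y, rfl⟩ := exists_complexVector z
  obtain ⟨v, rfl⟩ := hπ x
  obtain ⟨w, rfl⟩ := hπ y
  exact ⟨complexVector v w, baseChange_complexVector π v w⟩

/-- The preimage in the complexified Lie algebra of an eigenspace of the complexification of `N`. -/
def eigenPreimage (π : L →ₗ[ℝ] E) (N : Module.End ℝ E) (μ : ℂ) : Submodule ℂ (ℂ ⊗[ℝ] L) :=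
  (eigenspace (N.baseChange ℂ : Module.End ℂ (ℂ ⊗[ℝ] E)) μ).comap (π.baseChange ℂ)

lemma mem_eigenPreimage {μ : ℂ} {v : ℂ ⊗[ℝ] L} :
    v ∈ eigenPreimage π N μ ↔ N.baseChange ℂ (π.baseChange ℂ v) = μ • π.baseChange ℂ v :=
  mem_eigenspace_iff

/-- The complexified Nijenhuis identity. -/
theorem IsAlgNijenhuis.complexify (h : IsAlgNijenhuis π N) {v w v' w' : ℂ ⊗[ℝ] L}
    (hv : π.baseChange ℂ v' = N.baseChange ℂ (π.baseChange ℂ v))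
    (hw : π.baseChange ℂ w' = N.baseChange ℂ (π.baseChange ℂ w)) :
    π.baseChange ℂ ⁅v', w'⁆ = N.baseChange ℂ (π.baseChange ℂ ⁅v', w⁆ + π.baseChange ℂ ⁅v, w'⁆ -
      N.baseChange ℂ (π.baseChange ℂ ⁅v, w⁆)) := by
  obtain ⟨a, b, rfl⟩ := exists_complexVector v
  obtain ⟨a', b', rfl⟩ := exists_complexVector v'
  obtain ⟨c, e, rfl⟩ := exists_complexVector w
  obtain ⟨c', e', rfl⟩ := exists_complexVector w'
  simp only [baseChange_complexVector, complexVector_inj] at hv hw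
  have sub : ∀ x y x' y' : E, complexVector x y - complexVector x' y' =
      complexVector (x - x') (y - y') := by
    intro x y x' y'
    rw [sub_eq_iff_eq_add, complexVector_add, sub_add_cancel, sub_add_cancel]
  simp only [lie_complexVector, baseChange_complexVector, complexVector_add, sub,
    complexVector_inj, map_add, map_sub]
  -- The real part of the complex identity is the difference of the first two real instances, the
  -- imaginary part the sum of the last two.
  have h1 := h a c a' c' hv.1 hw.1
  have h2 := h b e b' e' hv.2 hw.2
  have h3 := h a e a' e' hv.1 hw.2
  have h4 := h b c b' c' hv.2 hw.1
  simp only [map_add, map_sub] at h1 h2 h3 h4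
  rw [h1, h2, h3, h4]
  exact ⟨by abel, by abel⟩

/-- With the lifts `v' = a v` and `w' = b w` the identity says that `(N - a)(N - b)` kills the
projection of `[v, w]`. -/
theorem IsAlgNijenhuis.lie_mem_sup (h : IsAlgNijenhuis π N) (hπ : Function.Surjective π)
    (hN : N.IsSemisimple) {a b : ℂ} {v w : ℂ ⊗[ℝ] L}
    (hv : v ∈ eigenPreimage π N a) (hw : w ∈ eigenPreimage π N b) :
    ⁅v, w⁆ ∈ eigenPreimage π N a ⊔ eigenPreimage π N b := by
  rw [mem_eigenPreimage] at hv hw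
  unfold eigenPreimage
  rw [← comap_sup_of_surjective (baseChange_surjective hπ), Submodule.mem_comap]
  refine mem_eigenspace_sup (IsSemisimple.baseChange hN) ?_
  have := h.complexify (v := v) (w := w) (v' := a • v) (w' := b • w)
    (by rw [map_smul, hv]) (by rw [map_smul, hw])
  have l1 : ∀ (c : ℂ) (x y : ℂ ⊗[ℝ] L), ⁅c • x, y⁆ = c • ⁅x, y⁆ := fun c x y => smul_lie c x y
  have l2 : ∀ (c : ℂ) (x y : ℂ ⊗[ℝ] L), ⁅x, c • y⁆ = c • ⁅x, y⁆ := fun c x y => lie_smul c x y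
  simp only [l1, l2, map_smul] at this
  rw [mul_smul, this]

theorem IsAlgNijenhuis.lie_mem (h : IsAlgNijenhuis π N) (hπ : Function.Surjective π)
    (hN : N.IsSemisimple) {a b : ℂ} {v w : ℂ ⊗[ℝ] L}
    (hv : v ∈ eigenPreimage π N a ⊔ eigenPreimage π N b)
    (hw : w ∈ eigenPreimage π N a ⊔ eigenPreimage π N b) :
    ⁅v, w⁆ ∈ eigenPreimage π N a ⊔ eigenPreimage π N b := by
  obtain ⟨x, hx, y, hy, rfl⟩ := Submodule.mem_sup.1 hv
  obtain ⟨x', hx', y', hy', rfl⟩ := Submodule.mem_sup.1 hw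
  simp only [add_lie, lie_add]
  have h1 := h.lie_mem_sup hπ hN hx hx'
  have h2 := h.lie_mem_sup hπ hN hy hy'
  have h3 := h.lie_mem_sup hπ hN hx hy'
  have h4 := h.lie_mem_sup hπ hN hy hx'
  rw [sup_idem] at h1 h2
  rw [sup_comm] at h4
  exact add_mem (add_mem (Submodule.mem_sup_left h1) h3) (add_mem h4 (Submodule.mem_sup_right h2))

lemma conjugation_mem_eigenPreimage {μ : ℂ} {v : ℂ ⊗[ℝ] L} (hv : v ∈ eigenPreimage π N μ) :
    conjugation L v ∈ eigenPreimage π N (starRingEnd ℂ μ) := by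
  rw [mem_eigenPreimage] at hv ⊢
  rw [baseChange_apply_conjugation, baseChange_apply_conjugation, hv, conjugation_smul]

lemma eigenPreimage_eq_image_conjugation {a b : ℂ} (h : a = starRingEnd ℂ b) :
    (eigenPreimage π N a : Set (ℂ ⊗[ℝ] L)) = conjugation L '' (eigenPreimage π N b) := by
  subst h
  ext v
  constructor
  · intro hv
    have := conjugation_mem_eigenPreimage hv
    rw [Complex.conj_conj] at this
    exact ⟨_, this, conjugation_conjugation v⟩
  · rintro ⟨w, hw, rfl⟩
    exact conjugation_mem_eigenPreimage hw

section Eigenvalues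

variable {ι : Type*} {lam : ι → ℂ} (hπ : Function.Surjective π) (hN : N.IsSemisimple)
  (hl : Function.Injective lam)
  (hs : spectrum ℂ (N.baseChange ℂ : Module.End ℂ (ℂ ⊗[ℝ] E)) = Set.range lam)

include hπ hN hs in
lemma iSup_eigenPreimage [Nonempty ι] : ⨆ i, eigenPreimage π N (lam i) = ⊤ := by
  unfold eigenPreimage
  rw [← comap_iSup_of_surjective (baseChange_surjective hπ),
    iSup_eigenspace_range (IsSemisimple.baseChange hN) hs, Submodule.comap_top]

omit [FiniteDimensional ℝ E] in
include hl in
lemma eigenPreimage_inf {i j : ι} (hij : i ≠ j) :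
    eigenPreimage π N (lam i) ⊓ eigenPreimage π N (lam j) = LinearMap.ker (π.baseChange ℂ) := by
  unfold eigenPreimage
  have h := ((eigenspaces_iSupIndep (N.baseChange ℂ : Module.End ℂ (ℂ ⊗[ℝ] E))).comp
    hl).pairwiseDisjoint hij
  rw [← Submodule.comap_inf, ← Submodule.comap_bot]
  exact congrArg _ (disjoint_iff.1 h)

include hπ hs in
lemma eigenPreimage_ne (i : ι) :
    eigenPreimage π N (lam i) ≠ LinearMap.ker (π.baseChange ℂ) := by
  unfold eigenPreimage
  rw [Ne, comap_eq_ker_iff (baseChange_surjective hπ)]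
  have : lam i ∈ spectrum ℂ (N.baseChange ℂ : Module.End ℂ (ℂ ⊗[ℝ] E)) := hs ▸ ⟨i, rfl⟩
  exact HasEigenvalue.of_mem_spectrum this

include hπ hN hl hs in
lemma isInternal_eigenPreimage [DecidableEq ι] :
    DirectSum.IsInternal fun i =>
      (eigenPreimage π N (lam i)).map (LinearMap.ker (π.baseChange ℂ)).mkQ :=
  (isInternal_map_mkQ_comap_iff (baseChange_surjective hπ) _).2
    (isInternal_eigenspace (IsSemisimple.baseChange hN) hl hs)

lemma map_eigenPreimage (hπ : Function.Surjective π) (μ : ℂ) :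
    (eigenPreimage π N μ).map (π.baseChange ℂ) =
      eigenspace (N.baseChange ℂ : Module.End ℂ (ℂ ⊗[ℝ] E)) μ :=
  Submodule.map_comap_eq_of_surjective (baseChange_surjective hπ) _

include hπ hN hs in
/-- A semisimple endomorphism is determined by its eigenspaces. -/
lemma eq_of_eigenPreimage_eq {N' : Module.End ℝ E}
    (h : ∀ i, eigenPreimage π N (lam i) = eigenPreimage π N' (lam i)) : N = N' := by
  apply baseChange_injective
  have : (⊤ : Submodule ℂ (ℂ ⊗[ℝ] E)) ≤
      LinearMap.eqLocus (N.baseChange ℂ) (N'.baseChange ℂ) := by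
    rw [← iSup_eigenspace_range (IsSemisimple.baseChange hN) hs]
    refine iSup_le fun i u hu => ?_
    have hu' : u ∈ eigenspace (N'.baseChange ℂ : Module.End ℂ (ℂ ⊗[ℝ] E)) (lam i) := by
      rwa [← map_eigenPreimage hπ, ← h, map_eigenPreimage hπ]
    rw [mem_eigenspace_iff] at hu hu'
    exact hu.trans hu'.symm
  exact LinearMap.ext fun u => this (Submodule.mem_top (x := u))

/-- Compatibility of two endomorphisms of `L` and `E`, in terms of eigenspaces. -/
lemma map_eigenPreimage_le {A : Module.End ℝ L} {B : Module.End ℝ E}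
    (hAB : ∀ v, π (A v) = B (π v)) (hc : ∀ u, N (B u) = B (N u)) (μ : ℂ) :
    (eigenPreimage π N μ).map (A.baseChange ℂ) ≤ eigenPreimage π N μ := by
  have e1 : ∀ v, π.baseChange ℂ (A.baseChange ℂ v) = B.baseChange ℂ (π.baseChange ℂ v) := by
    intro v
    obtain ⟨x, y, rfl⟩ := exists_complexVector v
    simp [hAB]
  have e2 : ∀ v, N.baseChange ℂ (B.baseChange ℂ v) = B.baseChange ℂ (N.baseChange ℂ v) := by
    intro v
    obtain ⟨x, y, rfl⟩ := exists_complexVector v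
    simp [hc]
  rintro _ ⟨v, hv, rfl⟩
  rw [SetLike.mem_coe, mem_eigenPreimage] at hv
  rw [mem_eigenPreimage, e1, e2, hv, map_smul]

include hπ hN hs in
lemma commute_of_map_eigenPreimage_le {A : Module.End ℝ L} {B : Module.End ℝ E}
    (hAB : ∀ v, π (A v) = B (π v))
    (h : ∀ i, (eigenPreimage π N (lam i)).map (A.baseChange ℂ) ≤ eigenPreimage π N (lam i))
    (u : E) : N (B u) = B (N u) := by
  have e1 : ∀ v, π.baseChange ℂ (A.baseChange ℂ v) = B.baseChange ℂ (π.baseChange ℂ v) := by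
    intro v
    obtain ⟨x, y, rfl⟩ := exists_complexVector v
    simp [hAB]
  have e2 : N.baseChange ℂ ∘ₗ B.baseChange ℂ = B.baseChange ℂ ∘ₗ N.baseChange ℂ := by
    have : (⊤ : Submodule ℂ (ℂ ⊗[ℝ] E)) ≤
        LinearMap.eqLocus (N.baseChange ℂ ∘ₗ B.baseChange ℂ)
          (B.baseChange ℂ ∘ₗ N.baseChange ℂ) := by
      rw [← iSup_eigenspace_range (IsSemisimple.baseChange hN) hs]
      refine iSup_le fun i u hu => ?_
      rw [← map_eigenPreimage hπ] at hu
      obtain ⟨v, hv, rfl⟩ := hu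
      have h1 := h i ⟨v, hv, rfl⟩
      rw [mem_eigenPreimage, e1] at h1
      rw [SetLike.mem_coe, mem_eigenPreimage] at hv
      change N.baseChange ℂ (B.baseChange ℂ _) = B.baseChange ℂ (N.baseChange ℂ _)
      rw [h1, hv, map_smul]
    exact LinearMap.ext fun u => this (Submodule.mem_top (x := u))
  have h3 := congrArg (fun L => L (complexVector u 0)) e2
  simp only [LinearMap.comp_apply, baseChange_complexVector, complexVector_inj] at h3
  exact h3.1

end Eigenvalues

/-! ### From decompositions of the Lie algebra to endomorphisms. -/

section Construction

variable {ι : Type*} [DecidableEq ι] {lam : ι → ℂ}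

/-- An endomorphism with prescribed eigenspaces. -/
lemma exists_end_of_isInternal {W : Type*} [AddCommGroup W] [Module ℂ W]
    {e : ι → Submodule ℂ W} (he : DirectSum.IsInternal e) (lam : ι → ℂ) :
    ∃ T : Module.End ℂ W, ∀ i, ∀ u ∈ e i, T u = lam i • u := by
  set φ := LinearEquiv.ofBijective (DirectSum.coeLinearMap e) he with hφ
  refine ⟨(DirectSum.toModule ℂ ι W fun i => lam i • (e i).subtype) ∘ₗ φ.symm.toLinearMap, ?_⟩
  intro i u hu
  have h1 : φ.symm u = DirectSum.lof ℂ ι (fun i => e i) i ⟨u, hu⟩ := by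
    rw [LinearEquiv.symm_apply_eq]
    exact (DirectSum.coeLinearMap_lof e i ⟨u, hu⟩).symm
  change DirectSum.toModule ℂ ι W _ (φ.symm u) = _
  rw [h1, DirectSum.toModule_lof]
  rfl

/-- Each summand is contained in its eigenspace. Eigenspaces for distinct eigenvalues are
independent, so none can exceed its summand when the summands already span. -/
lemma eigenspace_eq_of_isInternal {W : Type*} [AddCommGroup W] [Module ℂ W]
    {e : ι → Submodule ℂ W} (he : DirectSum.IsInternal e) (hl : Function.Injective lam)
    {T : Module.End ℂ W} (hT : ∀ i, ∀ u ∈ e i, T u = lam i • u) (i : ι) :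
    eigenspace T (lam i) = e i := by
  have hle : ∀ i, e i ≤ eigenspace T (lam i) := fun i u hu => mem_eigenspace_iff.2 (hT i u hu)
  refine le_antisymm ?_ (hle i)
  have hsup := ((DirectSum.isInternal_submodule_iff_iSupIndep_and_iSup_eq_top _).1 he).2
  intro u hu
  have h1 : u ∈ e i ⊔ ⨆ (j) (_ : j ≠ i), e j := by
    have : (⊤ : Submodule ℂ W) ≤ e i ⊔ ⨆ (j) (_ : j ≠ i), e j := by
      rw [← hsup]
      refine iSup_le fun j => ?_
      by_cases hj : j = i
      · subst hj
        exact le_sup_left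
      · exact le_sup_of_le_right (le_iSup₂_of_le j hj le_rfl)
    exact this (Submodule.mem_top (x := u))
  obtain ⟨x, hx, y, hy, rfl⟩ := Submodule.mem_sup.1 h1
  have hy1 : y ∈ eigenspace T (lam i) := by
    simpa using sub_mem hu (hle i hx)
  have hy2 : y ∈ ⨆ (j) (_ : j ≠ i), eigenspace T (lam j) :=
    iSup₂_mono (fun j _ => hle j) hy
  have hy0 : y = 0 := Submodule.disjoint_def.1 (T.eigenspaces_iSupIndep.comp hl i) y hy1 hy2
  rw [hy0, add_zero]
  exact hx

/-- An endomorphism of a complexification which commutes with the conjugation is real. -/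
lemma exists_real_of_commute_conjugation {T : Module.End ℂ (ℂ ⊗[ℝ] E)}
    (hT : ∀ z, T (conjugation E z) = conjugation E (T z)) :
    ∃ N : Module.End ℝ E, N.baseChange ℂ = T := by
  refine ⟨rePart ∘ₗ T.restrictScalars ℝ ∘ₗ (TensorProduct.mk ℝ ℂ E 1), ?_⟩
  have key : ∀ u : E, complexVector (rePart (T (complexVector u 0))) 0 =
      T (complexVector u 0) := by
    intro u
    have h := hT (complexVector u 0)
    obtain ⟨x, y, hxy⟩ := exists_complexVector (T (complexVector u 0))
    rw [conjugation_complexVector, neg_zero, ← hxy, conjugation_complexVector,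
      complexVector_inj] at h
    -- The image of a real vector is fixed by conjugation, so its imaginary part equals its own
    -- negative.
    have hy : y = 0 := by
      have h2 : (2 : ℝ) • y = 0 := by
        rw [two_smul]
        exact eq_neg_iff_add_eq_zero.1 h.2
      exact (smul_eq_zero.1 h2).resolve_left two_ne_zero
    rw [← hxy, hy, rePart_complexVector]
  have one : ∀ u : E, TensorProduct.mk ℝ ℂ E 1 u = complexVector u 0 := by
    intro u
    simp [complexVector]
  have real : ∀ u : E, LinearMap.baseChange ℂ
      (rePart ∘ₗ T.restrictScalars ℝ ∘ₗ (TensorProduct.mk ℝ ℂ E 1)) (complexVector u 0) =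
      T (complexVector u 0) := by
    intro u
    rw [baseChange_complexVector, map_zero]
    simp only [LinearMap.comp_apply, one]
    exact key u
  ext z
  have hz : ∀ x y : E, complexVector x y = complexVector x 0 + Complex.I • complexVector y 0 := by
    intro x y
    rw [smul_complexVector, complexVector_add]
    simp
  change LinearMap.baseChange ℂ _ ((1 : ℂ) ⊗ₜ[ℝ] z) = T ((1 : ℂ) ⊗ₜ[ℝ] z)
  have e := one z
  rw [TensorProduct.mk_apply] at e
  rw [e, real]

/-- Lie algebra decompositions yield solutions of the algebraic Nijenhuis identity. -/
theorem isAlgNijenhuis_of_lie_mem (hπ : Function.Surjective π)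
    (hker : ∀ k l : L, π k = 0 → π l = 0 → π ⁅k, l⁆ = 0)
    {g : ι → Submodule ℂ (ℂ ⊗[ℝ] L)} (hsum : ⨆ i, g i = ⊤)
    (hle : ∀ i, LinearMap.ker (π.baseChange ℂ) ≤ g i)
    (hlie : ∀ i j, ∀ v ∈ g i ⊔ g j, ∀ w ∈ g i ⊔ g j, ⁅v, w⁆ ∈ g i ⊔ g j)
    (hg : ∀ i, eigenPreimage π N (lam i) = g i) : IsAlgNijenhuis π N := by
  set P := π.baseChange ℂ with hPdef
  set T : Module.End ℂ (ℂ ⊗[ℝ] E) := N.baseChange ℂ with hTdef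
  have hT : ∀ i, ∀ v ∈ g i, T (P v) = lam i • P v := fun i v hv => by
    rw [← hg] at hv
    exact mem_eigenPreimage.1 hv
  have hker' : ∀ k l, P k = 0 → P l = 0 → P ⁅k, l⁆ = 0 := by
    intro k l hk hl
    obtain ⟨a, b, rfl⟩ := exists_complexVector k
    obtain ⟨c, e, rfl⟩ := exists_complexVector l
    have h0 : complexVector (0 : E) 0 = 0 := by simp [complexVector]
    rw [hPdef, baseChange_complexVector, ← h0, complexVector_inj] at hk hl
    rw [hPdef, lie_complexVector, baseChange_complexVector, ← h0, complexVector_inj]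
    simp [hker _ _ hk.1 hl.1, hker _ _ hk.1 hl.2, hker _ _ hk.2 hl.1, hker _ _ hk.2 hl.2]
  -- An induction principle for the admissible pairs `(v, v')`: they are generated additively by
  -- `(v, lam i • v)` with `v ∈ g i` and by `(0, k)` with `k` in the kernel. The latter pairs
  -- account for the freedom of the lift `v'`.
  have ind : ∀ Q : ℂ ⊗[ℝ] L → ℂ ⊗[ℝ] L → Prop,
      (∀ i, ∀ v ∈ g i, Q v (lam i • v)) → (∀ k, P k = 0 → Q 0 k) →
      (∀ v v' w w', Q v v' → Q w w' → Q (v + w) (v' + w')) →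
      ∀ v v', P v' = T (P v) → Q v v' := by
    intro Q h1 h2 h3 v v' hv
    have h4 : ∀ x : ℂ ⊗[ℝ] L, ∃ x', P x' = T (P x) ∧ Q x x' := by
      intro x
      have hx : x ∈ ⨆ i, g i := hsum ▸ Submodule.mem_top
      induction hx using Submodule.iSup_induction' with
      | mem i x hx => exact ⟨_, by rw [map_smul, hT i x hx], h1 i x hx⟩
      | zero => exact ⟨0, by simp, h2 0 (map_zero _)⟩
      | add x y _ _ hx hy =>
        obtain ⟨x', hx', qx⟩ := hx
        obtain ⟨y', hy', qy⟩ := hy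
        exact ⟨x' + y', by simp only [map_add, hx', hy'], h3 _ _ _ _ qx qy⟩
    obtain ⟨x', hx', q⟩ := h4 v
    have := h3 _ _ _ _ q (h2 (v' - x') (by rw [map_sub, hv, hx', sub_self]))
    rwa [add_zero, add_sub_cancel] at this
  have l1 : ∀ (c : ℂ) (x y : ℂ ⊗[ℝ] L), ⁅c • x, y⁆ = c • ⁅x, y⁆ := fun c x y => smul_lie c x y
  have l2 : ∀ (c : ℂ) (x y : ℂ ⊗[ℝ] L), ⁅x, c • y⁆ = c • ⁅x, y⁆ := fun c x y => lie_smul c x y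
  have l3 : ∀ x : ℂ ⊗[ℝ] L, ⁅x, (0 : ℂ ⊗[ℝ] L)⁆ = 0 := fun x => lie_zero x
  have self : ∀ i, ∀ v ∈ g i, ∀ w ∈ g i, ⁅v, w⁆ ∈ g i := fun i v hv w hw => by
    have := hlie i i v (Submodule.mem_sup_left hv) w (Submodule.mem_sup_left hw)
    rwa [sup_idem] at this
  have key : ∀ v v', P v' = T (P v) → ∀ w w', P w' = T (P w) →
      P ⁅v', w'⁆ = T (P ⁅v', w⁆ + P ⁅v, w'⁆ - T (P ⁅v, w⁆)) := by
    refine ind _ ?_ ?_ ?_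
    · intro i v hv
      refine ind _ ?_ ?_ ?_
      · intro j w hw
        -- On two eigenvectors the identity is the vanishing of `(N - lam i)(N - lam j)` on the sum
        -- of the two eigenspaces.
        have h1 := hlie i j v (Submodule.mem_sup_left hv) w (Submodule.mem_sup_right hw)
        rw [← hg, ← hg] at h1
        unfold eigenPreimage at h1
        rw [← comap_sup_of_surjective (baseChange_surjective hπ), Submodule.mem_comap] at h1
        have h2 := eq_of_mem_eigenspace_sup h1
        simp only [l1, l2, map_smul]
        rw [smul_smul]
        exact h2
      · intro k hk
        -- The kernel lies in `g i`, so `[v, k] ∈ g i` has eigenvalue `lam i`. This is the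
        -- infinitesimal invariance of `g i` under `𝔨`.
        have h1 := hT i _ (self i v hv k (hle i hk))
        simp only [l1, l3, map_zero, map_smul, h1, sub_zero, zero_add, smul_zero]
      · intro w w' x x' hw hx
        simp only [lie_add, map_add, map_sub] at hw hx ⊢
        rw [hw, hx]
        abel
    · intro k hk
      refine ind _ ?_ ?_ ?_
      · intro j w hw
        have h1 := hT j _ (self j k (hle j hk) w hw)
        simp only [l2, zero_lie, map_zero, map_smul, h1, sub_zero, add_zero, smul_zero]
      · intro l hl
        simp [hker' k l hk hl]
      · intro w w' x x' hw hx
        simp only [lie_add, map_add, map_sub] at hw hx ⊢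
        rw [hw, hx]
        abel
    · intro v v' x x' hv hx w w' hw
      have hv := hv w w' hw
      have hx := hx w w' hw
      simp only [add_lie, map_add, map_sub] at hv hx ⊢
      rw [hv, hx]
      abel
  intro v w v' w' hv hw
  have h1 := key (complexVector v 0) (complexVector v' 0) (by simp [hPdef, hTdef, hv])
    (complexVector w 0) (complexVector w' 0) (by simp [hPdef, hTdef, hw])
  have h2 := congrArg rePart h1
  simp only [hPdef, hTdef, lie_complexVector, lie_zero, zero_lie, sub_zero, add_zero, map_zero,
    baseChange_complexVector, map_add, map_sub, rePart_complexVector] at h2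
  rw [h2, map_sub, map_add]

/-- A decomposition of the complexified Lie algebra is the eigenspace decomposition of a real
semisimple endomorphism. -/
theorem exists_end_of_decomposition (hl : Function.Injective lam)
    (hπ : Function.Surjective π) {g : ι → Submodule ℂ (ℂ ⊗[ℝ] L)}
    (hle : ∀ i, LinearMap.ker (π.baseChange ℂ) ≤ g i)
    (hne : ∀ i, g i ≠ LinearMap.ker (π.baseChange ℂ))
    (hdir : DirectSum.IsInternal fun i => (g i).map (LinearMap.ker (π.baseChange ℂ)).mkQ)
    (hconj : ∀ i, ∃ j, lam j = starRingEnd ℂ (lam i) ∧ ∀ v ∈ g i, conjugation L v ∈ g j) :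
    ∃ N : Module.End ℝ E, N.IsSemisimple ∧
      spectrum ℂ (N.baseChange ℂ : Module.End ℂ (ℂ ⊗[ℝ] E)) = Set.range lam ∧
      ∀ i, eigenPreimage π N (lam i) = g i := by
  have hP := baseChange_surjective (π := π) hπ
  set e : ι → Submodule ℂ (ℂ ⊗[ℝ] E) := fun i => (g i).map (π.baseChange ℂ) with he
  have hcm : ∀ i, (e i).comap (π.baseChange ℂ) = g i := fun i => by
    rw [he, Submodule.comap_map_eq, sup_eq_left]
    exact hle i
  have hint : DirectSum.IsInternal e := by
    rw [← isInternal_map_mkQ_comap_iff hP]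
    simpa only [hcm] using hdir
  obtain ⟨T, hT⟩ := exists_end_of_isInternal hint lam
  have hsup := ((DirectSum.isInternal_submodule_iff_iSupIndep_and_iSup_eq_top _).1 hint).2
  -- Conjugation carries the `i`-th summand into the summand with the conjugate eigenvalue, so `T`
  -- commutes with it and is the complexification of a real operator.
  have hTc : ∀ z, T (conjugation E z) = conjugation E (T z) := by
    intro z
    have hz : z ∈ ⨆ i, e i := hsup ▸ Submodule.mem_top
    induction hz using Submodule.iSup_induction' with
    | mem i z hz =>
      obtain ⟨v, hv, rfl⟩ := hz
      obtain ⟨j, hj, hc⟩ := hconj i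
      rw [hT i _ ⟨v, hv, rfl⟩, conjugation_smul, ← hj]
      refine hT j _ ⟨conjugation L v, hc v hv, ?_⟩
      rw [baseChange_apply_conjugation]
    | zero => simp
    | add x y _ _ hx hy => simp only [map_add, hx, hy]
  obtain ⟨N, rfl⟩ := exists_real_of_commute_conjugation hTc
  have hE := eigenspace_eq_of_isInternal hint hl hT
  have hE' : ⨆ i, eigenspace (N.baseChange ℂ : Module.End ℂ (ℂ ⊗[ℝ] E)) (lam i) = ⊤ := by
    simp only [hE, hsup]
  refine ⟨N, isSemisimple_of_iSup_eigenspace hE', ?_, fun i => ?_⟩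
  · refine spectrum_eq_range_of_iSup_eq_top hE' fun i h => hne i ?_
    rw [hE, ← comap_eq_ker_iff hP, hcm] at h
    exact h
  · unfold eigenPreimage
    rw [hE, hcm]

end Construction

end

/-! ### Transport of the spectral data from the base point to all of `G/K`. -/

section

open Module.End

variable {d m : ℕ} {G : Type*} [TopologicalSpace G] [ChartedSpace (EuclideanSpace ℝ (Fin d)) G]
  [Group G] [LieGroup (𝓡 d) ω G] {K : Subgroup G}
  [ChartedSpace (EuclideanSpace ℝ (Fin m)) (G ⧸ K)] [IsManifold (𝓡 m) ω (G ⧸ K)]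

/-- The endomorphism of the tangent space at `x`, as a linear map on the model space. -/
def linAt {n : ℕ} {M : Type*} [TopologicalSpace M] [ChartedSpace (EuclideanSpace ℝ (Fin n)) M]
    (N : EndField n M) (x : M) : Module.End ℝ (EuclideanSpace ℝ (Fin n)) := (endAt N x).toLinearMap

variable (hP : Manifold.IsSubmersion (𝓡 d) (𝓡 m) ω (fun a : G => (a : G ⧸ K)))
include hP

/-- This and the next lemma identify `𝔤^ℂ → T_o^ℂ(G/K)` with the quotient by `𝔨^ℂ`, so that the
linear algebra above applies to `π = lieProj`. -/
lemma lieProj_surjective : Function.Surjective (lieProj (m := m) d K) :=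
  projDeriv_surjective hP 1

lemma complexLieAlgOf_eq_ker :
    complexLieAlgOf d K = LinearMap.ker ((lieProj (m := m) d K).baseChange ℂ) := by
  have : lieAlgOf (d := d) K = LinearMap.ker (lieProj (m := m) d K) := by
    ext v
    exact mem_lieAlgOf_iff hP v
  unfold complexLieAlgOf
  rw [this]
  exact ker_baseChange (lieProj (m := m) d K)

/-- The differential at the base point of the translation by `a`. -/
def smulEquiv (a : G) : EuclideanSpace ℝ (Fin m) ≃ₗ[ℝ] EuclideanSpace ℝ (Fin m) :=
  LinearEquiv.ofLinearMap (smulDeriv m a ((1 : G) : G ⧸ K)).toLinearMap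
    (smulDeriv m a⁻¹ (a : G ⧸ K)).toLinearMap
    (LinearMap.ext fun u => smulDeriv_smulDeriv_inv_one hP a u)
    (LinearMap.ext fun u => smulDeriv_inv_smulDeriv_one hP a u)

lemma translateProj_apply (a : G) (v : ComplexLieAlg d G) :
    (translateProj d m K a v : ℂ ⊗[ℝ] EuclideanSpace ℝ (Fin m)) =
      (smulEquiv hP a).toLinearMap.baseChange ℂ ((lieProj d K).baseChange ℂ v) := by
  obtain ⟨x, y, rfl⟩ := exists_complexVector v
  rw [baseChange_complexVector, baseChange_complexVector]
  refine (baseChange_complexVector (transDeriv d m K a).toLinearMap x y).trans ?_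
  exact congrArg₂ complexVector (transDeriv_eq hP a x) (transDeriv_eq hP a y)

lemma translateProj_one_apply (v : ComplexLieAlg d G) :
    (translateProj d m K 1 v : ℂ ⊗[ℝ] EuclideanSpace ℝ (Fin m)) =
      (lieProj d K).baseChange ℂ v := by
  obtain ⟨x, y, rfl⟩ := exists_complexVector v
  rw [baseChange_complexVector]
  refine (baseChange_complexVector (transDeriv d m K 1).toLinearMap x y).trans ?_
  exact congrArg₂ complexVector (transDeriv_one x) (transDeriv_one y)

lemma eigenDecomposition_eq {s : ℕ} (lam : Fin s → ℂ) (N : EndField m (G ⧸ K)) (i : Fin s) :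
    eigenDecomposition (d := d) lam N i =
      eigenPreimage (lieProj d K) (linAt N ((1 : G) : G ⧸ K)) (lam i) := by
  ext v
  have e := translateProj_one_apply hP v
  exact iff_of_eq (congrArg
    (fun z => z ∈ eigenspace ((linAt N ((1 : G) : G ⧸ K)).baseChange ℂ :
      Module.End ℂ (ℂ ⊗[ℝ] EuclideanSpace ℝ (Fin m))) (lam i)) e)

section Translate

variable {N : EndField m (G ⧸ K)} {N₀ : EuclideanSpace ℝ (Fin m) →L[ℝ] EuclideanSpace ℝ (Fin m)}
  (h : IsInvariantExtension N N₀)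
include h

lemma IsInvariantExtension.linAt_smulEquiv (a : G) :
    (smulEquiv hP a).toLinearMap ∘ₗ N₀.toLinearMap =
      linAt N (a : G ⧸ K) ∘ₗ (smulEquiv hP a).toLinearMap :=
  LinearMap.ext fun u => (h a u).symm

lemma IsInvariantExtension.linAt_one : linAt N ((1 : G) : G ⧸ K) = N₀.toLinearMap := by
  ext1 u
  have := h 1 u
  rwa [smulDeriv_one, smulDeriv_one] at this

lemma IsInvariantExtension.isSemisimple_iff (a : G) :
    (linAt N (a : G ⧸ K)).IsSemisimple ↔ Module.End.IsSemisimple N₀.toLinearMap :=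
  (LinearEquiv.isSemisimple_iff (f := N₀.toLinearMap) _ (smulEquiv hP a)
    (h.linAt_smulEquiv hP a)).symm

lemma IsInvariantExtension.complexify_smulEquiv (a : G)
    (z : ℂ ⊗[ℝ] EuclideanSpace ℝ (Fin m)) :
    (linAt N (a : G ⧸ K)).baseChange ℂ ((smulEquiv hP a).toLinearMap.baseChange ℂ z) =
      (smulEquiv hP a).toLinearMap.baseChange ℂ (N₀.toLinearMap.baseChange ℂ z) := by
  rw [← LinearMap.comp_apply, ← LinearMap.comp_apply, ← LinearMap.baseChange_comp,
    ← LinearMap.baseChange_comp, h.linAt_smulEquiv hP a]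

lemma IsInvariantExtension.mem_eigenspace_iff (a : G) (μ : ℂ)
    (z : ℂ ⊗[ℝ] EuclideanSpace ℝ (Fin m)) :
    (smulEquiv hP a).toLinearMap.baseChange ℂ z ∈
      eigenspace ((linAt N (a : G ⧸ K)).baseChange ℂ : Module.End ℂ _) μ ↔
    z ∈ eigenspace (N₀.toLinearMap.baseChange ℂ : Module.End ℂ _) μ := by
  rw [Module.End.mem_eigenspace_iff, Module.End.mem_eigenspace_iff,
    h.complexify_smulEquiv hP a, ← map_smul]
  exact ((smulEquiv hP a).baseChange ℝ ℂ _ _).injective.eq_iff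

lemma IsInvariantExtension.eigenspace_eq_map (a : G) (μ : ℂ) :
    eigenspace ((linAt N (a : G ⧸ K)).baseChange ℂ : Module.End ℂ _) μ =
    (eigenspace (N₀.toLinearMap.baseChange ℂ : Module.End ℂ _) μ).map
      ((smulEquiv hP a).toLinearMap.baseChange ℂ) := by
  ext z
  constructor
  · intro hz
    obtain ⟨w, rfl⟩ := ((smulEquiv hP a).baseChange ℝ ℂ _ _).surjective z
    exact ⟨w, (h.mem_eigenspace_iff hP a μ w).1 hz, rfl⟩
  · rintro ⟨w, hw, rfl⟩
    exact (h.mem_eigenspace_iff hP a μ w).2 hw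

lemma IsInvariantExtension.spectrum_eq (a : G) :
    spectrum ℂ ((linAt N (a : G ⧸ K)).baseChange ℂ : Module.End ℂ _) =
    spectrum ℂ (N₀.toLinearMap.baseChange ℂ : Module.End ℂ _) := by
  ext μ
  rw [← hasEigenvalue_iff_mem_spectrum, ← hasEigenvalue_iff_mem_spectrum]
  unfold HasEigenvalue HasUnifEigenvalue
  change eigenspace _ _ ≠ _ ↔ eigenspace _ _ ≠ _
  rw [h.eigenspace_eq_map hP a, Ne, Ne,
    ← Submodule.map_bot ((smulEquiv hP a).toLinearMap.baseChange ℂ)]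
  exact ((Submodule.map_injective_of_injective
    ((smulEquiv hP a).baseChange ℝ ℂ _ _).injective).eq_iff.trans
      (by rw [Submodule.map_bot])).not

end Translate

end

/-! ### The correspondence between tensors and decompositions. -/

section

open Module.End

variable {d m : ℕ} {G : Type*} [TopologicalSpace G] [ChartedSpace (EuclideanSpace ℝ (Fin d)) G]
  [Group G] [LieGroup (𝓡 d) ω G] {K : Subgroup G}

lemma adjoint_adjoint_inv (a : G) (v : GroupLieAlgebra (𝓡 d) G) :
    adjoint d a (adjoint d a⁻¹ v) = v := by
  have hc : ∀ b : G, ContMDiff (𝓡 d) (𝓡 d) ω (fun c : G => b * c * b⁻¹) := fun b =>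
    (contMDiff_const.mul contMDiff_id).mul contMDiff_const
  have h1 : MDifferentiableAt (𝓡 d) (𝓡 d) (fun c : G => a * c * a⁻¹) (a⁻¹ * 1 * a⁻¹⁻¹) :=
    (hc a).mdifferentiableAt (by simp)
  have h2 : MDifferentiableAt (𝓡 d) (𝓡 d) (fun c : G => a⁻¹ * c * a⁻¹⁻¹) 1 :=
    (hc a⁻¹).mdifferentiableAt (by simp)
  have e := mfderiv_comp (1 : G) h1 h2
  have e1 : (fun c : G => a * c * a⁻¹) ∘ (fun c : G => a⁻¹ * c * a⁻¹⁻¹) = id := by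
    funext c
    simp [mul_assoc]
  rw [e1, mfderiv_id] at e
  have e2 : a⁻¹ * 1 * a⁻¹⁻¹ = (1 : G) := by simp
  rw [e2] at e
  exact (congrArg (fun L : EuclideanSpace ℝ (Fin d) →L[ℝ] EuclideanSpace ℝ (Fin d) =>
    L (v : EuclideanSpace ℝ (Fin d))) e).symm

variable [ChartedSpace (EuclideanSpace ℝ (Fin m)) (G ⧸ K)] [IsManifold (𝓡 m) ω (G ⧸ K)]

variable (hP : Manifold.IsSubmersion (𝓡 d) (𝓡 m) ω (fun a : G => (a : G ⧸ K)))
  {s p : ℕ} {lam : Fin s → ℂ}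
include hP

omit hP in
lemma isInternal_map_mkQ_congr {g : Fin s → Submodule ℂ (ComplexLieAlg d G)}
    {k k' : Submodule ℂ (ComplexLieAlg d G)} (hk : k = k')
    (h : DirectSum.IsInternal fun i => (g i).map k.mkQ) :
    DirectSum.IsInternal fun i => (g i).map k'.mkQ := by
  subst hk
  exact h

section Forward

variable {N : EndField m (G ⧸ K)} (h : IsInvariantSemisimpleNijenhuis lam N)
include h

lemma IsInvariantSemisimpleNijenhuis.isSemisimple_linAt :
    (linAt N ((1 : G) : G ⧸ K)).IsSemisimple := h.semisimple _

lemma IsInvariantSemisimpleNijenhuis.spectrum_linAt :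
    spectrum ℂ ((linAt N ((1 : G) : G ⧸ K)).baseChange ℂ :
      Module.End ℂ (ℂ ⊗[ℝ] EuclideanSpace ℝ (Fin m))) = Set.range lam := h.spectrum_eq _

lemma IsInvariantSemisimpleNijenhuis.isAlgNijenhuis :
    IsAlgNijenhuis (lieProj d K) (linAt N ((1 : G) : G ⧸ K)) := by
  obtain ⟨ρ, hρ⟩ := exists_rightInverse_projDeriv hP
  exact isAlgNijenhuis_of_isNijenhuis hP ρ hρ (h.invariant.isInvariantExtension hP) h.nijenhuis

theorem IsInvariantSemisimpleNijenhuis.isNijenhuisDecomposition (hs : 0 < s)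
    (hlam : Function.Injective lam)
    (hpair : ∀ i j : Fin s, (i : ℕ) < p → (j : ℕ) = i + p → lam i = starRingEnd ℂ (lam j))
    (hreal : ∀ j : Fin s, 2 * p ≤ (j : ℕ) → starRingEnd ℂ (lam j) = lam j) :
    IsNijenhuisDecomposition K p (eigenDecomposition (d := d) lam N) := by
  -- With no summands the sum of the preimages would be zero and could not contain `𝔨^ℂ`.
  have : Nonempty (Fin s) := ⟨⟨0, hs⟩⟩
  have e := eigenDecomposition_eq hP lam N
  have hπ := lieProj_surjective hP
  have hN := h.isSemisimple_linAt hP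
  have hsp := h.spectrum_linAt hP
  have hker := complexLieAlgOf_eq_ker hP
  constructor
  · simp only [e]
    exact iSup_eigenPreimage hπ hN hsp
  · intro i j hij
    rw [e, e, hker]
    exact eigenPreimage_inf hlam hij
  · intro i
    rw [e, hker]
    exact eigenPreimage_ne hπ hsp i
  · refine isInternal_map_mkQ_congr hker.symm ?_
    simp only [e]
    exact isInternal_eigenPreimage hπ hN hlam hsp
  · intro i j v hv w hw
    rw [e, e] at *
    exact (h.isAlgNijenhuis hP).lie_mem hπ hN hv hw
  · intro i j hi hj
    rw [e, e]
    exact eigenPreimage_eq_image_conjugation (hpair i j hi hj)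
  · intro j hj
    rw [e]
    exact eigenPreimage_eq_image_conjugation (hreal j hj).symm

theorem IsInvariantSemisimpleNijenhuis.isAdInvariant :
    IsAdInvariant K (eigenDecomposition (d := d) lam N) := by
  have hle : ∀ a ∈ K, ∀ i, (eigenDecomposition (d := d) lam N i).map (LinearMap.baseChange ℂ
      (adjoint d a : GroupLieAlgebra (𝓡 d) G →ₗ[ℝ] GroupLieAlgebra (𝓡 d) G)) ≤
      eigenDecomposition (d := d) lam N i := by
    intro a ha i
    rw [eigenDecomposition_eq hP]
    have hc : ∀ u, linAt N ((1 : G) : G ⧸ K) ((smulEquiv hP a).toLinearMap u) =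
        (smulEquiv hP a).toLinearMap (linAt N ((1 : G) : G ⧸ K) u) :=
      (h.invariant.isInvariantExtension hP).commute_isotropy hP a ha
    have hA : ∀ v, lieProj d K
        ((adjoint d a : GroupLieAlgebra (𝓡 d) G →ₗ[ℝ] GroupLieAlgebra (𝓡 d) G) v) =
        (smulEquiv hP a).toLinearMap (lieProj d K v) := fun v => projDeriv_adjoint hP ha v
    exact map_eigenPreimage_le hA hc (lam i)
  intro a ha i
  -- The reverse inclusion is the same inclusion for `a⁻¹`, since `Ad a` and `Ad a⁻¹` are inverse to
  -- each other.
  refine le_antisymm (hle a ha i) fun v hv => ?_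
  refine ⟨_, hle a⁻¹ (K.inv_mem ha) i ⟨v, hv, rfl⟩, ?_⟩
  obtain ⟨x, y, rfl⟩ := exists_complexVector v
  rw [baseChange_complexVector, baseChange_complexVector]
  exact congrArg₂ complexVector (adjoint_adjoint_inv a x) (adjoint_adjoint_inv a y)

end Forward

/-- The eigenspaces determine a semisimple operator at the base point, and invariance determines the
tensor from there. -/
theorem injOn_eigenDecomposition :
    Set.InjOn (eigenDecomposition (d := d) lam)
      {N : EndField m (G ⧸ K) | IsInvariantSemisimpleNijenhuis lam N} := by
  intro N h N' h' e
  have h0 : linAt N ((1 : G) : G ⧸ K) = linAt N' ((1 : G) : G ⧸ K) := by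
    refine eq_of_eigenPreimage_eq (lieProj_surjective hP)
      (IsInvariantSemisimpleNijenhuis.isSemisimple_linAt hP h)
      (IsInvariantSemisimpleNijenhuis.spectrum_linAt hP h) fun i => ?_
    rw [← eigenDecomposition_eq hP, ← eigenDecomposition_eq hP, e]
  have h1 : endAt N ((1 : G) : G ⧸ K) = endAt N' ((1 : G) : G ⧸ K) :=
    ContinuousLinearMap.ext fun u => congrArg (fun L => L u) h0
  have i := IsInvariantEndField.isInvariantExtension hP (IsInvariantSemisimpleNijenhuis.invariant h)
  have i' := IsInvariantEndField.isInvariantExtension hP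
    (IsInvariantSemisimpleNijenhuis.invariant h')
  rw [← h1] at i'
  exact i.unique hP i'

-- The pairing is given only from `i < p` to `i + p`. Since conjugation is an involution it also
-- applies from `i + p` back to `i`, and the remaining indices are their own partners.
omit hP in
lemma exists_conj_index (hp : 2 * p ≤ s)
    (hpair : ∀ i j : Fin s, (i : ℕ) < p → (j : ℕ) = i + p → lam i = starRingEnd ℂ (lam j))
    (hreal : ∀ j : Fin s, 2 * p ≤ (j : ℕ) → starRingEnd ℂ (lam j) = lam j)
    {g : Fin s → Submodule ℂ (ComplexLieAlg d G)} (h : IsNijenhuisDecomposition K p g)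
    (i : Fin s) : ∃ j, lam j = starRingEnd ℂ (lam i) ∧ ∀ v ∈ g i, conjugation _ v ∈ g j := by
  rcases lt_or_ge (i : ℕ) p with hi | hi
  · have hlt : (i : ℕ) + p < s := by omega
    refine ⟨⟨i + p, hlt⟩, ?_, fun v hv => ?_⟩
    · rw [hpair i ⟨i + p, hlt⟩ hi rfl, Complex.conj_conj]
    · have hv' : v ∈ (g i : Set (ComplexLieAlg d G)) := hv
      rw [h.conj_pair i ⟨i + p, hlt⟩ hi rfl] at hv'
      obtain ⟨w, hw, rfl⟩ := hv'
      rwa [conjugation_conjugation]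
  · rcases lt_or_ge (i : ℕ) (2 * p) with hi' | hi'
    · have hlt : (i : ℕ) - p < s := by omega
      have hj : (⟨i - p, hlt⟩ : Fin s).val < p := by simp only; omega
      have hij : (i : ℕ) = (⟨i - p, hlt⟩ : Fin s).val + p := by simp only; omega
      refine ⟨⟨i - p, hlt⟩, hpair _ _ hj hij, fun v hv => ?_⟩
      have : conjugation _ v ∈ (g ⟨i - p, hlt⟩ : Set (ComplexLieAlg d G)) := by
        rw [h.conj_pair _ i hj hij]
        exact ⟨v, hv, rfl⟩
      exact this
    · refine ⟨i, (hreal i hi').symm, fun v hv => ?_⟩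
      have : conjugation _ v ∈ (g i : Set (ComplexLieAlg d G)) := by
        rw [h.conj_real i hi']
        exact ⟨v, hv, rfl⟩
      exact this

omit hP in
lemma IsNijenhuisDecomposition.complexLieAlgOf_le {g : Fin s → Submodule ℂ (ComplexLieAlg d G)}
    (h : IsNijenhuisDecomposition K p g) (i : Fin s) : complexLieAlgOf d K ≤ g i := by
  -- For a single summand the intersection condition is empty, but then `g i` is everything.
  by_cases hj : ∃ j, i ≠ j
  · obtain ⟨j, hj⟩ := hj
    rw [← h.inter_eq i j hj]
    exact inf_le_left
  · push Not at hj
    have : g i = ⊤ := by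
      rw [← h.sum_eq]
      exact le_antisymm (le_iSup g i) (iSup_le fun j => by rw [hj j])
    rw [this]
    exact le_top

/-- A decomposition of the complexified Lie algebra is induced by a tensor if it is invariant
under `K`, or if `K` is connected. -/
theorem exists_isInvariantSemisimpleNijenhuis (hp : 2 * p ≤ s) (hlam : Function.Injective lam)
    (hpair : ∀ i j : Fin s, (i : ℕ) < p → (j : ℕ) = i + p → lam i = starRingEnd ℂ (lam j))
    (hreal : ∀ j : Fin s, 2 * p ≤ (j : ℕ) → starRingEnd ℂ (lam j) = lam j)
    {g : Fin s → Submodule ℂ (ComplexLieAlg d G)} (h : IsNijenhuisDecomposition K p g)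
    (hK : IsAdInvariant K g ∨ IsConnected (K : Set G)) :
    ∃ N : EndField m (G ⧸ K), IsInvariantSemisimpleNijenhuis lam N ∧
      eigenDecomposition lam N = g := by
  have hπ := lieProj_surjective hP
  have hker := complexLieAlgOf_eq_ker hP
  have hle : ∀ i, LinearMap.ker ((lieProj (m := m) d K).baseChange ℂ) ≤ g i := fun i =>
    hker ▸ h.complexLieAlgOf_le i
  have hne := h.ne
  have hdir := isInternal_map_mkQ_congr hker h.direct
  simp only [hker] at hne
  obtain ⟨T, hT, hsp, hg⟩ := exists_end_of_decomposition hlam hπ hle hne hdir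
    (exists_conj_index hp hpair hreal h)
  have halg : IsAlgNijenhuis (lieProj d K) T :=
    isAlgNijenhuis_of_lie_mem hπ (fun k l hk hl => projDeriv_lieBr_vertical hP hk hl) h.sum_eq hle
      h.lie_mem hg
  set N₀ : EuclideanSpace ℝ (Fin m) →L[ℝ] EuclideanSpace ℝ (Fin m) :=
    LinearMap.toContinuousLinearMap T with hN₀
  -- The only place where the two alternatives differ: isotropy invariance comes either from
  -- `Ad(K)`-invariance of the eigenspaces or from connectedness of `K`.
  have hc : ∀ a ∈ K, ∀ u, N₀ (smulDeriv m a ((1 : G) : G ⧸ K) u) =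
      smulDeriv m a ((1 : G) : G ⧸ K) (N₀ u) := by
    intro a ha
    rcases hK with hK | hK
    · refine commute_of_map_eigenPreimage_le (B := (smulEquiv hP a).toLinearMap) hπ hT hsp
        (A := (adjoint d a : GroupLieAlgebra (𝓡 d) G →ₗ[ℝ] GroupLieAlgebra (𝓡 d) G))
        (fun v => projDeriv_adjoint hP ha v) fun i => ?_
      rw [hg]
      exact (hK a ha i).le
    · exact IsAlgNijenhuis.commute_isotropy hP halg hK a ha
  obtain ⟨N, hN⟩ := exists_isInvariantExtension hP N₀ hc
  obtain ⟨ρ, hρ⟩ := exists_rightInverse_projDeriv hP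
  refine ⟨N, ⟨hN.analytic hP, hN.isInvariantEndField hP, fun x => ?_, fun x => ?_,
    isNijenhuis_of_isAlgNijenhuis hP ρ hρ hN halg⟩, ?_⟩
  · obtain ⟨a, rfl⟩ := QuotientGroup.mk_surjective x
    exact (hN.isSemisimple_iff hP a).2 hT
  · obtain ⟨a, rfl⟩ := QuotientGroup.mk_surjective x
    exact (hN.spectrum_eq hP a).trans hsp
  · funext i
    rw [eigenDecomposition_eq hP, hN.linAt_one hP]
    exact hg i

end

/-! ### Involutivity of the eigendistributions. -/

section Involutive

open Module.End

variable {m : ℕ} {M : Type*} [TopologicalSpace M] [ChartedSpace (EuclideanSpace ℝ (Fin m)) M]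
  [IsManifold (𝓡 m) ω M]

lemma vbr_comb_left {X Y W : VField m M} {x : M} (hX : AnalyticVFieldAt X x)
    (hY : AnalyticVFieldAt Y x) (a b : ℝ) :
    vbr (a • X + b • Y) W x = a • vbr X W x + b • vbr Y W x := by
  have dX := hX.mdifferentiableAt (by simp)
  have dY := hY.mdifferentiableAt (by simp)
  have h1 := mlieBracket_add_left (I := 𝓡 m) (V := a • X) (V₁ := b • Y) (W := W) (x := x)
    (MDifferentiableAt.smul_const_section (a :=
      a) dX) (MDifferentiableAt.smul_const_section (a := b) dY)
  have h2 := mlieBracket_const_smul_left (I := 𝓡 m) (c := a) (W := W) dX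
  have h3 := mlieBracket_const_smul_left (I := 𝓡 m) (c := b) (W := W) dY
  rw [h2, h3] at h1
  exact h1

lemma vbr_comb_right {X Y W : VField m M} {x : M} (hX : AnalyticVFieldAt X x)
    (hY : AnalyticVFieldAt Y x) (a b : ℝ) :
    vbr W (a • X + b • Y) x = a • vbr W X x + b • vbr W Y x := by
  rw [vbr_swap, vbr_comb_left hX hY, vbr_swap X, vbr_swap Y]
  module

lemma vbr_congr {X X' Y Y' : VField m M} {x : M} (hX : ∀ᶠ y in 𝓝 x, X y = X' y)
    (hY : ∀ᶠ y in 𝓝 x, Y y = Y' y) : vbr X Y x = vbr X' Y' x :=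
  Filter.EventuallyEq.mlieBracket_vectorField_eq hX hY

lemma complexVector_mem_eigenDistribution_iff {N : EndField m M} {μ : ℂ} {x : M}
    (u v : EuclideanSpace ℝ (Fin m)) :
    complexVector u v ∈ eigenspace ((linAt N x).baseChange ℂ : Module.End ℂ _) μ ↔
      linAt N x u = μ.re • u + (-μ.im) • v ∧ linAt N x v = μ.re • v + μ.im • u := by
  rw [mem_eigenspace_iff, baseChange_complexVector, smul_complexVector, complexVector_inj,
    neg_smul, ← sub_eq_add_neg]

/-- The eigendistributions of a semisimple Nijenhuis tensor are involutive. -/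
theorem IsNijenhuis.isInvolutive_eigenDistribution {N : EndField m M} (hn : IsNijenhuis N)
    (hN : ∀ x, (linAt N x).IsSemisimple) (μ : ℂ) : IsInvolutive (eigenDistribution N μ) := by
  intro x X Y U V hX hY hU hV hZ hW
  -- Real and imaginary parts of the eigenvector equation. They hold near `x`, so they may be
  -- inserted into brackets at `x`.
  have ev : ∀ {X Y : VField m M}, (∀ᶠ y in 𝓝 x, complexVector (X y) (Y y) ∈
      eigenDistribution N μ y) →
      (∀ᶠ y in 𝓝 x, N.app X y = (μ.re • X + (-μ.im) • Y) y) ∧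
      (∀ᶠ y in 𝓝 x, N.app Y y = (μ.re • Y + μ.im • X) y) := by
    intro X Y h
    have h' := fun y hy => (complexVector_mem_eigenDistribution_iff (N := N) (μ := μ) (x := y)
      (X y) (Y y)).1 hy
    exact ⟨h.mono fun y hy => (h' y hy).1, h.mono fun y hy => (h' y hy).2⟩
  obtain ⟨eX, eY⟩ := ev hZ
  obtain ⟨eU, eV⟩ := ev hW
  have refl : ∀ X : VField m M, ∀ᶠ y in 𝓝 x, X y = X y :=
    fun X => Filter.Eventually.of_forall fun y => rfl
  have tor : ∀ {X U : VField m M}, AnalyticVFieldAt X x → AnalyticVFieldAt U x →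
      vbr (N.app X) (N.app U) x = linAt N x (vbr (N.app X) U x + vbr X (N.app U) x -
        linAt N x (vbr X U x)) := by
    intro X U hX hU
    exact sub_eq_zero.1 (hn x X U hX hU)
  have h1 := tor hX hU
  have h2 := tor hX hV
  have h3 := tor hY hU
  have h4 := tor hY hV
  rw [vbr_congr eX eU, vbr_congr eX (refl U), vbr_congr (refl X) eU] at h1
  rw [vbr_congr eX eV, vbr_congr eX (refl V), vbr_congr (refl X) eV] at h2
  rw [vbr_congr eY eU, vbr_congr eY (refl U), vbr_congr (refl Y) eU] at h3
  rw [vbr_congr eY eV, vbr_congr eY (refl V), vbr_congr (refl Y) eV] at h4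
  simp only [vbr_comb_left hX hY, vbr_comb_left hY hX, vbr_comb_right hU hV,
    vbr_comb_right hV hU] at h1 h2 h3 h4
  have key : complexVector (vbr X U x - vbr Y V x) (vbr X V x + vbr Y U x) ∈
      eigenspace ((linAt N x).baseChange ℂ : Module.End ℂ _) μ := by
    -- The torsion equations amount to `(N - μ)² [Z, W] = 0`. Semisimplicity removes the square,
    -- through `mem_eigenspace_sup` with both eigenvalues equal to `μ`.
    rw [← sup_idem (eigenspace ((linAt N x).baseChange ℂ : Module.End ℂ _) μ)]
    refine mem_eigenspace_sup (IsSemisimple.baseChange (hN x)) ?_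
    have sub : ∀ a b a' b' : EuclideanSpace ℝ (Fin m), complexVector a b - complexVector a' b' =
        complexVector (a - a') (b - b') := by
      intro a b a' b'
      rw [sub_eq_iff_eq_add, complexVector_add, sub_add_cancel, sub_add_cancel]
    simp only [smul_complexVector, complexVector_add, baseChange_complexVector, sub,
      complexVector_inj, Complex.mul_re, Complex.mul_im]
    simp only [map_add, map_sub, map_smul] at h1 h2 h3 h4 ⊢
    constructor
    -- Real and imaginary parts of the complex torsion: `T(X,U) - T(Y,V)` and `T(X,V) + T(Y,U)`.
    · linear_combination (norm := module) h1 - h4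
    · linear_combination (norm := module) h2 + h3
  exact key

end Involutive

/-! ### Eigendistributions as induced analytic subbundles. -/

section

open Module.End

variable {d m : ℕ} {G : Type*} [TopologicalSpace G] [ChartedSpace (EuclideanSpace ℝ (Fin d)) G]
  [Group G] [LieGroup (𝓡 d) ω G] {K : Subgroup G}
  [ChartedSpace (EuclideanSpace ℝ (Fin m)) (G ⧸ K)] [IsManifold (𝓡 m) ω (G ⧸ K)]

variable (hP : Manifold.IsSubmersion (𝓡 d) (𝓡 m) ω (fun a : G => (a : G ⧸ K)))
  {s : ℕ} {lam : Fin s → ℂ}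
include hP

/-- The eigendistributions of an invariant tensor are analytic subbundles. -/
theorem IsInvariantExtension.isAnalyticSubbundle {N : EndField m (G ⧸ K)}
    {N₀ : EuclideanSpace ℝ (Fin m) →L[ℝ] EuclideanSpace ℝ (Fin m)}
    (h : IsInvariantExtension N N₀) (μ : ℂ) : IsAnalyticSubbundle (eigenDistribution N μ) := by
  intro x
  obtain ⟨a, rfl⟩ := QuotientGroup.mk_surjective x
  obtain ⟨σ, sσ, -, hσ⟩ := exists_local_section hP a
  set W := eigenspace (N₀.toLinearMap.baseChange ℂ :
    Module.End ℂ (ℂ ⊗[ℝ] EuclideanSpace ℝ (Fin m))) μ with hW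
  -- A basis of the eigenspace at the base point, translated along a local section, is an analytic
  -- frame.
  set b := Module.finBasis ℂ W with hb
  refine ⟨Module.finrank ℂ W,
    fun k y => smulDeriv m (σ y) ((1 : G) : G ⧸ K) (rePart (b k : ℂ ⊗[ℝ] _)),
    fun k y => smulDeriv m (σ y) ((1 : G) : G ⧸ K) (imPart (b k : ℂ ⊗[ℝ] _)),
    fun k => ⟨analyticVFieldAt_section hP sσ hσ _, analyticVFieldAt_section hP sσ hσ _⟩, ?_⟩
  filter_upwards [hσ] with y hy
  have e : ∀ k, complexVector (smulDeriv m (σ y) ((1 : G) : G ⧸ K) (rePart (b k : ℂ ⊗[ℝ] _)))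
      (smulDeriv m (σ y) ((1 : G) : G ⧸ K) (imPart (b k : ℂ ⊗[ℝ] _))) =
      (smulEquiv hP (σ y)).toLinearMap.baseChange ℂ (b k) := by
    intro k
    conv_rhs => rw [← complexVector_re_im (b k : ℂ ⊗[ℝ] EuclideanSpace ℝ (Fin m)),
      baseChange_complexVector]
    rfl
  have hli : LinearIndependent ℂ fun k =>
      (smulEquiv hP (σ y)).toLinearMap.baseChange ℂ (b k : ℂ ⊗[ℝ] EuclideanSpace ℝ (Fin m)) := by
    have h1 := b.linearIndependent.map' W.subtype (Submodule.ker_subtype W)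
    exact h1.map' ((smulEquiv hP (σ y)).toLinearMap.baseChange ℂ)
      (LinearMap.ker_eq_bot.2 ((smulEquiv hP (σ y)).baseChange ℝ ℂ _ _).injective)
  have hspan : eigenspace ((linAt N y).baseChange ℂ : Module.End ℂ _) μ =
      Submodule.span ℂ (Set.range fun k => (smulEquiv hP (σ y)).toLinearMap.baseChange ℂ
        (b k : ℂ ⊗[ℝ] EuclideanSpace ℝ (Fin m))) := by
    have h1 := h.eigenspace_eq_map hP (σ y) μ
    rw [hy] at h1
    have h2 : Submodule.span ℂ (Set.range fun k => (b k : ℂ ⊗[ℝ] EuclideanSpace ℝ (Fin m))) =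
        W := by
      have h3 : (Set.range fun k => (b k : ℂ ⊗[ℝ] EuclideanSpace ℝ (Fin m))) =
          W.subtype '' Set.range b := by
        rw [← Set.range_comp]
        rfl
      rw [h3, Submodule.span_image, b.span_eq, Submodule.map_top, Submodule.range_subtype]
    have h4 : (Set.range fun k => (smulEquiv hP (σ y)).toLinearMap.baseChange ℂ
        (b k : ℂ ⊗[ℝ] EuclideanSpace ℝ (Fin m))) =
        (smulEquiv hP (σ y)).toLinearMap.baseChange ℂ ''
          (Set.range fun k => (b k : ℂ ⊗[ℝ] EuclideanSpace ℝ (Fin m))) := by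
      rw [← Set.range_comp]
      rfl
    rw [h1, h4, Submodule.span_image, h2]
  simp only [← e] at hli hspan
  exact ⟨hli, hspan⟩

theorem IsInvariantSemisimpleNijenhuis.isInducedDecomposition (hlam : Function.Injective lam)
    {N : EndField m (G ⧸ K)} (h : IsInvariantSemisimpleNijenhuis lam N) :
    IsInducedDecomposition (eigenDecomposition (d := d) lam N)
      (fun i => eigenDistribution N (lam i)) := by
  have hN := h.invariant.isInvariantExtension hP
  refine ⟨fun i a => ?_, fun x => ?_, fun i => hN.isAnalyticSubbundle hP _,
    fun i => h.nijenhuis.isInvolutive_eigenDistribution h.semisimple _⟩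
  · rw [eigenDecomposition_eq hP]
    have h1 := hN.eigenspace_eq_map hP a (lam i)
    have h2 := map_eigenPreimage (N := linAt N ((1 : G) : G ⧸ K)) (lieProj_surjective hP) (lam i)
    -- Projecting at the unit element and then translating by `a` equals translating and then
    -- projecting, so the translated eigenspaces are the induced ones.
    have h3 : ((smulEquiv hP a).toLinearMap.baseChange ℂ).comp ((lieProj d K).baseChange ℂ) =
        (translateProj d m K a : ComplexLieAlg d G →ₗ[ℂ] ℂ ⊗[ℝ] EuclideanSpace ℝ (Fin m)) :=
      LinearMap.ext fun v => (translateProj_apply hP a v).symm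
    have h4 := h1.trans (congrArg (Submodule.map ((smulEquiv hP a).toLinearMap.baseChange ℂ))
      h2.symm)
    rw [← Submodule.map_comp, h3] at h4
    exact h4
  · have h1 := isInternal_eigenspace (N := (linAt N x).baseChange ℂ)
      (IsSemisimple.baseChange (h.semisimple x)) hlam (h.spectrum_eq x)
    exact h1

end

end HomNij

end

/-- `G` is a real (analytic) Lie group, `K` a closed subgroup, and `G/K` carries its structure of
homogeneous manifold, i.e. the unique analytic structure for which `G → G/K` is a submersion. -/
theorem theorem2p5 {d m : ℕ}
    {G : Type*} [TopologicalSpace G] [T2Space G] [ChartedSpace (EuclideanSpace ℝ (Fin d)) G]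
    [Group G] [LieGroup (𝓡 d) ω G]
    (K : Subgroup G) (hK : IsClosed (K : Set G))
    [ChartedSpace (EuclideanSpace ℝ (Fin m)) (G ⧸ K)] [IsManifold (𝓡 m) ω (G ⧸ K)]
    (hP : Manifold.IsSubmersion (𝓡 d) (𝓡 m) ω (fun a : G => (a : G ⧸ K)))
    {s p : ℕ} (hs : 0 < s) (hp : 2 * p ≤ s)
    (lam : Fin s → ℂ) (hlam : Function.Injective lam)
    (hpair : ∀ i j : Fin s, (i : ℕ) < p → (j : ℕ) = i + p → lam i = starRingEnd ℂ (lam j))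
    (hreal : ∀ j : Fin s, 2 * p ≤ (j : ℕ) → starRingEnd ℂ (lam j) = lam j) :
    -- the correspondence `(i) ↔ (ii)`, for arbitrary `K`
    Set.BijOn (HomNij.eigenDecomposition lam)
      {N : HomNij.EndField m (G ⧸ K) | HomNij.IsInvariantSemisimpleNijenhuis lam N}
      {g : Fin s → Submodule ℂ (HomNij.ComplexLieAlg d G) |
        HomNij.IsNijenhuisDecomposition K p g ∧ HomNij.IsAdInvariant K g} ∧
    -- if `K` is connected, the condition of `Ad(K)`-invariance can be dropped
    (IsConnected (K : Set G) →
      Set.BijOn (HomNij.eigenDecomposition lam)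
        {N : HomNij.EndField m (G ⧸ K) | HomNij.IsInvariantSemisimpleNijenhuis lam N}
        {g : Fin s → Submodule ℂ (HomNij.ComplexLieAlg d G) |
          HomNij.IsNijenhuisDecomposition K p g}) ∧
    -- from `(ii)` to `(i)`: the induced decomposition of `T^ℂ(G/K)`, and `N = lam i` on `D i`
    (∀ g : Fin s → Submodule ℂ (HomNij.ComplexLieAlg d G),
      HomNij.IsNijenhuisDecomposition K p g → HomNij.IsAdInvariant K g →
      ∃ D : Fin s → HomNij.ComplexDistribution m (G ⧸ K),
        HomNij.IsInducedDecomposition g D ∧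
        ∃ N : HomNij.EndField m (G ⧸ K), HomNij.IsInvariantSemisimpleNijenhuis lam N ∧
          HomNij.eigenDecomposition lam N = g ∧
          ∀ i x, ∀ v ∈ D i x, N.complexify x v = lam i • v) ∧
    -- from `(i)` to `(ii)`: the decomposition constructed from `N` corresponds to the
    -- decomposition of `T^ℂ(G/K)` into the eigendistributions of `N`
    (∀ N : HomNij.EndField m (G ⧸ K), HomNij.IsInvariantSemisimpleNijenhuis lam N →
      HomNij.IsInducedDecomposition (HomNij.eigenDecomposition (d := d) lam N)
        (fun i => HomNij.eigenDistribution N (lam i))) := by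
  have dec := fun (N : HomNij.EndField m (G ⧸ K))
    (h : HomNij.IsInvariantSemisimpleNijenhuis lam N) =>
    HomNij.IsInvariantSemisimpleNijenhuis.isNijenhuisDecomposition hP h hs hlam hpair hreal
  have ex := fun (g : Fin s → Submodule ℂ (HomNij.ComplexLieAlg d G)) hg hg' =>
    HomNij.exists_isInvariantSemisimpleNijenhuis (g := g) hP hp hlam hpair hreal hg hg'
  have inj := HomNij.injOn_eigenDecomposition (lam := lam) hP
  have ind := fun (N : HomNij.EndField m (G ⧸ K))
    (h : HomNij.IsInvariantSemisimpleNijenhuis lam N) =>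
    HomNij.IsInvariantSemisimpleNijenhuis.isInducedDecomposition hP hlam h
  refine ⟨⟨fun N h => ⟨dec N h, h.isAdInvariant hP⟩, inj, fun g hg => ex g hg.1 (Or.inl hg.2)⟩,
    fun hc => ⟨fun N h => dec N h, inj, fun g hg => ex g hg (Or.inr hc)⟩, fun g hg hA => ?_, ind⟩
  -- By surjectivity `g` may be replaced by the decomposition of a tensor `N`, and its
  -- eigendistributions serve as `D`.
  obtain ⟨N, hN, rfl⟩ := ex g hg (Or.inl hA)
  exact ⟨_, ind N hN, N, hN, rfl, fun i x v hv => Module.End.mem_eigenspace_iff.1 hv⟩
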